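/- Let $R>0$, $m\ge 0$, and let $B_R\subset\mathbb R^3$ be the open ball of radius $R$ centered at the origin, with outward unit normal $\nu$. For $\tau\in\mathbb R$ let $\mathcal H_\tau$ be the operator in $L^2(B_R)^4$ with domain $$\mathrm{Dom}(\mathcal H_\tau)=\{\varphi\in H^1(B_R)^4:\ \varphi=i(\sinh\tau-\cosh\tau\,\beta)(\alpha\cdot\nu)\varphi\ \text{ on }\partial B_R\}$$ (in the sense of traces) and action $\mathcal H_\tau\varphi=(-i\alpha\cdot\nabla+m\beta)\varphi$, where $\alpha_k=\begin{pmatrix}0&\sigma_k\\ \sigma_k&0\end{pmatrix}$, $\beta=\begin{pmatrix}I_2&0\\0&-I_2\end{pmatrix}$ and $\sigma_1=\begin{pmatrix}0&1\\1&0\end{pmatrix}$, $\sigma_2=\begin{pmatrix}0&-i\\i&0\end{pmatrix}$, $\sigma_3=\begin{pmatrix}1&0\\0&-1\end{pmatrix}$ are the Pauli matrices. Let $J_p$ be the Bessel function of the first kind of order $p$ and $z_{p,k}$ its $k$-th positive zero ($k\ge1$). Let $Y_n^q$ be the orthonormal spherical harmonics on $\mathbb S^2$ of degree $n$ and order $q$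 (with the Condon–Shortley phase). For $j\in\{1/2,3/2,\dots\}$ and $\mu\in\{-j,-j+1,\dots,j\}$ put $$\psi_{j-1/2}^{\mu}=\frac1{\sqrt{2j}}\begin{pmatrix}\sqrt{j+\mu}\,Y_{j-1/2}^{\mu-1/2}\\ \sqrt{j-\mu}\,Y_{j-1/2}^{\mu+1/2}\end{pmatrix},\qquad \psi_{j+1/2}^{\mu}=\frac1{\sqrt{2j+2}}\begin{pmatrix}\sqrt{j+1-\mu}\,Y_{j+1/2}^{\mu-1/2}\\ -\sqrt{j+1+\mu}\,Y_{j+1/2}^{\mu+1/2}\end{pmatrix},$$ and let $L^\pm_{j,\mu}$ be the space of all $\varphi\in L^2(B_R)^4$ of the form $\varphi(r\theta)=\begin{pmatrix} i\tilde f(r)\psi^{\mu}_{j\pm1/2}(\theta)\\ \tilde g(r)\psi^{\mu}_{j\mp1/2}(\theta)\end{pmatrix}$ with $\tilde f,\tilde g\in L^2((0,R),r^2dr)$, where $x=r\theta$ with $r=|x|$ and $\theta\in\mathbb S^2$. Write $e_{p,k}=\sqrt{(z_{p,k}/R)^2+m^2}$ and define the intervals - $I^-_{j,0}=(m,e_{j,1})$;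 $I^-_{j,k}=(e_{j+1,k},e_{j,k+1})$ for $k\ge1$; $I^-_{j,k}=(-e_{j+1,|k|},-e_{j,|k|})$ for $k\le-1$; - $I^+_{j,0}=(-e_{j,1},-m)$; $I^+_{j,k}=(-e_{j,k+1},-e_{j+1,k})$ for $k\ge1$; $I^+_{j,k}=(e_{j,|k|},e_{j+1,|k|})$ for $k\le-1$. Then for every $j\in\{1/2,3/2,\dots\}$ there exist two infinite families of pairwise distinct functions $\uplambda^+_{j,k}$ and $\uplambda^-_{j,k}$, $k\in\mathbb Z$, from $\mathbb R$ to $\mathbb R$, each of which is $C^\infty$, strictly increasing and maps $\mathbb R$ onto $I^\pm_{j,k}$, such that for every $\tau\in\mathbb R$ the number $\uplambda^\pm_{j,k}(\tau)$ is an eigenvalue of $\mathcal H_\tau$. Moreover, for these functions, for every choice of sign, every $k\in\mathbb Z$, every $\tau\in\mathbb R$ and every $\mu\in\{-j,-j+1,\dots,j\}$, writing $\lambda=\uplambda^\pm_{j,k}(\tau)$, $\ell=j\pm1/2$ and $\ell'=j\mp1/2$, the function $$\varphi_\tau(r\theta)=\frac1{\sqrt r}\begin{pmatrix} i\,J_{\ell+1/2}\big(\sqrt{\lambda^2-m^2}\,r\big)\,\psi^{\mu}_{j\pm1/2}(\theta)\\[3pt]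 \pm\dfrac{\sqrt{\lambda^2-m^2}}{\lambda+m}\,J_{\ell'+1/2}\big(\sqrt{\lambda^2-m^2}\,r\big)\,\psi^{\mu}_{j\mp1/2}(\theta)\end{pmatrix}$$ belongs to $L^\pm_{j,\mu}$ and is an eigenfunction of $\mathcal H_\tau$ with eigenvalue $\uplambda^\pm_{j,k}(\tau)$. -/

import Mathlib

open MeasureTheory Filter Topology
open scoped ENNReal ContDiff

noncomputable section

namespace DiracBall

/-! ### Points, spinors and Dirac matrices -/

/-- Euclidean three-space. -/
abbrev E3 := EuclideanSpace ℝ (Fin 3)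

/-- The index set of the four components of a spinor: `Sum.inl` for the upper two components `u`,
`Sum.inr` for the lower two components `v`. -/
abbrev SpinorIdx := Fin 2 ⊕ Fin 2

/-- The space `ℂ⁴`. Its elements are only ever used componentwise. -/
abbrev Spinor := SpinorIdx → ℂ

/-- The Pauli matrices `σ₁, σ₂, σ₃`. -/
def pauli : Fin 3 → Matrix (Fin 2) (Fin 2) ℂ :=
  ![!![0, 1; 1, 0], !![0, -Complex.I; Complex.I, 0], !![1, 0; 0, -1]]

/-- The Dirac matrices `α₁, α₂, α₃`. -/
def alphaMat (k : Fin 3) : Matrix SpinorIdx SpinorIdx ℂ :=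
  Matrix.fromBlocks 0 (pauli k) (pauli k) 0

/-- The Dirac matrix `β`. -/
def betaMat : Matrix SpinorIdx SpinorIdx ℂ :=
  Matrix.fromBlocks 1 0 0 (-1)

/-- `α · X = α₁ X₁ + α₂ X₂ + α₃ X₃`. -/
def alphaDot (X : E3) : Matrix SpinorIdx SpinorIdx ℂ :=
  ∑ k : Fin 3, (X k : ℂ) • alphaMat k

/-! ### Weak derivatives, `H¹`, and traces -/

/-- The `i`-th standard basis vector of `ℝ³`. -/
def basisVec (i : Fin 3) : E3 := EuclideanSpace.single i 1

/-- `g` is the weak `i`-th partial derivative of `u` in the open set `Ω`. -/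
def HasWeakPartial (Ω : Set E3) (i : Fin 3) (u g : E3 → ℂ) : Prop :=
  ∀ η : E3 → ℝ, ContDiff ℝ ∞ η → HasCompactSupport η → tsupport η ⊆ Ω →
    ∫ x in Ω, u x * ((fderiv ℝ η x (basisVec i) : ℝ) : ℂ) = -∫ x in Ω, g x * ((η x : ℝ) : ℂ)

/-- `u ∈ H¹(Ω)` with weak gradient `G`: the function and its first weak partial derivatives
are square integrable in `Ω`. -/
structure IsH1With (Ω : Set E3) (u : E3 → ℂ) (G : Fin 3 → E3 → ℂ) : Prop where
  memLp : MemLp u 2 (volume.restrict Ω)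
  memLp_grad : ∀ i, MemLp (G i) 2 (volume.restrict Ω)
  weak : ∀ i, HasWeakPartial Ω i u (G i)

/-- The Sobolev space `H¹(Ω)`. -/
def MemH1 (Ω : Set E3) (u : E3 → ℂ) : Prop := ∃ G, IsH1With Ω u G

/-- The ball `B_R` centred at the origin. -/
def ballR (R : ℝ) : Set E3 := Metric.ball 0 R

/-- Surface measure on `∂B_R`, as a measure on `ℝ³` carried by the sphere of radius `R`. -/
def surfaceMeasure (R : ℝ) : Measure E3 :=
  ENNReal.ofReal (R ^ 2) •
    Measure.map (fun θ : Metric.sphere (0 : E3) 1 => R • (θ : E3)) (volume : Measure E3).toSphere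

/-- `T` is the trace on `∂B_R` of `u ∈ H¹(B_R)`: some sequence of smooth functions on the closed
ball (restrictions of smooth functions on `ℝ³`) converges to `u` in `H¹(B_R)`, and its boundary
values converge to `T` in `L²(∂B_R)`. -/
def HasTrace (R : ℝ) (u T : E3 → ℂ) : Prop :=
  MemLp T 2 (surfaceMeasure R) ∧
  ∃ G, IsH1With (ballR R) u G ∧
  ∃ w : ℕ → E3 → ℂ, (∀ n, ContDiff ℝ ∞ (w n)) ∧
    Tendsto (fun n => eLpNorm (w n - u) 2 (volume.restrict (ballR R))) atTop (𝓝 0) ∧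
    (∀ i, Tendsto (fun n => eLpNorm (fun x => fderiv ℝ (w n) x (basisVec i) - G i x) 2
      (volume.restrict (ballR R))) atTop (𝓝 0)) ∧
    Tendsto (fun n => eLpNorm (w n - T) 2 (surfaceMeasure R)) atTop (𝓝 0)

/-! ### The operators `H_τ` on the ball -/

/-- The outward unit normal `ν` at a point of `∂B_R`. -/
def outwardNormal (R : ℝ) (x : E3) : E3 := R⁻¹ • x

/-- The domain of `H_τ`: spinors in `H¹(B_R)⁴` whose trace satisfies
`φ = i (sinh τ - cosh τ β) (α · ν) φ` on `∂B_R`. -/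
def diracDomain (R τ : ℝ) : Set (E3 → Spinor) :=
  {φ | (∀ a, MemH1 (ballR R) (fun x => φ x a)) ∧
    ∃ T : E3 → Spinor, (∀ a, HasTrace R (fun x => φ x a) (fun x => T x a)) ∧
      ∀ᵐ x ∂(surfaceMeasure R),
        T x = Complex.I •
          ((((Real.sinh τ : ℝ) : ℂ) • (1 : Matrix SpinorIdx SpinorIdx ℂ)
              - ((Real.cosh τ : ℝ) : ℂ) • betaMat) * alphaDot (outwardNormal R x)).mulVec (T x)}

/-- `ψ = (-i α · ∇ + m β) φ` almost everywhere in `B_R`, with the weak gradient of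
`φ ∈ H¹(B_R)⁴`. -/
def IsDiracImage (R m : ℝ) (φ ψ : E3 → Spinor) : Prop :=
  ∃ G : Fin 3 → E3 → Spinor,
    (∀ a, IsH1With (ballR R) (fun x => φ x a) (fun i x => G i x a)) ∧
    ∀ᵐ x ∂(volume.restrict (ballR R)),
      ψ x = (-Complex.I) • (∑ k : Fin 3, (alphaMat k).mulVec (G k x))
        + (m : ℂ) • betaMat.mulVec (φ x)

/-- `φ` is an eigenfunction of `H_τ` with eigenvalue `lam`: it lies in the domain, is nonzero as
an element of `L²(B_R)⁴`, and `H_τ φ = lam φ`. -/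
structure IsEigenfunction (R m τ : ℝ) (lam : ℂ) (φ : E3 → Spinor) : Prop where
  mem_domain : φ ∈ diracDomain R τ
  ne_zero : ¬ ∀ᵐ x ∂(volume.restrict (ballR R)), φ x = 0
  eigen : IsDiracImage R m φ (fun x => lam • φ x)

/-- `lam` is an eigenvalue of `H_τ`. -/
def IsEigenvalue (R m τ : ℝ) (lam : ℂ) : Prop := ∃ φ, IsEigenfunction R m τ lam φ

/-! ### Bessel functions and their zeroes -/

/-- The Bessel function of the first kind `J_p(x)` of order `p`, for `x ≥ 0`. -/
def besselJ (p x : ℝ) : ℝ :=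
  (x / 2) ^ p *
    ∑' n : ℕ, (-1) ^ n / ((n.factorial : ℝ) * Real.Gamma (n + p + 1)) * (x / 2) ^ (2 * n)

/-- For `k ≥ 1`, `besselZero p k` is the `k`-th positive zero of `J_p`: the smallest zero beyond
the previous one, the recursion being started at `0`. -/
def besselZero (p : ℝ) : ℕ → ℝ
  | 0 => 0
  | k + 1 => sInf {x | besselZero p k < x ∧ besselJ p x = 0}

/-! ### Spherical harmonics and spherical harmonic spinors -/

/-- The Legendre polynomial `P_n`, by the Rodrigues formula. -/
def legendreP (n : ℕ) : Polynomial ℝ :=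
  Polynomial.C (1 / (2 ^ n * (n.factorial : ℝ))) *
    (Polynomial.derivative^[n] ((Polynomial.X ^ 2 - 1) ^ n))

/-- The spherical harmonic `Y_n^q` for `0 ≤ q`, at a unit vector `θ`, with the Condon-Shortley
phase; `(θ₁ + i θ₂)^q P_n^{(q)}(θ₃)` is the associated Legendre function of the polar angle times
the `q`-th azimuthal mode. It vanishes for `q > n`. -/
def sphHarmNonneg (n q : ℕ) (θ : E3) : ℂ :=
  (-1) ^ q *
    ((Real.sqrt ((2 * n + 1) / (4 * Real.pi) *
        (((n - q).factorial : ℝ) / ((n + q).factorial : ℝ))) : ℝ) : ℂ) *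
    (((Polynomial.derivative^[q] (legendreP n)).eval (θ 2) : ℝ) : ℂ) *
    ((θ 0 : ℂ) + Complex.I * (θ 1 : ℂ)) ^ q

/-- The spherical harmonic `Y_n^q` at a unit vector `θ`, for every integer `q`, where
`Y_n^{-q} = (-1)^q conj (Y_n^q)`. -/
def sphHarm (n : ℕ) (q : ℤ) (θ : E3) : ℂ :=
  if 0 ≤ q then sphHarmNonneg n q.natAbs θ
  else (-1) ^ q.natAbs * (starRingEnd ℂ) (sphHarmNonneg n q.natAbs θ)

/-- The superscript `±`. -/
inductive Branch where
  | plus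
  | minus

/-- The sign `±1` of a branch. -/
def Branch.sgn : Branch → ℝ
  | .plus => 1
  | .minus => -1

/-- The opposite branch, which turns `±` into `∓`. -/
def Branch.opp : Branch → Branch
  | .plus => .minus
  | .minus => .plus

/-- The half-integer `j = n + 1/2`, for `n = 0, 1, 2, …`. -/
def jOf (n : ℕ) : ℝ := n + 1 / 2

/-- The half-integer `μ = M + 1/2`; it runs over `-j, …, j` when `-(n+1) ≤ M ≤ n`. -/
def muOf (M : ℤ) : ℝ := M + 1 / 2

/-- The spherical harmonic spinor `ψ_{j ± 1/2}^μ`, with `j = n + 1/2` and `μ = M + 1/2`, so that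
`j - 1/2 = n`, `j + 1/2 = n + 1`, `μ - 1/2 = M`, `μ + 1/2 = M + 1`. -/
def sphSpinor (s : Branch) (n : ℕ) (M : ℤ) (θ : E3) : Fin 2 → ℂ :=
  match s with
  | .minus =>
    ((1 / Real.sqrt (2 * jOf n) : ℝ) : ℂ) •
      ![((Real.sqrt (jOf n + muOf M) : ℝ) : ℂ) * sphHarm n M θ,
        ((Real.sqrt (jOf n - muOf M) : ℝ) : ℂ) * sphHarm n (M + 1) θ]
  | .plus =>
    ((1 / Real.sqrt (2 * jOf n + 2) : ℝ) : ℂ) •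
      ![((Real.sqrt (jOf n + 1 - muOf M) : ℝ) : ℂ) * sphHarm (n + 1) M θ,
        -((Real.sqrt (jOf n + 1 + muOf M) : ℝ) : ℂ) * sphHarm (n + 1) (M + 1) θ]

/-- The direction `θ = x / |x|`. -/
def dir (x : E3) : E3 := ‖x‖⁻¹ • x

/-- The spinor field with upper part `i f(r) ψ_{j ± 1/2}^μ(θ)` and lower part
`g(r) ψ_{j ∓ 1/2}^μ(θ)`, in polar coordinates `x = r θ`. -/
def separatedSpinor (s : Branch) (n : ℕ) (M : ℤ) (f g : ℝ → ℂ) (x : E3) : Spinor :=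
  Sum.elim ((Complex.I * f ‖x‖) • sphSpinor s n M (dir x))
    (g ‖x‖ • sphSpinor s.opp n M (dir x))

/-- The measure `r² dr` on `(0, R)`. -/
def radialMeasure (R : ℝ) : Measure ℝ :=
  (volume.restrict (Set.Ioo 0 R)).withDensity (fun r => ENNReal.ofReal (r ^ 2))

/-- The subspace `L^±_{j,μ}` of `L²(B_R)⁴`. -/
def partialWaveSpace (R : ℝ) (s : Branch) (n : ℕ) (M : ℤ) : Set (E3 → Spinor) :=
  {φ | (∀ a, MemLp (fun x => φ x a) 2 (volume.restrict (ballR R))) ∧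
    ∃ f g : ℝ → ℂ, MemLp f 2 (radialMeasure R) ∧ MemLp g 2 (radialMeasure R) ∧
      ∀ᵐ x ∂(volume.restrict (ballR R)), φ x = separatedSpinor s n M f g x}

/-! ### The intervals and the explicit eigenfunctions -/

/-- `√((z_{p,k} / R)² + m²)`. -/
def edge (R m p : ℝ) (k : ℕ) : ℝ := Real.sqrt ((besselZero p k / R) ^ 2 + m ^ 2)

/-- The interval `I_{j,k}^±`, with `j = n + 1/2`; the third case of each branch is
`k = -(q + 1)`, that is `|k| = q + 1`. -/
def curveInterval (R m : ℝ) (s : Branch) (n : ℕ) (k : ℤ) : Set ℝ :=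
  match s, k with
  | .minus, .ofNat 0 => Set.Ioo m (edge R m (jOf n) 1)
  | .minus, .ofNat (q + 1) =>
      Set.Ioo (edge R m (jOf n + 1) (q + 1)) (edge R m (jOf n) (q + 2))
  | .minus, .negSucc q =>
      Set.Ioo (-edge R m (jOf n + 1) (q + 1)) (-edge R m (jOf n) (q + 1))
  | .plus, .ofNat 0 => Set.Ioo (-edge R m (jOf n) 1) (-m)
  | .plus, .ofNat (q + 1) =>
      Set.Ioo (-edge R m (jOf n) (q + 2)) (-edge R m (jOf n + 1) (q + 1))
  | .plus, .negSucc q =>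
      Set.Ioo (edge R m (jOf n) (q + 1)) (edge R m (jOf n + 1) (q + 1))

/-- `ℓ = j ± 1/2`; the companion `ℓ' = j ∓ 1/2` is obtained from the opposite branch. -/
def ellOf (s : Branch) (n : ℕ) : ℝ := jOf n + s.sgn / 2

/-- The explicit spinor field attached to `±`, `j = n + 1/2`, `μ = M + 1/2` and the real number
`lam`. -/
def explicitSpinor (m : ℝ) (s : Branch) (n : ℕ) (M : ℤ) (lam : ℝ) : E3 → Spinor :=
  separatedSpinor s n M
    (fun r => ((1 / Real.sqrt r *
      besselJ (ellOf s n + 1 / 2) (Real.sqrt (lam ^ 2 - m ^ 2) * r) : ℝ) : ℂ))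
    (fun r => ((1 / Real.sqrt r *
      (s.sgn * (Real.sqrt (lam ^ 2 - m ^ 2) / (lam + m)) *
        besselJ (ellOf s.opp n + 1 / 2) (Real.sqrt (lam ^ 2 - m ^ 2) * r)) : ℝ) : ℂ))

end DiracBall

end

open DiracBall

/-! Write w = √(λ² - m²) and j = n + 1/2. The proof has an analytic half, which produces the curves,
and an algebraic half, which shows that the explicit spinors are eigenfunctions along them.

Analytic half. The boundary condition amounts to v = i e^τ (σ · ν) u, with u and v the upper and
lower two-spinors. For the explicit spinors of the minus branch this is the scalar equation w/(λ +
m) · J_{n+3/2}(Rw)/J_{n+1/2}(Rw) = e^τ. Dividing both Bessel functions by (x/2)^(n+1/2) leaves a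
pair of entire functions α, β without common real zero. Hence α + iβ = A e^{iθ} with A > 0 and a
smooth Prüfer angle θ. A Wronskian argument shows that θ increases strictly on [0, ∞), from 0 to ∞
(`strictMonoOn_besselPhase`, `tendsto_besselPhase`). So the zeros of J_{n+1/2} are the points where
θ = kπ + π/2 and those of J_{n+3/2} the points where θ = kπ + π, k ≥ 0. The intervals of the minus
branch are therefore the bands in which θ(Rw) runs through one quadrant and λ has the sign that
makes `dispersion` = w/(λ + m) · tan θ(Rw) positive. There this function has positive derivative and
limits 0 and ∞ at the left and right ends, so solving for the value e^τ gives a smooth increasing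
curve onto the interval (`exists_minus_curve`). The substitution (λ, τ) ↦ (-λ, -τ) exchanges the two
boundary relations and yields the plus branch (`exists_curves`).

Algebraic half. The spinors ψ_{j∓1/2} are the restrictions to the sphere of P and (σ · x) P, where P
is homogeneous of degree n and σ · ∇ P = 0 (`exists_monogenic`). The explicit spinors are then, off
the origin, constant multiples of the smooth fields Φ_{n+1/2}(κ|x|²) P and Φ_{n+3/2}(κ|x|²) (σ · x)
P, with κ = w²/4. The operator σ · ∇ exchanges these two up to constants
(`IsMonogenic.sigmaGrad_lowerWave`, `IsMonogenic.sigmaGrad_upperWave`), which is the Dirac equation.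
Smoothness up to the boundary makes weak derivatives and traces classical
(`isEigenfunction_of_smooth`). -/

namespace DiracBall

/-! ### The entire factor of a Bessel function -/

/-- The `k`-th Taylor coefficient of `besselPhi p`. -/
noncomputable def besselCoeff (p : ℝ) (k : ℕ) : ℝ :=
  (-1) ^ k / ((k.factorial : ℝ) * Real.Gamma (k + p + 1))

/-- The entire function `Φ_p` with `J_p(x) = (x / 2) ^ p Φ_p((x / 2) ^ 2)`. -/
noncomputable def besselPhi (p t : ℝ) : ℝ := ∑' k : ℕ, besselCoeff p k * t ^ k

theorem besselJ_eq_besselPhi (p x : ℝ) :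
    besselJ p x = (x / 2) ^ p * besselPhi p ((x / 2) ^ 2) := by
  simp only [besselJ, besselPhi, besselCoeff, ← pow_mul]

theorem Gamma_add_one_le_Gamma_nat_add {p : ℝ} (hp : 0 ≤ p) (k : ℕ) :
    Real.Gamma (p + 1) ≤ Real.Gamma (k + p + 1) := by
  induction k with
  | zero => simp
  | succ k ih =>
    have h0 : (0 : ℝ) < k + p + 1 := by positivity
    have h : ((k + 1 : ℕ) : ℝ) + p + 1 = (k + p + 1) + 1 := by push_cast; ring
    rw [h, Real.Gamma_add_one h0.ne']
    have h1 := Real.Gamma_pos_of_pos h0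
    have h2 : (0 : ℝ) ≤ k := Nat.cast_nonneg k
    nlinarith

theorem abs_besselCoeff_le {p : ℝ} (hp : 0 ≤ p) (k : ℕ) :
    |besselCoeff p k| ≤ (Real.Gamma (p + 1))⁻¹ / k.factorial := by
  have h0 : 0 < Real.Gamma (p + 1) := Real.Gamma_pos_of_pos (by positivity)
  have h1 := Gamma_add_one_le_Gamma_nat_add hp k
  have h2 : (0 : ℝ) < k.factorial := by positivity
  rw [besselCoeff, abs_div, abs_pow, abs_neg, abs_one, one_pow, abs_of_pos (by positivity),
    inv_eq_one_div, div_div, mul_comm (k.factorial : ℝ)]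
  gcongr

theorem summable_besselCoeff {p : ℝ} (hp : 0 ≤ p) (t : ℝ) :
    Summable fun k : ℕ => besselCoeff p k * t ^ k := by
  refine Summable.of_norm_bounded
    ((Real.summable_pow_div_factorial |t|).mul_left (Real.Gamma (p + 1))⁻¹) fun k => ?_
  rw [Real.norm_eq_abs, abs_mul, abs_pow]
  calc |besselCoeff p k| * |t| ^ k ≤ (Real.Gamma (p + 1))⁻¹ / k.factorial * |t| ^ k := by
        gcongr; exact abs_besselCoeff_le hp k
    _ = _ := by ring

theorem besselCoeff_succ_mul (p : ℝ) (k : ℕ) :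
    besselCoeff p (k + 1) * (k + 1) = -besselCoeff (p + 1) k := by
  have h : ((k + 1 : ℕ) : ℝ) + p + 1 = k + (p + 1) + 1 := by push_cast; ring
  rw [besselCoeff, besselCoeff, h, Nat.factorial_succ, pow_succ]
  -- At a pole of Γ, where `Real.Gamma` takes the value 0, both sides vanish.
  by_cases hG : Real.Gamma (k + (p + 1) + 1) = 0
  · simp [hG]
  have : ((k : ℝ) + 1) ≠ 0 := by positivity
  have : (k.factorial : ℝ) ≠ 0 := by positivity
  push_cast
  field_simp

/-- Termwise differentiation: the coefficient identity `besselCoeff_succ_mul` turns the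
differentiated series into that of order p + 1. This is the classical formula for the derivative of
x^(-p) J_p(x). -/
theorem hasDerivAt_besselPhi {p : ℝ} (hp : 0 ≤ p) (t : ℝ) :
    HasDerivAt (besselPhi p) (-besselPhi (p + 1) t) t := by
  -- A ball around 0 that contains t; on it the k-th differentiated term is dominated by a constant
  -- times B^(k-1)/(k-1)!.
  set B : ℝ := |t| + 1
  have hB : 0 ≤ B := by positivity
  set u : ℕ → ℝ := fun k => (Real.Gamma (p + 1))⁻¹ / k.factorial * (k * B ^ (k - 1))
  have hG : 0 < Real.Gamma (p + 1) := Real.Gamma_pos_of_pos (by positivity)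
  have hu : Summable u := by
    rw [← summable_nat_add_iff 1]
    refine ((Real.summable_pow_div_factorial B).mul_left (Real.Gamma (p + 1))⁻¹).congr fun k => ?_
    simp only [u, Nat.factorial_succ, Nat.add_sub_cancel]
    have : ((k : ℝ) + 1) ≠ 0 := by positivity
    have : (k.factorial : ℝ) ≠ 0 := by positivity
    push_cast
    field_simp
  have key := hasDerivAt_tsum_of_isPreconnected (𝕜 := ℝ) (t := Metric.ball (0 : ℝ) B)
    (g := fun k y => besselCoeff p k * y ^ k)
    (g' := fun k y => besselCoeff p k * (k * y ^ (k - 1))) (y₀ := 0) (y := t) hu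
    Metric.isOpen_ball (convex_ball _ _).isPreconnected
    (fun k y _ => (hasDerivAt_pow k y).const_mul _)
    (fun k y hy => by
      rw [Real.norm_eq_abs, abs_mul, abs_mul, abs_pow, Nat.abs_cast]
      have hy' : |y| ≤ B := by simpa using (mem_ball_zero_iff.mp hy).le
      simp only [u]
      gcongr
      exact abs_besselCoeff_le hp k)
    (by simp [B]; positivity) (summable_besselCoeff hp 0) (by simp [B])
  have hval : ∑' k : ℕ, besselCoeff p k * (k * t ^ (k - 1)) = -besselPhi (p + 1) t := by
    have hs : Summable fun k : ℕ => besselCoeff p k * (k * t ^ (k - 1)) := by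
      rw [← summable_nat_add_iff 1]
      refine (summable_besselCoeff (p := p + 1) (by positivity) t).neg.congr fun k => ?_
      rw [← neg_mul, ← besselCoeff_succ_mul]
      push_cast [Nat.add_sub_cancel]
      ring
    rw [hs.tsum_eq_zero_add, besselPhi, ← tsum_neg]
    simp only [Nat.cast_zero, zero_mul, mul_zero, zero_add]
    refine tsum_congr fun k => ?_
    rw [← neg_mul, ← besselCoeff_succ_mul]
    push_cast [Nat.add_sub_cancel]
    ring
  rw [hval] at key
  exact key

theorem contDiff_besselPhi {p : ℝ} (hp : 0 ≤ p) : ContDiff ℝ ∞ (besselPhi p) := by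
  rw [contDiff_infty]
  intro N
  -- The order p must vary, since differentiation raises it by one.
  induction N generalizing p with
  | zero =>
    exact contDiff_zero.mpr (continuous_iff_continuousAt.mpr
      fun t => (hasDerivAt_besselPhi hp t).continuousAt)
  | succ N ih =>
    have hd : deriv (besselPhi p) = fun t => -besselPhi (p + 1) t :=
      funext fun t => (hasDerivAt_besselPhi hp t).deriv
    rw [Nat.cast_succ]
    refine contDiff_succ_iff_deriv.mpr
      ⟨fun t => (hasDerivAt_besselPhi hp t).differentiableAt, fun h => by simp at h, ?_⟩
    rw [hd]
    exact (ih (by positivity)).neg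

/-- The three-term recurrence of the Bessel functions. With c_p(k) the coefficients, c_p(k) = (p + 1
+ k) c_{p+1}(k), and the part k c_{p+1}(k) equals -c_{p+2}(k - 1), whose series is shifted by one
power of t. -/
theorem besselPhi_recurrence {p : ℝ} (hp : 0 ≤ p) (t : ℝ) :
    besselPhi p t = (p + 1) * besselPhi (p + 1) t - t * besselPhi (p + 2) t := by
  have h1 := (summable_besselCoeff (p := p + 1) (by positivity) t).hasSum.mul_left (p + 1)
  have h3 : HasSum (fun k : ℕ => besselCoeff (p + 1) k * k * t ^ k)
      (-(t * besselPhi (p + 2) t)) := by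
    have h2 := ((summable_besselCoeff (p := p + 1 + 1) (by positivity) t).hasSum.mul_left t).neg
    rw [show p + 1 + 1 = p + 2 by ring] at h2
    rw [← hasSum_nat_add_iff' 1]
    simp only [Finset.range_one, Finset.sum_singleton, Nat.cast_zero, mul_zero, zero_mul, sub_zero]
    refine h2.congr_fun fun k => ?_
    have := besselCoeff_succ_mul (p + 1) k
    rw [show p + 1 + 1 = p + 2 by ring] at this
    push_cast
    rw [this]
    ring
  refine HasSum.unique (summable_besselCoeff hp t).hasSum ?_
  rw [sub_eq_add_neg]
  refine (h1.add h3).congr_fun fun k => ?_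
  have hpos : (0 : ℝ) < k + p + 1 := by positivity
  have h : (k : ℝ) + (p + 1) + 1 = (k + p + 1) + 1 := by ring
  have hc : besselCoeff p k = (p + 1 + k) * besselCoeff (p + 1) k := by
    have hG := (Real.Gamma_pos_of_pos hpos).ne'
    have : (k.factorial : ℝ) ≠ 0 := by positivity
    rw [besselCoeff, besselCoeff, h, Real.Gamma_add_one hpos.ne']
    field_simp
    ring
  rw [hc]
  ring

theorem besselPhi_zero_pos {p : ℝ} (hp : 0 ≤ p) : 0 < besselPhi p 0 := by
  rw [besselPhi, tsum_eq_single 0 fun k hk => by simp [hk]]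
  have : 0 < Real.Gamma (p + 1) := Real.Gamma_pos_of_pos (by positivity)
  simpa [besselCoeff] using this

/-! ### The first-order system of two consecutive half-integer orders -/

/-- `(x / 2) ^ (-p) J_p(x)` for `p = n + 1 / 2`. -/
noncomputable def besselEven (n : ℕ) (x : ℝ) : ℝ := besselPhi (n + 1 / 2) ((x / 2) ^ 2)

/-- `(x / 2) ^ (-p) J_{p + 1}(x)` for `p = n + 1 / 2`. -/
noncomputable def besselOdd (n : ℕ) (x : ℝ) : ℝ := x / 2 * besselPhi (n + 3 / 2) ((x / 2) ^ 2)

/-- The derivative of `besselOdd`. -/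
noncomputable def besselOddDeriv (n : ℕ) (x : ℝ) : ℝ :=
  besselEven n x - (n + 1) * besselPhi (n + 3 / 2) ((x / 2) ^ 2)

theorem contDiff_besselEven (n : ℕ) : ContDiff ℝ ∞ (besselEven n) :=
  (contDiff_besselPhi (by positivity)).comp (by fun_prop)

theorem contDiff_besselOdd (n : ℕ) : ContDiff ℝ ∞ (besselOdd n) :=
  ContDiff.mul (by fun_prop) ((contDiff_besselPhi (by positivity)).comp (by fun_prop))

theorem contDiff_besselOddDeriv (n : ℕ) : ContDiff ℝ ∞ (besselOddDeriv n) :=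
  (contDiff_besselEven n).sub
    (contDiff_const.mul ((contDiff_besselPhi (by positivity)).comp (by fun_prop)))

theorem besselEven_recurrence (n : ℕ) (x : ℝ) :
    besselEven n x = (n + 3 / 2) * besselPhi (n + 3 / 2) ((x / 2) ^ 2)
      - (x / 2) ^ 2 * besselPhi (n + 5 / 2) ((x / 2) ^ 2) := by
  have := besselPhi_recurrence (p := (n : ℝ) + 1 / 2) (by positivity) ((x / 2) ^ 2)
  rw [besselEven, this]
  ring_nf

theorem hasDerivAt_half_sq (x : ℝ) : HasDerivAt (fun y : ℝ => (y / 2) ^ 2) (x / 2) x := by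
  have := ((hasDerivAt_id x).div_const 2).pow 2
  refine this.congr_deriv ?_
  simp; ring

theorem hasDerivAt_besselEven (n : ℕ) (x : ℝ) :
    HasDerivAt (besselEven n) (-besselOdd n x) x := by
  have h := (hasDerivAt_besselPhi (p := (n : ℝ) + 1 / 2) (by positivity) ((x / 2) ^ 2)).comp x
    (hasDerivAt_half_sq x)
  refine h.congr_deriv ?_
  rw [besselOdd, show (n : ℝ) + 1 / 2 + 1 = n + 3 / 2 by ring]
  ring

theorem hasDerivAt_besselOdd (n : ℕ) (x : ℝ) :
    HasDerivAt (besselOdd n) (besselOddDeriv n x) x := by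
  have h := (hasDerivAt_besselPhi (p := (n : ℝ) + 3 / 2) (by positivity) ((x / 2) ^ 2)).comp x
    (hasDerivAt_half_sq x)
  have h2 := ((hasDerivAt_id x).div_const 2).mul h
  refine h2.congr_deriv ?_
  rw [besselOddDeriv, besselEven_recurrence, show (n : ℝ) + 3 / 2 + 1 = n + 5 / 2 by ring]
  simp
  ring

/-- With α' = -β this completes the system: xβ' = xα - (2n + 2)β. The form of `besselOddDeriv`
avoids the division by x and so remains smooth at 0. -/
theorem mul_besselOddDeriv (n : ℕ) (x : ℝ) :
    x * besselOddDeriv n x = x * besselEven n x - (2 * n + 2) * besselOdd n x := by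
  rw [besselOddDeriv, besselOdd]; ring

theorem besselEven_zero_pos (n : ℕ) : 0 < besselEven n 0 := by
  simpa [besselEven] using besselPhi_zero_pos (p := (n : ℝ) + 1 / 2) (by positivity)

/-- The Wronskian `x ^ (2 * n + 3) (α β' - α' β)` of `α = besselEven n` and `β = besselOdd n`. -/
theorem besselWronskian_pos (n : ℕ) {x : ℝ} (hx : 0 < x) :
    0 < x ^ (2 * n + 3) *
      (besselEven n x * besselOddDeriv n x + besselOdd n x * besselOdd n x) := by
  -- The Wronskian with β' eliminated by the system. Its derivative is y^(2n+2) (α² + β²) and it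
  -- vanishes at 0, so it is nonnegative on the right half-line.
  set D : ℝ → ℝ := fun y => y ^ (2 * n + 3) *
      (besselEven n y * besselEven n y + besselOdd n y * besselOdd n y)
      - (2 * n + 2) * (y ^ (2 * n + 2) * (besselEven n y * besselOdd n y)) with hD
  have hDeq : ∀ y, y ^ (2 * n + 3) *
      (besselEven n y * besselOddDeriv n y + besselOdd n y * besselOdd n y) = D y := by
    intro y
    have := mul_besselOddDeriv n y
    simp only [hD]
    linear_combination (y ^ (2 * n + 2) * besselEven n y) * this
  have hder : ∀ y, HasDerivAt D (y ^ (2 * n + 2) *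
      (besselEven n y * besselEven n y + besselOdd n y * besselOdd n y)) y := by
    intro y
    have ha := hasDerivAt_besselEven n y
    have hb := hasDerivAt_besselOdd n y
    have h := ((hasDerivAt_pow (2 * n + 3) y).mul ((ha.mul ha).add (hb.mul hb))).sub
      (((hasDerivAt_pow (2 * n + 2) y).mul (ha.mul hb)).const_mul (2 * (n : ℝ) + 2))
    refine h.congr_deriv ?_
    have e := mul_besselOddDeriv n y
    rw [show 2 * n + 3 - 1 = 2 * n + 2 by omega, show 2 * n + 2 - 1 = 2 * n + 1 by omega]
    simp only [Pi.mul_apply, Pi.add_apply]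
    push_cast
    linear_combination (2 * y ^ (2 * n + 2) * besselOdd n y
      - (2 * n + 2) * y ^ (2 * n + 1) * besselEven n y) * e
  have hmono : MonotoneOn D (Set.Ici 0) := by
    refine monotoneOn_of_deriv_nonneg (convex_Ici 0)
      (fun y _ => (hder y).continuousAt.continuousWithinAt)
      (fun y _ => (hder y).differentiableAt.differentiableWithinAt) fun y hy => ?_
    rw [(hder y).deriv]
    rw [interior_Ici] at hy
    have hy' : 0 < y := hy
    have := mul_self_nonneg (besselEven n y)
    have := mul_self_nonneg (besselOdd n y)
    positivity
  rw [hDeq]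
  have h0 : D 0 = 0 := by simp [hD]
  -- A nonpositive value at x would force the monotone function D to vanish on (0, x). Its
  -- derivative is positive near 0 because α(0) > 0. That α² + β² never vanishes is not available
  -- here, since it is deduced from this result.
  by_contra hneg
  have hzero : ∀ y ∈ Set.Ioo 0 x, D y = 0 := fun y hy =>
    le_antisymm ((hmono hy.1.le hx.le hy.2.le).trans (not_lt.mp hneg))
      (h0 ▸ hmono (Set.mem_Ici.mpr le_rfl) hy.1.le hy.1.le)
  have hev : ∀ᶠ y in 𝓝[>] (0 : ℝ), 0 < besselEven n y :=
    nhdsWithin_le_nhds ((contDiff_besselEven n).continuous.continuousAt.eventually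
      (lt_mem_nhds (besselEven_zero_pos n)))
  obtain ⟨y, hy1, hy2⟩ := (hev.and (Ioo_mem_nhdsGT hx)).exists
  have hd0 : HasDerivAt D 0 y :=
    (hasDerivAt_const y (0 : ℝ)).congr_of_eventuallyEq
      (eventually_of_mem (isOpen_Ioo.mem_nhds hy2) hzero)
  have := hd0.unique (hder y)
  have h1 : 0 < y ^ (2 * n + 2) := pow_pos hy2.1 _
  have h2 := mul_self_nonneg (besselOdd n y)
  nlinarith [mul_pos hy1 hy1, mul_pos h1 (mul_pos hy1 hy1), mul_nonneg h1.le h2]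

theorem besselEven_neg (n : ℕ) (x : ℝ) : besselEven n (-x) = besselEven n x := by
  simp [besselEven, neg_div]

theorem besselOdd_neg (n : ℕ) (x : ℝ) : besselOdd n (-x) = -besselOdd n x := by
  simp [besselOdd, neg_div]

/-! ### The Prüfer angle -/

/-- The complex combination of the two normalized Bessel functions. -/
noncomputable def besselCurve (n : ℕ) (x : ℝ) : ℂ :=
  (besselEven n x : ℂ) + Complex.I * (besselOdd n x : ℂ)

/-- A common zero would annihilate the Wronskian; negative arguments reduce to positive ones by
parity, and at 0 the even function is positive. -/
theorem besselCurve_ne_zero (n : ℕ) (x : ℝ) : besselCurve n x ≠ 0 := by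
  intro h
  have h1 : besselEven n x = 0 := by simpa [besselCurve] using congrArg Complex.re h
  have h2 : besselOdd n x = 0 := by simpa [besselCurve] using congrArg Complex.im h
  rcases lt_trichotomy x 0 with hx | rfl | hx
  · have := besselWronskian_pos n (neg_pos.mpr hx)
    simp [besselEven_neg, besselOdd_neg, h1, h2] at this
  · exact (besselEven_zero_pos n).ne' h1
  · have := besselWronskian_pos n hx
    simp [h1, h2] at this

/-- The logarithmic derivative of `besselCurve`. -/
noncomputable def besselLogDeriv (n : ℕ) (x : ℝ) : ℂ :=
  (-(besselOdd n x : ℂ) + Complex.I * (besselOddDeriv n x : ℂ)) / besselCurve n x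

theorem contDiff_ofReal {f : ℝ → ℝ} (hf : ContDiff ℝ ∞ f) : ContDiff ℝ ∞ fun x => (f x : ℂ) :=
  Complex.ofRealCLM.contDiff.comp hf

theorem contDiff_besselLogDeriv (n : ℕ) : ContDiff ℝ ∞ (besselLogDeriv n) := by
  refine ContDiff.mul ?_ (ContDiff.inv ?_ (besselCurve_ne_zero n))
  · exact (contDiff_ofReal (contDiff_besselOdd n)).neg.add
      (contDiff_const.mul (contDiff_ofReal (contDiff_besselOddDeriv n)))
  · exact (contDiff_ofReal (contDiff_besselEven n)).add
      (contDiff_const.mul (contDiff_ofReal (contDiff_besselOdd n)))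

/-- A logarithm of `besselCurve`, up to a constant. -/
noncomputable def besselLog (n : ℕ) (x : ℝ) : ℂ := ∫ t in (0 : ℝ)..x, besselLogDeriv n t

theorem hasDerivAt_besselLog (n : ℕ) (x : ℝ) :
    HasDerivAt (besselLog n) (besselLogDeriv n x) x :=
  (contDiff_besselLogDeriv n).continuous.integral_hasStrictDerivAt 0 x |>.hasDerivAt

/-- The quotient of the curve by the exponential of a primitive of its logarithmic derivative is
constant. This yields a smooth argument on all of ℝ without a choice of branch. -/
theorem besselCurve_eq (n : ℕ) (x : ℝ) :
    besselCurve n x = besselEven n 0 * Complex.exp (besselLog n x) := by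
  have hd : ∀ y, HasDerivAt (fun y => besselCurve n y * Complex.exp (-besselLog n y)) 0 y := by
    intro y
    have h1 : HasDerivAt (besselCurve n)
        (-(besselOdd n y : ℂ) + Complex.I * (besselOddDeriv n y : ℂ)) y := by
      have ha := (hasDerivAt_besselEven n y).ofReal_comp
      have hb := (hasDerivAt_besselOdd n y).ofReal_comp.const_mul Complex.I
      refine (ha.add hb).congr_deriv ?_
      simp
    have h2 := h1.mul (hasDerivAt_besselLog n y).neg.cexp
    refine h2.congr_deriv ?_
    rw [besselLogDeriv]
    field_simp [besselCurve_ne_zero n y]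
    ring
  have hc := is_const_of_deriv_eq_zero (fun y => (hd y).differentiableAt)
    (fun y => (hd y).deriv) x 0
  simp only [besselLog, intervalIntegral.integral_same, neg_zero, Complex.exp_zero, mul_one] at hc
  rw [show (besselEven n 0 : ℂ) = besselCurve n 0 by simp [besselCurve, besselOdd], ← hc, mul_assoc,
    ← Complex.exp_add, besselLog, neg_add_cancel, Complex.exp_zero, mul_one]

/-- The Prüfer angle of the pair `J_{n + 1 / 2}`, `J_{n + 3 / 2}`. -/
noncomputable def besselPhase (n : ℕ) (x : ℝ) : ℝ := (besselLog n x).im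

/-- The Prüfer amplitude of the pair `besselEven n`, `besselOdd n`. -/
noncomputable def besselAmp (n : ℕ) (x : ℝ) : ℝ :=
  besselEven n 0 * Real.exp (besselLog n x).re

theorem besselAmp_pos (n : ℕ) (x : ℝ) : 0 < besselAmp n x :=
  mul_pos (besselEven_zero_pos n) (Real.exp_pos _)

theorem besselEven_eq (n : ℕ) (x : ℝ) :
    besselEven n x = besselAmp n x * Real.cos (besselPhase n x) := by
  have := congrArg Complex.re (besselCurve_eq n x)
  simpa [besselCurve, Complex.exp_re, besselAmp, besselPhase, mul_assoc] using this

theorem besselOdd_eq (n : ℕ) (x : ℝ) :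
    besselOdd n x = besselAmp n x * Real.sin (besselPhase n x) := by
  have := congrArg Complex.im (besselCurve_eq n x)
  simpa [besselCurve, Complex.exp_im, besselAmp, besselPhase, mul_assoc] using this

theorem besselPhase_zero (n : ℕ) : besselPhase n 0 = 0 := by simp [besselPhase, besselLog]

theorem hasDerivAt_besselPhase (n : ℕ) (x : ℝ) :
    HasDerivAt (besselPhase n) (besselLogDeriv n x).im x :=
  Complex.imCLM.hasFDerivAt.comp_hasDerivAt x (hasDerivAt_besselLog n x)

theorem contDiff_besselPhase (n : ℕ) : ContDiff ℝ ∞ (besselPhase n) := by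
  rw [contDiff_infty_iff_deriv]
  refine ⟨fun x => (hasDerivAt_besselPhase n x).differentiableAt, ?_⟩
  rw [show deriv (besselPhase n) = fun x => (besselLogDeriv n x).im from
    funext fun x => (hasDerivAt_besselPhase n x).deriv]
  exact Complex.imCLM.contDiff.comp (contDiff_besselLogDeriv n)

theorem besselLogDeriv_im (n : ℕ) (x : ℝ) :
    (besselLogDeriv n x).im =
      (besselEven n x * besselOddDeriv n x + besselOdd n x * besselOdd n x) /
        (besselEven n x * besselEven n x + besselOdd n x * besselOdd n x) := by
  rw [besselLogDeriv, Complex.div_im]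
  simp [besselCurve, Complex.normSq_apply]
  ring

theorem sq_add_sq_bessel_pos (n : ℕ) (x : ℝ) :
    0 < besselEven n x * besselEven n x + besselOdd n x * besselOdd n x := by
  have := Complex.normSq_pos.mpr (besselCurve_ne_zero n x)
  simpa [besselCurve, Complex.normSq_apply] using this

theorem besselLogDeriv_im_pos (n : ℕ) {x : ℝ} (hx : 0 < x) : 0 < (besselLogDeriv n x).im := by
  rw [besselLogDeriv_im]
  exact div_pos (pos_of_mul_pos_right (besselWronskian_pos n hx) (by positivity))
    (sq_add_sq_bessel_pos n x)

/-- By the system θ' = 1 - (2n + 2)/x · αβ/(α² + β²), and 2αβ ≤ α² + β² gives θ' ≥ 1 - (n + 1)/x. -/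
theorem half_le_besselLogDeriv_im (n : ℕ) {x : ℝ} (hx : 2 * (n + 1) ≤ x) :
    1 / 2 ≤ (besselLogDeriv n x).im := by
  have hx0 : 0 < x := lt_of_lt_of_le (by positivity) hx
  rw [besselLogDeriv_im, le_div_iff₀ (sq_add_sq_bessel_pos n x)]
  have h := mul_besselOddDeriv n x
  refine le_of_mul_le_mul_left ?_ hx0
  have e : x * (besselEven n x * besselOddDeriv n x + besselOdd n x * besselOdd n x) =
      x * (besselEven n x * besselEven n x + besselOdd n x * besselOdd n x)
        - (2 * n + 2) * (besselEven n x * besselOdd n x) := by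
    linear_combination besselEven n x * h
  rw [e]
  have h1 := mul_nonneg (sub_nonneg.mpr hx) (sq_add_sq_bessel_pos n x).le
  have h2 := mul_nonneg (show (0 : ℝ) ≤ n + 1 by positivity)
    (mul_self_nonneg (besselEven n x - besselOdd n x))
  nlinarith

theorem strictMonoOn_besselPhase (n : ℕ) : StrictMonoOn (besselPhase n) (Set.Ici 0) := by
  refine strictMonoOn_of_deriv_pos (convex_Ici 0)
    (contDiff_besselPhase n).continuous.continuousOn fun x hx => ?_
  rw [interior_Ici] at hx
  rw [(hasDerivAt_besselPhase n x).deriv]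
  exact besselLogDeriv_im_pos n hx

/-- Beyond 2(n + 1) the slope is at least 1/2, so θ(x) - x/2 is nondecreasing there. -/
theorem tendsto_besselPhase (n : ℕ) : Tendsto (besselPhase n) atTop atTop := by
  set b : ℝ := 2 * (n + 1)
  have hmono : MonotoneOn (fun x => besselPhase n x - x / 2) (Set.Ici b) := by
    have hd : ∀ x, HasDerivAt (fun x => besselPhase n x - x / 2)
        ((besselLogDeriv n x).im - 1 / 2) x := fun x =>
      (hasDerivAt_besselPhase n x).sub ((hasDerivAt_id x).div_const 2)
    refine monotoneOn_of_deriv_nonneg (convex_Ici b)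
      (fun x _ => (hd x).continuousAt.continuousWithinAt)
      (fun x _ => (hd x).differentiableAt.differentiableWithinAt) fun x hx => ?_
    rw [interior_Ici] at hx
    rw [(hd x).deriv]
    linarith [half_le_besselLogDeriv_im n (le_of_lt hx)]
  have h1 : Tendsto (fun x : ℝ => x / 2 + (besselPhase n b - b / 2)) atTop atTop :=
    tendsto_atTop_add_const_right _ _ (tendsto_id.atTop_div_const (by norm_num))
  refine tendsto_atTop_mono' _ ?_ h1
  filter_upwards [eventually_ge_atTop b] with x hx
  have := hmono (Set.mem_Ici.mpr le_rfl) hx hx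
  simp only at this
  linarith

theorem exists_besselPhase_eq (n : ℕ) {y : ℝ} (hy : 0 < y) : ∃ x, 0 < x ∧ besselPhase n x = y := by
  obtain ⟨b, hb0, hb⟩ := ((eventually_gt_atTop (0 : ℝ)).and
    ((tendsto_besselPhase n).eventually_gt_atTop y)).exists
  obtain ⟨x, hx, hxy⟩ := intermediate_value_Ioo hb0.le
    (contDiff_besselPhase n).continuous.continuousOn
    (show y ∈ Set.Ioo (besselPhase n 0) (besselPhase n b) from ⟨by rwa [besselPhase_zero], hb⟩)
  exact ⟨x, hx.1, hxy⟩

/-! ### Zeros of the Bessel functions in terms of the angle -/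

theorem besselJ_half_eq (n : ℕ) (x : ℝ) :
    besselJ (n + 1 / 2) x = (x / 2) ^ ((n : ℝ) + 1 / 2) * besselEven n x := by
  rw [besselJ_eq_besselPhi, besselEven]

theorem besselJ_three_half_eq (n : ℕ) {x : ℝ} (hx : 0 ≤ x) :
    besselJ (n + 3 / 2) x = (x / 2) ^ ((n : ℝ) + 1 / 2) * besselOdd n x := by
  rw [besselJ_eq_besselPhi, besselOdd, show (n : ℝ) + 3 / 2 = n + 1 / 2 + 1 by ring,
    Real.rpow_add_one' (by positivity) (by positivity)]
  ring

theorem besselPhase_pos (n : ℕ) {x : ℝ} (hx : 0 < x) : 0 < besselPhase n x := by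
  have := strictMonoOn_besselPhase n (Set.mem_Ici.mpr le_rfl) (Set.mem_Ici.mpr hx.le) hx
  rwa [besselPhase_zero] at this

theorem besselJ_half_eq_zero_iff (n : ℕ) {x : ℝ} (hx : 0 < x) :
    besselJ (n + 1 / 2) x = 0 ↔ ∃ k : ℕ, besselPhase n x = k * Real.pi + Real.pi / 2 := by
  have h0 : (x / 2) ^ ((n : ℝ) + 1 / 2) ≠ 0 := (Real.rpow_pos_of_pos (by positivity) _).ne'
  rw [besselJ_half_eq, mul_eq_zero, or_iff_right h0, besselEven_eq, mul_eq_zero,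
    or_iff_right (besselAmp_pos n x).ne', Real.cos_eq_zero_iff]
  constructor
  · rintro ⟨k, hk⟩
    have hp := besselPhase_pos n hx
    rw [hk] at hp
    have hk0 : (-1 : ℝ) < k := by nlinarith [Real.pi_pos]
    have hk1 : (-1 : ℤ) < k := by exact_mod_cast hk0
    lift k to ℕ using by omega
    exact ⟨k, by rw [hk]; push_cast; ring⟩
  · rintro ⟨k, hk⟩
    exact ⟨k, by rw [hk]; push_cast; ring⟩

theorem besselJ_three_half_eq_zero_iff (n : ℕ) {x : ℝ} (hx : 0 < x) :
    besselJ (n + 3 / 2) x = 0 ↔ ∃ k : ℕ, besselPhase n x = k * Real.pi + Real.pi := by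
  have h0 : (x / 2) ^ ((n : ℝ) + 1 / 2) ≠ 0 := (Real.rpow_pos_of_pos (by positivity) _).ne'
  rw [besselJ_three_half_eq n hx.le, mul_eq_zero, or_iff_right h0, besselOdd_eq, mul_eq_zero,
    or_iff_right (besselAmp_pos n x).ne', Real.sin_eq_zero_iff]
  constructor
  · rintro ⟨k, hk⟩
    have hp := besselPhase_pos n hx
    rw [← hk] at hp
    have hk0 : (0 : ℝ) < k := by nlinarith [Real.pi_pos]
    have hk1 : (0 : ℤ) < k := by exact_mod_cast hk0
    obtain ⟨j, rfl⟩ : ∃ j : ℕ, k = j + 1 := ⟨(k - 1).toNat, by omega⟩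
    exact ⟨j, by rw [← hk]; push_cast; ring⟩
  · rintro ⟨k, hk⟩
    exact ⟨k + 1, by rw [hk]; push_cast; ring⟩

theorem besselPhase_lt_iff (n : ℕ) {x y : ℝ} (hx : 0 ≤ x) (hy : 0 ≤ y) :
    besselPhase n x < besselPhase n y ↔ x < y :=
  (strictMonoOn_besselPhase n).lt_iff_lt hx hy

/-- The previous zero has angle (k - 1)π + δ, or 0 at the start of the recursion. Hence the zeros
beyond it are the points of angle jπ + δ with j ≥ k, and by monotonicity j = k gives the least of
them, so the infimum is attained. It is applied with δ = π/2 and δ = π. -/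
theorem besselPhase_besselZero {p δ : ℝ} (n : ℕ) (hδ : 0 < δ)
    (hz : ∀ x, 0 < x → (besselJ p x = 0 ↔ ∃ k : ℕ, besselPhase n x = k * Real.pi + δ)) (k : ℕ) :
    0 < besselZero p (k + 1) ∧ besselPhase n (besselZero p (k + 1)) = k * Real.pi + δ := by
  have hpi := Real.pi_pos
  suffices h : ∀ k : ℕ, 0 ≤ besselZero p k →
      (∀ j : ℕ, besselPhase n (besselZero p k) < j * Real.pi + δ ↔ k ≤ j) →
      0 < besselZero p (k + 1) ∧ besselPhase n (besselZero p (k + 1)) = k * Real.pi + δ by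
    induction k with
    | zero =>
      refine h 0 le_rfl fun j => ?_
      simp only [besselZero, besselPhase_zero, zero_le, iff_true]
      positivity
    | succ k ih =>
      refine h (k + 1) ih.1.le fun j => ?_
      rw [ih.2, add_lt_add_iff_right, mul_lt_mul_iff_left₀ hpi, Nat.cast_lt]
      rfl
  intro k h0 hj
  obtain ⟨x, hx0, hx⟩ := exists_besselPhase_eq n (show 0 < (k : ℝ) * Real.pi + δ by positivity)
  have hleast : IsLeast {y | besselZero p k < y ∧ besselJ p y = 0} x := by
    refine ⟨⟨?_, (hz x hx0).mpr ⟨k, hx⟩⟩, fun y hy => ?_⟩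
    · rw [← besselPhase_lt_iff n h0 hx0.le, hx]
      exact (hj k).mpr le_rfl
    · have hy0 : 0 < y := h0.trans_lt hy.1
      obtain ⟨j, hjy⟩ := (hz y hy0).mp hy.2
      have h1 := (besselPhase_lt_iff n h0 hy0.le).mpr hy.1
      rw [hjy, hj] at h1
      rw [← not_lt, ← besselPhase_lt_iff n hy0.le hx0.le, hx, hjy, not_lt]
      gcongr
  have e : besselZero p (k + 1) = x := by rw [besselZero]; exact hleast.csInf_eq
  rw [e]
  exact ⟨hx0, hx⟩

theorem besselPhase_besselZero_jOf (n k : ℕ) : 0 < besselZero (jOf n) (k + 1) ∧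
    besselPhase n (besselZero (jOf n) (k + 1)) = k * Real.pi + Real.pi / 2 :=
  besselPhase_besselZero n (by positivity) (fun _ hx => besselJ_half_eq_zero_iff n hx) k

theorem besselPhase_besselZero_jOf_add_one (n k : ℕ) : 0 < besselZero (jOf n + 1) (k + 1) ∧
    besselPhase n (besselZero (jOf n + 1) (k + 1)) = k * Real.pi + Real.pi := by
  have : jOf n + 1 = n + 3 / 2 := by rw [jOf]; ring
  rw [this]
  exact besselPhase_besselZero n (by positivity) (fun _ hx => besselJ_three_half_eq_zero_iff n hx) k

/-! ### The angle at the boundary and the energy bands -/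

/-- The Prüfer angle at the boundary of the ball, as a function of the energy. -/
noncomputable def boundaryPhase (R m : ℝ) (n : ℕ) (lam : ℝ) : ℝ :=
  besselPhase n (R * Real.sqrt (lam ^ 2 - m ^ 2))

theorem boundaryPhase_edge {R : ℝ} (m : ℝ) (hR : 0 < R) (n : ℕ) (p : ℝ) {k : ℕ}
    (hz : 0 < besselZero p k) :
    boundaryPhase R m n (edge R m p k) = besselPhase n (besselZero p k) := by
  rw [boundaryPhase, edge, Real.sq_sqrt (by positivity), add_sub_cancel_right,
    Real.sqrt_sq (by positivity), mul_div_cancel₀ _ hR.ne']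

theorem boundaryPhase_neg (R m : ℝ) (n : ℕ) (lam : ℝ) :
    boundaryPhase R m n (-lam) = boundaryPhase R m n lam := by
  simp [boundaryPhase]

theorem lt_edge_iff {R m : ℝ} (hR : 0 < R) (n : ℕ) {p : ℝ} {k : ℕ} (hz : 0 < besselZero p k)
    {lam : ℝ} (hl : 0 ≤ lam) :
    lam < edge R m p k ↔ boundaryPhase R m n lam < besselPhase n (besselZero p k) := by
  rw [boundaryPhase, besselPhase_lt_iff n (by positivity) hz.le, edge, Real.lt_sqrt hl,
    ← lt_div_iff₀' hR, Real.sqrt_lt' (by positivity), sub_lt_iff_lt_add]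

theorem edge_lt_iff {R m : ℝ} (hR : 0 < R) (n : ℕ) {p : ℝ} {k : ℕ} (hz : 0 < besselZero p k)
    {lam : ℝ} (hl : 0 < lam) :
    edge R m p k < lam ↔ besselPhase n (besselZero p k) < boundaryPhase R m n lam := by
  rw [boundaryPhase, besselPhase_lt_iff n hz.le (by positivity), edge, Real.sqrt_lt' hl,
    ← div_lt_iff₀' hR, Real.lt_sqrt (by positivity), lt_sub_iff_add_lt]

theorem boundaryPhase_pos_iff {R : ℝ} (m : ℝ) (hR : 0 < R) (n : ℕ) (lam : ℝ) :
    0 < boundaryPhase R m n lam ↔ m ^ 2 < lam ^ 2 := by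
  have h := besselPhase_lt_iff n le_rfl (y := R * Real.sqrt (lam ^ 2 - m ^ 2)) (by positivity)
  rw [besselPhase_zero] at h
  rw [boundaryPhase, h, mul_pos_iff_of_pos_left hR, Real.sqrt_pos, sub_pos]

/-- The energies whose Prüfer angle at the boundary lies in the quadrant numbered by `k`. -/
def InBand (R m : ℝ) (n : ℕ) (k : ℤ) (lam : ℝ) : Prop :=
  match k with
  | .ofNat q => 0 < lam ∧ q * Real.pi < boundaryPhase R m n lam ∧
      boundaryPhase R m n lam < q * Real.pi + Real.pi / 2
  | .negSucc q => lam < 0 ∧ q * Real.pi + Real.pi / 2 < boundaryPhase R m n lam ∧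
      boundaryPhase R m n lam < q * Real.pi + Real.pi

theorem edge_pos {R : ℝ} (m : ℝ) (hR : 0 < R) {p : ℝ} {k : ℕ} (hz : 0 < besselZero p k) :
    0 < edge R m p k := by
  rw [edge]; positivity

/-- Monotonicity of the angle turns each comparison of |λ| with an edge into a comparison of angles;
the end m of the interval k = 0 corresponds to angle 0. -/
theorem mem_curveInterval_minus_iff {R m : ℝ} (hR : 0 < R) (hm : 0 ≤ m) (n : ℕ) (k : ℤ) (lam : ℝ) :
    lam ∈ curveInterval R m .minus n k ↔ InBand R m n k lam := by
  have hj := besselPhase_besselZero_jOf n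
  have hj1 := besselPhase_besselZero_jOf_add_one n
  match k with
  | .ofNat 0 =>
    have h : 0 < lam → (m < lam ↔ 0 < boundaryPhase R m n lam) := fun hl => by
      rw [boundaryPhase_pos_iff m hR, sq_lt_sq₀ hm hl.le]
    have h' : 0 < lam → _ := fun hl => lt_edge_iff (m := m) hR n (hj 0).1 (lam := lam) hl.le
    rw [(hj 0).2] at h'
    simp only [curveInterval, InBand, Set.mem_Ioo]
    push_cast at h' ⊢
    simp only [zero_mul, zero_add] at h' ⊢
    constructor
    · rintro ⟨h1, h2⟩
      have hl : 0 < lam := hm.trans_lt h1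
      exact ⟨hl, (h hl).mp h1, (h' hl).mp h2⟩
    · rintro ⟨hl, h1, h2⟩
      exact ⟨(h hl).mpr h1, (h' hl).mpr h2⟩
  | .ofNat (q + 1) =>
    have h : 0 < lam → _ := fun hl => edge_lt_iff (m := m) hR n (hj1 q).1 (lam := lam) hl
    have h' : 0 < lam → _ := fun hl => lt_edge_iff (m := m) hR n (hj (q + 1)).1 (lam := lam) hl.le
    rw [(hj1 q).2] at h
    rw [(hj (q + 1)).2] at h'
    simp only [curveInterval, InBand, Set.mem_Ioo]
    push_cast at h' ⊢
    rw [add_one_mul] at h' ⊢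
    constructor
    · rintro ⟨h1, h2⟩
      have hl : 0 < lam := (edge_pos m hR (hj1 q).1).trans h1
      exact ⟨hl, (h hl).mp h1, (h' hl).mp h2⟩
    · rintro ⟨hl, h1, h2⟩
      exact ⟨(h hl).mpr h1, (h' hl).mpr h2⟩
  | .negSucc q =>
    have h : 0 < -lam → _ := fun hl => edge_lt_iff (m := m) hR n (hj q).1 (lam := -lam) hl
    have h' : 0 < -lam → _ := fun hl => lt_edge_iff (m := m) hR n (hj1 q).1 (lam := -lam) hl.le
    rw [(hj q).2, boundaryPhase_neg, lt_neg (a := edge R m (jOf n) (q + 1))] at h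
    rw [(hj1 q).2, boundaryPhase_neg, neg_lt (b := edge R m (jOf n + 1) (q + 1))] at h'
    simp only [curveInterval, InBand, Set.mem_Ioo]
    constructor
    · rintro ⟨h1, h2⟩
      have hl : 0 < -lam := (edge_pos m hR (hj q).1).trans (lt_neg.mp h2)
      exact ⟨neg_pos.mp hl, (h hl).mp h2, (h' hl).mp h1⟩
    · rintro ⟨hl, h1, h2⟩
      exact ⟨(h' (neg_pos.mpr hl)).mpr h2, (h (neg_pos.mpr hl)).mpr h1⟩

/-- This reflection reduces the plus branch to the minus branch. -/
theorem curveInterval_plus (R m : ℝ) (n : ℕ) (k : ℤ) (lam : ℝ) :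
    lam ∈ curveInterval R m .plus n k ↔ -lam ∈ curveInterval R m .minus n k := by
  match k with
  | .ofNat 0 => simp only [curveInterval, Set.mem_Ioo, lt_neg (b := lam), neg_lt (a := lam), and_comm]
  | .ofNat (q + 1) =>
    simp only [curveInterval, Set.mem_Ioo, lt_neg (b := lam), neg_lt (a := lam), and_comm]
  | .negSucc q => simp only [curveInterval, Set.mem_Ioo, neg_lt_neg_iff, and_comm]

/-- Angles inside the quadrants are attained; this shows that the endpoints of each interval are in
the right order. -/
theorem exists_inBand {R : ℝ} (m : ℝ) (hR : 0 < R) (n : ℕ) (k : ℤ) : ∃ lam, InBand R m n k lam := by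
  have hpi := Real.pi_pos
  have key : ∀ y : ℝ, 0 < y → ∃ lam, 0 < lam ∧ boundaryPhase R m n lam = y := by
    intro y hy
    obtain ⟨x, hx0, hx⟩ := exists_besselPhase_eq n hy
    refine ⟨Real.sqrt ((x / R) ^ 2 + m ^ 2), by positivity, ?_⟩
    rw [boundaryPhase, Real.sq_sqrt (by positivity), add_sub_cancel_right,
      Real.sqrt_sq (by positivity), mul_div_cancel₀ _ hR.ne', hx]
  match k with
  | .ofNat q =>
    obtain ⟨lam, h0, h⟩ := key (q * Real.pi + Real.pi / 4) (by positivity)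
    exact ⟨lam, h0, by rw [h]; linarith, by rw [h]; linarith⟩
  | .negSucc q =>
    obtain ⟨lam, h0, h⟩ := key (q * Real.pi + 3 * Real.pi / 4) (by positivity)
    exact ⟨-lam, by linarith, by rw [boundaryPhase_neg, h]; linarith,
      by rw [boundaryPhase_neg, h]; linarith⟩

/-- The sign of the energy and the quadrant of the angle determine the index. Hence curves with
different indices are different functions. -/
theorem InBand.index_unique {R m : ℝ} {n : ℕ} {k l : ℤ} {lam : ℝ}
    (hk : InBand R m n k lam) (hl : InBand R m n l lam) : k = l := by
  have hpi := Real.pi_pos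
  have aux : ∀ q r : ℕ, (q : ℝ) * Real.pi < r * Real.pi + Real.pi → q ≤ r := fun q r h => by
    have : (q : ℝ) < r + 1 := lt_of_mul_lt_mul_right (by linarith) hpi.le
    exact Nat.lt_succ_iff.mp (by exact_mod_cast this)
  match k, l, hk, hl with
  | .ofNat q, .ofNat r, hk, hl =>
    have := aux q r (by linarith [hk.2.1, hl.2.2])
    have := aux r q (by linarith [hl.2.1, hk.2.2])
    rw [le_antisymm ‹q ≤ r› ‹r ≤ q›]
  | .ofNat q, .negSucc r, hk, hl => exact absurd hk.1 hl.1.not_gt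
  | .negSucc q, .ofNat r, hk, hl => exact absurd hk.1 hl.1.not_gt
  | .negSucc q, .negSucc r, hk, hl =>
    have := aux q r (by linarith [hk.2.1, hl.2.2])
    have := aux r q (by linarith [hl.2.1, hk.2.2])
    rw [le_antisymm ‹q ≤ r› ‹r ≤ q›]

/-! ### The dispersion function and its inversion -/

/-- A smooth positive function with positive derivative on an interval, tending to `0` and `∞` at
the endpoints, can be inverted along the exponential function. -/
theorem exists_smooth_strictMono_inverse {a b : ℝ} (hab : a < b) {G : ℝ → ℝ}
    (hG : ∀ x ∈ Set.Ioo a b, ContDiffAt ℝ ∞ G x) (hpos : ∀ x ∈ Set.Ioo a b, 0 < G x)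
    (hd : ∀ x ∈ Set.Ioo a b, 0 < deriv G x) (ha : Tendsto G (𝓝[>] a) (𝓝 0))
    (hb : Tendsto (fun x => (G x)⁻¹) (𝓝[<] b) (𝓝 0)) :
    ∃ lam : ℝ → ℝ, ContDiff ℝ ∞ lam ∧ StrictMono lam ∧ Set.range lam = Set.Ioo a b ∧
      ∀ τ, G (lam τ) = Real.exp τ := by
  have hcont : ContinuousOn G (Set.Ioo a b) := fun x hx => (hG x hx).continuousAt.continuousWithinAt
  have hmono : StrictMonoOn G (Set.Ioo a b) :=
    strictMonoOn_of_deriv_pos (convex_Ioo a b) hcont fun x hx => hd x (by rwa [interior_Ioo] at hx)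
  have hex : ∀ τ : ℝ, ∃ x ∈ Set.Ioo a b, G x = Real.exp τ := by
    intro τ
    obtain ⟨x, hx1, hx2⟩ :=
      ((ha.eventually (gt_mem_nhds (Real.exp_pos τ))).and (Ioo_mem_nhdsGT hab)).exists
    obtain ⟨y, hy1, hy2⟩ :=
      ((hb.eventually (gt_mem_nhds (inv_pos.mpr (Real.exp_pos τ)))).and
        (Ioo_mem_nhdsLT hab)).exists
    have hy3 := (inv_lt_inv₀ (hpos y hy2) (Real.exp_pos τ)).mp hy1
    exact isPreconnected_Ioo.intermediate_value hx2 hy2 hcont ⟨hx1.le, hy3.le⟩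
  choose lam hmem hlam using hex
  refine ⟨lam, ?_, ?_, ?_, hlam⟩
  · rw [contDiff_iff_contDiffAt]
    intro τ
    -- The inverse function theorem is applied to log G, which sends lam σ to σ.
    set F : ℝ → ℝ := fun x => Real.log (G x)
    have hF : ContDiffAt ℝ ∞ F (lam τ) := (hG _ (hmem τ)).log (hpos _ (hmem τ)).ne'
    have hFτ : ∀ σ, F (lam σ) = σ := fun σ => by simp only [F, hlam, Real.log_exp]
    have hFd : HasDerivAt F (deriv G (lam τ) / G (lam τ)) (lam τ) :=
      ((hG _ (hmem τ)).differentiableAt (by simp)).hasDerivAt.log (hpos _ (hmem τ)).ne'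
    have hne : deriv G (lam τ) / G (lam τ) ≠ 0 := (div_pos (hd _ (hmem τ)) (hpos _ (hmem τ))).ne'
    have hFf : HasFDerivAt F
        ((ContinuousLinearEquiv.unitsEquivAut ℝ (Units.mk0 _ hne) : ℝ ≃L[ℝ] ℝ) : ℝ →L[ℝ] ℝ)
        (lam τ) := hFd.hasFDerivAt_equiv hne
    have hinv := hF.to_localInverse hFf (by simp)
    rw [hFτ] at hinv
    set g := hF.localInverse hFf (by simp)
    have hgτ : g τ = lam τ := by
      have := hF.localInverse_apply_image hFf (by simp)
      rwa [hFτ] at this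
    have hright : ∀ᶠ σ in 𝓝 τ, F (g σ) = σ := by
      have := (hF.hasStrictFDerivAt' hFf (by simp)).eventually_right_inverse
      rwa [hFτ] at this
    refine hinv.congr_of_eventuallyEq ?_
    -- The local inverse stays in the interval near τ, where G is injective; it therefore agrees
    -- with `lam` there.
    have hmem' : ∀ᶠ σ in 𝓝 τ, g σ ∈ Set.Ioo a b :=
      hinv.continuousAt.eventually (by rw [hgτ]; exact isOpen_Ioo.mem_nhds (hmem τ))
    filter_upwards [hright, hmem'] with σ h1 h2
    refine hmono.injOn (hmem σ) h2 ?_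
    rw [hlam, ← Real.exp_log (hpos _ h2)]
    exact congrArg Real.exp h1.symm
  · intro σ τ h
    rw [← hmono.lt_iff_lt (hmem σ) (hmem τ), hlam, hlam]
    exact Real.exp_lt_exp.mpr h
  · refine Set.Subset.antisymm (Set.range_subset_iff.mpr hmem) fun x hx =>
      ⟨Real.log (G x), hmono.injOn (hmem _) hx ?_⟩
    rw [hlam, Real.exp_log (hpos x hx)]

/-- The function of the energy which equals `exp τ` along the minus curves. -/
noncomputable def dispersion (R m : ℝ) (n : ℕ) (lam : ℝ) : ℝ :=
  Real.sqrt (lam ^ 2 - m ^ 2) / (lam + m) * Real.tan (boundaryPhase R m n lam)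

theorem continuous_boundaryPhase (R m : ℝ) (n : ℕ) : Continuous (boundaryPhase R m n) :=
  (contDiff_besselPhase n).continuous.comp (by fun_prop)

theorem InBand.boundaryPhase_pos {R m : ℝ} {n : ℕ} {k : ℤ} {lam : ℝ} (h : InBand R m n k lam) :
    0 < boundaryPhase R m n lam := by
  have hpi := Real.pi_pos
  match k, h with
  | .ofNat q, h => exact lt_of_le_of_lt (by positivity) h.2.1
  | .negSucc q, h => exact lt_of_le_of_lt (by positivity) h.2.1

theorem InBand.sq_lt_sq {R m : ℝ} (hR : 0 < R) {n : ℕ} {k : ℤ} {lam : ℝ}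
    (h : InBand R m n k lam) : m ^ 2 < lam ^ 2 :=
  (boundaryPhase_pos_iff m hR n lam).mp h.boundaryPhase_pos

/-- Subtracting a multiple of π puts the angle in (0, π/2) for λ > 0 and in (-π/2, 0) for λ < 0.
Since |λ| > m ≥ 0, the sum λ + m has the sign of λ, hence that of the tangent. -/
theorem InBand.signs {R m : ℝ} (hR : 0 < R) (hm : 0 ≤ m) {n : ℕ} {k : ℤ} {lam : ℝ}
    (h : InBand R m n k lam) :
    0 < lam / (lam + m) ∧ 0 < Real.tan (boundaryPhase R m n lam) / (lam + m) := by
  have hsq := h.sq_lt_sq hR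
  match k, h with
  | .ofNat q, h =>
    have h0 : 0 < lam + m := by linarith [h.1]
    have ht := Real.tan_pos_of_pos_of_lt_pi_div_two (x := boundaryPhase R m n lam - q * Real.pi)
      (by linarith [h.2.1]) (by linarith [h.2.2])
    rw [Real.tan_sub_nat_mul_pi] at ht
    exact ⟨div_pos h.1 h0, div_pos ht h0⟩
  | .negSucc q, h =>
    have h0 : lam + m < 0 := by nlinarith [h.1]
    have ht := Real.tan_neg_of_neg_of_pi_div_two_lt
      (x := boundaryPhase R m n lam - (q + 1 : ℕ) * Real.pi)
      (by push_cast; linarith [h.2.2]) (by push_cast; linarith [h.2.1])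
    rw [Real.tan_sub_nat_mul_pi] at ht
    exact ⟨div_pos_of_neg_of_neg h.1 h0, div_pos_of_neg_of_neg ht h0⟩

theorem InBand.add_ne_zero {R m : ℝ} (hR : 0 < R) (hm : 0 ≤ m) {n : ℕ} {k : ℤ} {lam : ℝ}
    (h : InBand R m n k lam) : lam + m ≠ 0 := fun h0 => by
  simpa [h0] using (h.signs hR hm).1

theorem InBand.cos_ne_zero {R m : ℝ} (hR : 0 < R) (hm : 0 ≤ m) {n : ℕ} {k : ℤ} {lam : ℝ}
    (h : InBand R m n k lam) : Real.cos (boundaryPhase R m n lam) ≠ 0 := fun h0 => by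
  simpa [Real.tan_eq_sin_div_cos, h0] using (h.signs hR hm).2

theorem InBand.dispersion_pos {R m : ℝ} (hR : 0 < R) (hm : 0 ≤ m) {n : ℕ} {k : ℤ} {lam : ℝ}
    (h : InBand R m n k lam) : 0 < dispersion R m n lam := by
  have h1 : 0 < Real.sqrt (lam ^ 2 - m ^ 2) := Real.sqrt_pos.mpr (sub_pos.mpr (h.sq_lt_sq hR))
  rw [dispersion, div_mul_eq_mul_div, mul_div_assoc]
  exact mul_pos h1 (h.signs hR hm).2

theorem InBand.contDiffAt_dispersion {R m : ℝ} (hR : 0 < R) (hm : 0 ≤ m) {n : ℕ} {k : ℤ} {lam : ℝ}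
    (h : InBand R m n k lam) : ContDiffAt ℝ ∞ (dispersion R m n) lam := by
  have hs : ContDiffAt ℝ ∞ (fun x : ℝ => Real.sqrt (x ^ 2 - m ^ 2)) lam :=
    ContDiffAt.sqrt (by fun_prop) (sub_pos.mpr (h.sq_lt_sq hR)).ne'
  have hb : ContDiffAt ℝ ∞ (boundaryPhase R m n) lam :=
    (contDiff_besselPhase n).contDiffAt.comp lam (contDiffAt_const.mul hs)
  refine (hs.div (by fun_prop) (h.add_ne_zero hR hm)).mul ?_
  exact (Real.contDiffAt_tan.mpr (h.cos_ne_zero hR hm)).comp lam hb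

/-- Both terms of the product rule have a sign: they are m/w · tan θ/(λ + m) ≥ 0 and a positive
multiple of θ' · λ/(λ + m) > 0. -/
theorem InBand.deriv_dispersion_pos {R m : ℝ} (hR : 0 < R) (hm : 0 ≤ m) {n : ℕ} {k : ℤ} {lam : ℝ}
    (h : InBand R m n k lam) : 0 < deriv (dispersion R m n) lam := by
  have hsq := h.sq_lt_sq hR
  obtain ⟨hsg1, hsg2⟩ := h.signs hR hm
  have hadd := h.add_ne_zero hR hm
  set om : ℝ := Real.sqrt (lam ^ 2 - m ^ 2) with hom
  have hpos : 0 < lam ^ 2 - m ^ 2 := sub_pos.mpr hsq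
  have hom0 : 0 < om := Real.sqrt_pos.mpr hpos
  have hom2 : om * om = lam ^ 2 - m ^ 2 := Real.mul_self_sqrt hpos.le
  have hs : HasDerivAt (fun x : ℝ => Real.sqrt (x ^ 2 - m ^ 2)) (lam / om) lam := by
    have := ((hasDerivAt_pow 2 lam).sub_const (m ^ 2)).sqrt hpos.ne'
    refine this.congr_deriv ?_
    rw [← hom]
    field_simp
    push_cast
    ring
  -- The numerator λ(λ + m) - w² of the quotient rule, up to the factor 1/w, collapses to m(λ + m).
  have h1 : HasDerivAt (fun x : ℝ => Real.sqrt (x ^ 2 - m ^ 2) / (x + m)) (m / (om * (lam + m)))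
      lam := by
    refine (hs.div ((hasDerivAt_id lam).add_const m) hadd).congr_deriv ?_
    simp only [id, ← hom]
    field_simp
    linear_combination -hom2
  have hth := (besselLogDeriv_im_pos n (mul_pos hR hom0))
  have hb : HasDerivAt (boundaryPhase R m n)
      ((besselLogDeriv n (R * om)).im * (R * (lam / om))) lam :=
    (hasDerivAt_besselPhase n (R * om)).comp lam (hs.const_mul R)
  have ht := (Real.hasDerivAt_tan (h.cos_ne_zero hR hm)).comp lam hb
  have hG : HasDerivAt (dispersion R m n) _ lam := h1.mul ht
  rw [hG.deriv]
  set th := (besselLogDeriv n (R * om)).im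
  set c := Real.cos (boundaryPhase R m n lam)
  have hc : 0 < c ^ 2 := by have := h.cos_ne_zero hR hm; positivity
  have e1 : m / (om * (lam + m)) * Real.tan (boundaryPhase R m n lam) =
      m / om * (Real.tan (boundaryPhase R m n lam) / (lam + m)) := by
    field_simp
  have e2 : om / (lam + m) * (1 / c ^ 2 * (th * (R * (lam / om)))) =
      1 / c ^ 2 * (th * R) * (lam / (lam + m)) := by
    field_simp
  rw [e1, ← hom, e2]
  have : 0 ≤ m / om * (Real.tan (boundaryPhase R m n lam) / (lam + m)) := by positivity
  have : 0 < 1 / c ^ 2 * (th * R) * (lam / (lam + m)) := by positivity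
  linarith

/-- In every case the left end comes from a zero of J_{n+3/2}, or from w = 0 when k = 0, and the
right end from a zero of J_{n+1/2}. For negative k the reflection of the energies reverses the order
of the two edges, so the roles stay the same. -/
theorem exists_curveInterval_minus_eq {R m : ℝ} (hR : 0 < R) (hm : 0 ≤ m) (n : ℕ) (k : ℤ) :
    ∃ a b, curveInterval R m .minus n k = Set.Ioo a b ∧
      Real.sin (boundaryPhase R m n a) = 0 ∧ Real.cos (boundaryPhase R m n b) = 0 ∧
      m ^ 2 < b ^ 2 ∧ (m ≤ a ∨ a < -m) := by
  have hj := besselPhase_besselZero_jOf n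
  have hj1 := besselPhase_besselZero_jOf_add_one n
  have hpi := Real.pi_pos
  have hbp : ∀ q : ℕ, boundaryPhase R m n (edge R m (jOf n) (q + 1)) = q * Real.pi + Real.pi / 2 :=
    fun q => by rw [boundaryPhase_edge m hR n _ (hj q).1, (hj q).2]
  have hbp1 : ∀ q : ℕ, boundaryPhase R m n (edge R m (jOf n + 1) (q + 1)) =
      q * Real.pi + Real.pi := fun q => by rw [boundaryPhase_edge m hR n _ (hj1 q).1, (hj1 q).2]
  have hcos : ∀ q : ℕ, Real.cos ((q : ℝ) * Real.pi + Real.pi / 2) = 0 := fun q =>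
    Real.cos_eq_zero_iff.mpr ⟨q, by push_cast; ring⟩
  have hsin : ∀ q : ℕ, Real.sin ((q : ℝ) * Real.pi + Real.pi) = 0 := fun q =>
    Real.sin_eq_zero_iff.mpr ⟨q + 1, by push_cast; ring⟩
  have hsq : ∀ q : ℕ, m ^ 2 < edge R m (jOf n) (q + 1) ^ 2 := fun q => by
    rw [← boundaryPhase_pos_iff m hR n, hbp]; positivity
  have hsq1 : ∀ q : ℕ, m < edge R m (jOf n + 1) (q + 1) := fun q => by
    rw [← sq_lt_sq₀ hm (edge_pos m hR (hj1 q).1).le, ← boundaryPhase_pos_iff m hR n, hbp1]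
    positivity
  match k with
  | .ofNat 0 =>
    refine ⟨m, _, rfl, ?_, ?_, hsq 0, .inl le_rfl⟩
    · simp [boundaryPhase, besselPhase_zero]
    · rw [hbp 0, hcos]
  | .ofNat (q + 1) =>
    refine ⟨_, _, rfl, ?_, ?_, hsq (q + 1), .inl (hsq1 q).le⟩
    · rw [hbp1, hsin]
    · rw [hbp, hcos]
  | .negSucc q =>
    refine ⟨_, _, rfl, ?_, ?_, ?_, .inr (neg_lt_neg (hsq1 q))⟩
    · rw [boundaryPhase_neg, hbp1, hsin]
    · rw [boundaryPhase_neg, hbp, hcos]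
    · rw [neg_sq]; exact hsq q

theorem tendsto_dispersion_left {R m a : ℝ} (hm : 0 ≤ m) (n : ℕ)
    (hsin : Real.sin (boundaryPhase R m n a) = 0) (ha : m ≤ a ∨ a < -m) :
    Tendsto (dispersion R m n) (𝓝[>] a) (𝓝 0) := by
  have hcos : Real.cos (boundaryPhase R m n a) ≠ 0 := fun h => by
    simpa [h, hsin] using Real.sin_sq_add_cos_sq (boundaryPhase R m n a)
  have htan : ContinuousAt (fun x => Real.tan (boundaryPhase R m n x)) a :=
    (Real.continuousAt_tan.mpr hcos).comp (continuous_boundaryPhase R m n).continuousAt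
  have htan0 : Tendsto (fun x => Real.tan (boundaryPhase R m n x)) (𝓝[>] a) (𝓝 0) := by
    have := htan.tendsto
    rw [Real.tan_eq_sin_div_cos, hsin, zero_div] at this
    exact this.mono_left nhdsWithin_le_nhds
  rcases ha with ha | ha
  -- The prefactor w/(x + m) is at most 1 to the right of a. A bound replaces continuity because the
  -- prefactor is 0/0 at a when a = m = 0.
  · refine squeeze_zero_norm' ?_ (htan0.norm.trans (by simp))
    filter_upwards [self_mem_nhdsWithin] with x hx
    have hx : a < x := hx
    have hxm : 0 < x + m := by linarith
    rw [dispersion, norm_mul, Real.norm_eq_abs, abs_of_nonneg (by positivity)]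
    refine mul_le_of_le_one_left (norm_nonneg _) ?_
    rw [div_le_one hxm, Real.sqrt_le_left hxm.le]
    nlinarith
  · have h1 : ContinuousAt (fun x : ℝ => Real.sqrt (x ^ 2 - m ^ 2) / (x + m)) a :=
      ContinuousAt.div (by fun_prop) (by fun_prop) (by linarith)
    have := (h1.tendsto.mono_left nhdsWithin_le_nhds).mul htan0
    rwa [mul_zero] at this

/-- The reciprocal (x + m)/w · cot θ is continuous at b and vanishes there. -/
theorem tendsto_inv_dispersion_right {R m b : ℝ} (n : ℕ)
    (hcos : Real.cos (boundaryPhase R m n b) = 0) (hb : m ^ 2 < b ^ 2) :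
    Tendsto (fun x => (dispersion R m n x)⁻¹) (𝓝[<] b) (𝓝 0) := by
  have hsin : Real.sin (boundaryPhase R m n b) ≠ 0 := fun h => by
    simpa [h, hcos] using Real.sin_sq_add_cos_sq (boundaryPhase R m n b)
  have hc := continuous_boundaryPhase R m n
  have h : ContinuousAt (fun x : ℝ => (x + m) / Real.sqrt (x ^ 2 - m ^ 2) *
      (Real.cos (boundaryPhase R m n x) / Real.sin (boundaryPhase R m n x))) b :=
    ContinuousAt.mul (ContinuousAt.div (by fun_prop) (by fun_prop)
      (Real.sqrt_pos.mpr (sub_pos.mpr hb)).ne')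
      (ContinuousAt.div (Real.continuous_cos.comp hc).continuousAt
        (Real.continuous_sin.comp hc).continuousAt hsin)
  have h0 := h.tendsto
  rw [hcos, zero_div, mul_zero] at h0
  refine (h0.mono_left nhdsWithin_le_nhds).congr fun x => ?_
  rw [dispersion, Real.tan_eq_sin_div_cos, mul_inv, inv_div, inv_div]

theorem exists_minus_curve {R m : ℝ} (hR : 0 < R) (hm : 0 ≤ m) (n : ℕ) (k : ℤ) :
    ∃ lam : ℝ → ℝ, ContDiff ℝ ∞ lam ∧ StrictMono lam ∧
      Set.range lam = curveInterval R m .minus n k ∧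
      ∀ τ, dispersion R m n (lam τ) = Real.exp τ := by
  obtain ⟨a, b, hI, hsin, hcos, hb, ha⟩ := exists_curveInterval_minus_eq hR hm n k
  have hband : ∀ x ∈ Set.Ioo a b, InBand R m n k x := fun x hx =>
    (mem_curveInterval_minus_iff hR hm n k x).mp (hI ▸ hx)
  obtain ⟨x, hx⟩ := exists_inBand m hR n k
  have hx' : x ∈ Set.Ioo a b := hI ▸ (mem_curveInterval_minus_iff hR hm n k x).mpr hx
  rw [hI]
  exact exists_smooth_strictMono_inverse (hx'.1.trans hx'.2)
    (fun y hy => (hband y hy).contDiffAt_dispersion hR hm)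
    (fun y hy => (hband y hy).dispersion_pos hR hm)
    (fun y hy => (hband y hy).deriv_dispersion_pos hR hm)
    (tendsto_dispersion_left hm n hsin ha) (tendsto_inv_dispersion_right n hcos hb)

/-! ### The boundary relation and the eigenvalue curves -/

/-- The eigenvalue condition: `v = i e^τ (σ · ν) u` at the boundary, in terms of the normalized
Bessel functions. -/
def BoundaryRelation (R m τ : ℝ) (n : ℕ) (s : Branch) (lam : ℝ) : Prop :=
  match s with
  | .minus => Real.sqrt (lam ^ 2 - m ^ 2) * besselOdd n (R * Real.sqrt (lam ^ 2 - m ^ 2)) =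
      Real.exp τ * (lam + m) * besselEven n (R * Real.sqrt (lam ^ 2 - m ^ 2))
  | .plus => Real.sqrt (lam ^ 2 - m ^ 2) * besselEven n (R * Real.sqrt (lam ^ 2 - m ^ 2)) =
      -(Real.exp τ * (lam + m) * besselOdd n (R * Real.sqrt (lam ^ 2 - m ^ 2)))

theorem exists_curves {R m : ℝ} (hR : 0 < R) (hm : 0 ≤ m) (n : ℕ) :
    ∃ lam : Branch → ℤ → ℝ → ℝ,
      (∀ s : Branch, Function.Injective (lam s)) ∧
      ∀ (s : Branch) (k : ℤ),
        ContDiff ℝ ∞ (lam s k) ∧ StrictMono (lam s k) ∧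
        Set.range (lam s k) = curveInterval R m s n k ∧
        ∀ τ : ℝ, m ^ 2 < lam s k τ ^ 2 ∧ BoundaryRelation R m τ n s (lam s k τ) := by
  choose l hsm hmono hrange hdisp using exists_minus_curve hR hm n
  have hband : ∀ k τ, InBand R m n k (l k τ) := fun k τ =>
    (mem_curveInterval_minus_iff hR hm n k _).mp (hrange k ▸ Set.mem_range_self τ)
  have hrel : ∀ k τ, Real.sqrt (l k τ ^ 2 - m ^ 2) *
      besselOdd n (R * Real.sqrt (l k τ ^ 2 - m ^ 2)) = Real.exp τ * (l k τ + m) *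
        besselEven n (R * Real.sqrt (l k τ ^ 2 - m ^ 2)) := by
    intro k τ
    have h := hdisp k τ
    have h1 := (hband k τ).cos_ne_zero hR hm
    have h2 := (hband k τ).add_ne_zero hR hm
    rw [dispersion, Real.tan_eq_sin_div_cos, div_mul_div_comm, div_eq_iff (mul_ne_zero h2 h1)] at h
    rw [besselOdd_eq, besselEven_eq]
    simp only [boundaryPhase] at h
    linear_combination besselAmp n (R * Real.sqrt (l k τ ^ 2 - m ^ 2)) * h
  -- The plus curves are the minus curves with the signs of energy and τ reversed.
  refine ⟨fun s k τ => match s with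
    | .minus => l k τ
    | .plus => -l k (-τ), fun s k k' h => ?_, fun s k => ?_⟩
  · have h0 := congrFun h 0
    match s, h0 with
    | .minus, h0 =>
      have h1 : l k 0 = l k' 0 := h0
      exact (hband k 0).index_unique (h1 ▸ hband k' 0)
    | .plus, h0 =>
      have h1 : l k (-0) = l k' (-0) := neg_injective h0
      exact (hband k (-0)).index_unique (h1 ▸ hband k' (-0))
  · match s with
    | .minus => exact ⟨hsm k, hmono k, hrange k, fun τ => ⟨(hband k τ).sq_lt_sq hR, hrel k τ⟩⟩
    | .plus =>
      refine ⟨((hsm k).comp contDiff_neg).neg,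
        fun σ τ h => neg_lt_neg (hmono k (neg_lt_neg h)), ?_, fun τ => ⟨?_, ?_⟩⟩
      · ext x
        rw [curveInterval_plus, ← hrange k]
        constructor
        · rintro ⟨τ, rfl⟩
          exact ⟨-τ, by simp⟩
        · rintro ⟨τ, hτ⟩
          exact ⟨-τ, by simp [hτ]⟩
      · rw [neg_sq]
        exact (hband k (-τ)).sq_lt_sq hR
      · have hsq := (hband k (-τ)).sq_lt_sq hR
        have hr := hrel k (-τ)
        simp only [BoundaryRelation, neg_sq]
        have ho : 0 < Real.sqrt (l k (-τ) ^ 2 - m ^ 2) := Real.sqrt_pos.mpr (sub_pos.mpr hsq)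
        have ho2 := Real.mul_self_sqrt (sub_pos.mpr hsq).le
        have hexp : Real.exp τ * Real.exp (-τ) = 1 := by rw [← Real.exp_add]; simp
        -- After multiplication by w, the identity w² = (l - m)(l + m) lets the minus relation at -τ
        -- become the plus relation at τ.
        refine mul_left_cancel₀ ho.ne' ?_
        linear_combination besselEven n (R * Real.sqrt (l k (-τ) ^ 2 - m ^ 2)) * ho2
          - Real.exp τ * (l k (-τ) - m) * hr
          - (l k (-τ) ^ 2 - m ^ 2) *
            besselEven n (R * Real.sqrt (l k (-τ) ^ 2 - m ^ 2)) * hexp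

/-! ### Derivatives of Legendre polynomials -/

section Legendre
open Polynomial

theorem iterate_derivative_X_mul_succ (f : ℝ[X]) (k : ℕ) :
    derivative^[k + 1] (X * f) = X * derivative^[k + 1] f + ((k : ℝ[X]) + 1) * derivative^[k] f := by
  induction k with
  | zero => simp [add_comm]
  | succ k ih =>
    rw [Function.iterate_succ_apply', ih, Function.iterate_succ_apply' _ (k + 1)]
    simp only [derivative_add, derivative_mul, derivative_X, derivative_natCast, derivative_one,
      Function.iterate_succ_apply']
    push_cast
    ring

theorem iterate_derivative_sq_sub_one_mul (f : ℝ[X]) (k : ℕ) :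
    derivative^[k + 2] ((X ^ 2 - 1) * f) = (X ^ 2 - 1) * derivative^[k + 2] f
      + 2 * ((k : ℝ[X]) + 2) * X * derivative^[k + 1] f + ((k : ℝ[X]) + 2) * ((k : ℝ[X]) + 1) * derivative^[k] f := by
  rw [show (X ^ 2 - 1) * f = X * (X * f) - f by ring, iterate_derivative_sub,
    iterate_derivative_X_mul_succ, iterate_derivative_X_mul_succ, iterate_derivative_X_mul_succ]
  push_cast
  ring

theorem derivative_sq_sub_one_pow (n : ℕ) :
    derivative ((X ^ 2 - 1 : ℝ[X]) ^ (n + 1)) =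
      2 * ((n : ℝ[X]) + 1) * (X * (X ^ 2 - 1) ^ n) := by
  rw [derivative_pow_succ]
  simp
  ring_nf

theorem iterate_derivative_const_mul (c f : ℝ[X]) (hc : derivative c = 0) (k : ℕ) :
    derivative^[k] (c * f) = c * derivative^[k] f := by
  induction k with
  | zero => rfl
  | succ k ih => rw [Function.iterate_succ_apply', ih, Function.iterate_succ_apply',
      derivative_mul, hc, zero_mul, zero_add]

theorem iterate_derivative_sq_sub_one_pow_succ (n k : ℕ) :
    derivative^[k + 2] ((X ^ 2 - 1 : ℝ[X]) ^ (n + 1)) = 2 * ((n : ℝ[X]) + 1) *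
      (X * derivative^[k + 1] ((X ^ 2 - 1 : ℝ[X]) ^ n) +
        ((k : ℝ[X]) + 1) * derivative^[k] ((X ^ 2 - 1 : ℝ[X]) ^ n)) := by
  rw [Function.iterate_succ_apply, derivative_sq_sub_one_pow,
    iterate_derivative_const_mul _ _ (by simp), iterate_derivative_X_mul_succ]

theorem iterate_derivative_legendreP (n q : ℕ) :
    derivative^[q] (legendreP n) = C (1 / (2 ^ n * (n.factorial : ℝ))) *
      derivative^[n + q] ((X ^ 2 - 1 : ℝ[X]) ^ n) := by
  rw [legendreP, iterate_derivative_C_mul, ← Function.iterate_add_apply, add_comm q n]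

theorem legendreP_succ_const (n : ℕ) :
    (1 / (2 ^ n * (n.factorial : ℝ))) = 2 * (n + 1) * (1 / (2 ^ (n + 1) * ((n + 1).factorial : ℝ))) := by
  have : (n.factorial : ℝ) ≠ 0 := by positivity
  rw [Nat.factorial_succ]
  push_cast
  field_simp
  ring

theorem legendreP_zero : legendreP 0 = 1 := by simp [legendreP]

theorem legendreP_one : legendreP 1 = X := by
  have h1 : derivative ((X ^ 2 - 1 : ℝ[X]) ^ (0 + 1)) = C 2 * X := by
    rw [derivative_sq_sub_one_pow]; simp [C_ofNat]
  simp only [legendreP, Function.iterate_one]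
  rw [zero_add] at h1
  rw [h1, ← mul_assoc, ← C_mul]
  simp

/-- `P_{n+1}^{(q+1)} = z P_n^{(q+1)} + (n + q + 1) P_n^{(q)}`. -/
theorem legendreP_succ_derivative (n q : ℕ) (z : ℝ) :
    (derivative^[q + 1] (legendreP (n + 1))).eval z =
      z * (derivative^[q + 1] (legendreP n)).eval z
        + (n + q + 1) * (derivative^[q] (legendreP n)).eval z := by
  have h := congrArg (eval z) (iterate_derivative_sq_sub_one_pow_succ n (n + q))
  simp only [iterate_derivative_legendreP, eval_mul, eval_C, eval_add, eval_X, eval_natCast,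
    eval_one, eval_ofNat] at h ⊢
  rw [legendreP_succ_const n, show n + 1 + (q + 1) = n + q + 2 by ring, h]
  push_cast
  ring

/-- `(n + 1 - q) P_{n+1}^{(q)} = (n + q + 1) z P_n^{(q)} - (1 - z²) P_n^{(q+1)}`. -/
theorem legendreP_succ_eval (n q : ℕ) (z : ℝ) :
    ((n : ℝ) + 1 - q) * (derivative^[q] (legendreP (n + 1))).eval z =
      (n + q + 1) * z * (derivative^[q] (legendreP n)).eval z
        - (1 - z ^ 2) * (derivative^[q + 1] (legendreP n)).eval z := by
  -- The general argument uses the derivative of order n + q - 1 of (X² - 1)^n, so n + q = 0 is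
  -- treated apart.
  obtain h0 | ⟨k, hk⟩ : n + q = 0 ∨ ∃ k, n + q = k + 1 := by
    rcases Nat.eq_zero_or_pos (n + q) with h | h
    · exact .inl h
    · exact .inr ⟨n + q - 1, by omega⟩
  · obtain ⟨rfl, rfl⟩ : n = 0 ∧ q = 0 := by omega
    simp [legendreP_zero, legendreP_one]
  · have h1 := congrArg (eval z) (iterate_derivative_sq_sub_one_pow_succ n k)
    have h2 := congrArg (eval z) (iterate_derivative_sq_sub_one_mul ((X ^ 2 - 1 : ℝ[X]) ^ n) k)
    rw [← pow_succ'] at h2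
    simp only [iterate_derivative_legendreP, eval_mul, eval_C, eval_add, eval_sub, eval_pow, eval_X,
      eval_natCast, eval_one, eval_ofNat] at h1 h2 ⊢
    have hkr : (n : ℝ) + q = k + 1 := by exact_mod_cast hk
    rw [legendreP_succ_const n, show n + 1 + q = k + 2 by omega, hk,
      show n + (q + 1) = k + 2 by omega]
    set c := (1 / (2 ^ (n + 1) * ((n + 1).factorial : ℝ)))
    rw [show (q : ℝ) = k + 1 - n by linarith]
    -- Two Leibniz expansions of the same derivative of (X² - 1)^(n+1) are combined so that the term
    -- of order n + q - 1 drops out.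
    linear_combination c * (2 * (n + 1)) * h2 - c * (k + 2) * h1

/-- Legendre's differential equation, differentiated `q` times. -/
theorem legendreP_ode (n q : ℕ) (z : ℝ) :
    (1 - z ^ 2) * (derivative^[q + 2] (legendreP n)).eval z
      - 2 * (q + 1) * z * (derivative^[q + 1] (legendreP n)).eval z
      + (n - q) * (n + q + 1) * (derivative^[q] (legendreP n)).eval z = 0 := by
  obtain h0 | ⟨k, hk⟩ : n = 0 ∨ ∃ k, n = k + 1 := by
    rcases n with _ | k
    · exact .inl rfl
    · exact .inr ⟨k, rfl⟩
  · subst h0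
    rcases q with _ | q
    · simp [legendreP_zero]
    · simp [legendreP_zero, iterate_derivative_one]
  · subst hk
    -- With n = k + 1 and f = (X² - 1)^n, the equation (X² - 1) f' = 2n X f is differentiated n + q
    -- + 1 times.
    have h := congrArg (derivative^[k + q + 2])
      (show (X ^ 2 - 1 : ℝ[X]) * derivative ((X ^ 2 - 1 : ℝ[X]) ^ (k + 1)) =
        2 * ((k : ℝ[X]) + 1) * (X * (X ^ 2 - 1) ^ (k + 1)) by rw [derivative_sq_sub_one_pow]; ring)
    rw [iterate_derivative_sq_sub_one_mul, iterate_derivative_const_mul _ _ (by simp),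
      iterate_derivative_X_mul_succ] at h
    simp only [← Function.iterate_succ_apply] at h
    replace h := congrArg (eval z) h
    simp only [iterate_derivative_legendreP, eval_mul, eval_C, eval_add, eval_sub, eval_pow, eval_X,
      eval_natCast, eval_one, eval_ofNat] at h ⊢
    rw [show k + 1 + (q + 2) = k + q + 2 + 1 by ring, show k + 1 + (q + 1) = k + q + 2 by ring,
      show k + 1 + q = k + q + 1 by ring]
    set c := (1 / (2 ^ (k + 1) * ((k + 1).factorial : ℝ)))
    simp only [Nat.succ_eq_add_one] at h
    push_cast at h ⊢
    linear_combination -c * h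

/-- Parity and degree: (X² - 1)^n contains only even powers up to 2n. Consequently the
homogenization of P_n^{(q)} needs only powers of |x|² and is a polynomial. -/
theorem legendreP_coeff_ne_zero {n q k : ℕ} (h : (derivative^[q] (legendreP n)).coeff k ≠ 0) :
    ∃ e, n = q + k + 2 * e := by
  rw [iterate_derivative_legendreP, coeff_C_mul, coeff_iterate_derivative] at h
  have h1 : ((X ^ 2 - 1 : ℝ[X]) ^ n).coeff (k + (n + q)) ≠ 0 := fun h0 => h (by simp [h0])
  have hexp : (X ^ 2 - 1 : ℝ[X]) ^ n = expand ℝ 2 ((X - 1) ^ n) := by simp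
  rw [hexp, coeff_expand two_pos] at h1
  have h2 : 2 ∣ k + (n + q) := by by_contra h3; simp [h3] at h1
  rw [if_pos h2] at h1
  have h3 : (k + (n + q)) / 2 ≤ n := by
    refine (le_natDegree_of_ne_zero h1).trans ?_
    refine natDegree_pow_le.trans ?_
    rw [← C_1, natDegree_X_sub_C, mul_one]
  exact ⟨(n - q - k) / 2, by omega⟩

theorem iterate_derivative_legendreP_ne_zero {n q : ℕ} (h : q ≤ n) :
    derivative^[q] (legendreP n) ≠ 0 := by
  rw [iterate_derivative_legendreP]
  refine mul_ne_zero (C_ne_zero.mpr (by positivity)) fun h0 => ?_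
  have hdeg : ((X ^ 2 - 1 : ℝ[X]) ^ n).natDegree = n * 2 := by
    rw [natDegree_pow, ← C_1, natDegree_X_pow_sub_C]
  have hc := congrArg (fun p => coeff p (n - q)) h0
  simp only [coeff_iterate_derivative, coeff_zero, smul_eq_zero] at hc
  rcases hc with hc | hc
  · exact absurd hc (Nat.descFactorial_pos.mpr (by omega)).ne'
  · rw [show n - q + (n + q) = n * 2 by omega, ← hdeg, coeff_natDegree, leadingCoeff_eq_zero] at hc
    rw [hc] at hdeg
    simp at hdeg
    subst hdeg
    simp at hc

theorem legendreP_derivative_eq_zero {n q : ℕ} (h : n < q) : derivative^[q] (legendreP n) = 0 := by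
  ext k
  rw [coeff_zero]
  by_contra hk
  obtain ⟨e, he⟩ := legendreP_coeff_ne_zero hk
  omega

end Legendre

/-! ### Partial derivatives -/

/-- The classical `i`-th partial derivative. -/
noncomputable def partialDeriv (i : Fin 3) (f : E3 → ℂ) (x : E3) : ℂ := fderiv ℝ f x (basisVec i)

theorem partialDeriv_mul {f g : E3 → ℂ} {x : E3} (i : Fin 3) (hf : DifferentiableAt ℝ f x)
    (hg : DifferentiableAt ℝ g x) :
    partialDeriv i (fun y => f y * g y) x =
      partialDeriv i f x * g x + f x * partialDeriv i g x := by
  rw [partialDeriv, fderiv_fun_mul hf hg]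
  simp [partialDeriv]
  ring

theorem partialDeriv_add {f g : E3 → ℂ} {x : E3} (i : Fin 3) (hf : DifferentiableAt ℝ f x)
    (hg : DifferentiableAt ℝ g x) :
    partialDeriv i (fun y => f y + g y) x = partialDeriv i f x + partialDeriv i g x := by
  rw [partialDeriv, fderiv_fun_add hf hg]
  simp [partialDeriv]

theorem partialDeriv_sub {f g : E3 → ℂ} {x : E3} (i : Fin 3) (hf : DifferentiableAt ℝ f x)
    (hg : DifferentiableAt ℝ g x) :
    partialDeriv i (fun y => f y - g y) x = partialDeriv i f x - partialDeriv i g x := by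
  rw [partialDeriv, fderiv_fun_sub hf hg]
  simp [partialDeriv]

theorem partialDeriv_const_mul {f : E3 → ℂ} {x : E3} (i : Fin 3) (c : ℂ)
    (hf : DifferentiableAt ℝ f x) :
    partialDeriv i (fun y => c * f y) x = c * partialDeriv i f x := by
  rw [partialDeriv, fderiv_const_mul hf]
  simp [partialDeriv]

theorem partialDeriv_conj {f : E3 → ℂ} {x : E3} (i : Fin 3) (hf : DifferentiableAt ℝ f x) :
    partialDeriv i (fun y => (starRingEnd ℂ) (f y)) x = (starRingEnd ℂ) (partialDeriv i f x) := by
  have h := (Complex.conjCLE.toContinuousLinearMap.hasFDerivAt (x := f x)).comp x hf.hasFDerivAt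
  rw [partialDeriv, show (fun y => (starRingEnd ℂ) (f y)) =
    (Complex.conjCLE : ℂ →L[ℝ] ℂ) ∘ f from rfl, h.fderiv]
  rfl

theorem partialDeriv_ofReal {f : E3 → ℝ} {f' : E3 →L[ℝ] ℝ} {x : E3} (i : Fin 3)
    (hf : HasFDerivAt f f' x) :
    partialDeriv i (fun y => (f y : ℂ)) x = (f' (basisVec i) : ℝ) := by
  have h := (Complex.ofRealCLM.hasFDerivAt (x := f x)).comp x hf
  rw [partialDeriv, show (fun y => (f y : ℂ)) = Complex.ofRealCLM ∘ f from rfl, h.fderiv]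
  rfl

/-- The `i`-th coordinate functional. -/
noncomputable def coordCLM (i : Fin 3) : E3 →L[ℝ] ℝ := EuclideanSpace.proj i

theorem partialDeriv_coord (i j : Fin 3) (x : E3) :
    partialDeriv i (fun y => (y j : ℂ)) x = if j = i then 1 else 0 := by
  have := partialDeriv_ofReal i (coordCLM j).hasFDerivAt (x := x)
  refine this.trans ?_
  by_cases h : j = i <;> simp [coordCLM, basisVec, h]

theorem contDiff_coord (j : Fin 3) : ContDiff ℝ ∞ fun y : E3 => (y j : ℂ) :=
  Complex.ofRealCLM.contDiff.comp (coordCLM j).contDiff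

/-- `x₁ + i x₂`. -/
noncomputable def complexCoord (x : E3) : ℂ := (x 0 : ℂ) + Complex.I * (x 1 : ℂ)

theorem contDiff_complexCoord : ContDiff ℝ ∞ complexCoord :=
  (contDiff_coord 0).add (contDiff_const.mul (contDiff_coord 1))

theorem differentiableAt_of_contDiff {f : E3 → ℂ} (hf : ContDiff ℝ ∞ f) (x : E3) :
    DifferentiableAt ℝ f x := hf.differentiable (by simp) x

theorem partialDeriv_complexCoord (i : Fin 3) (x : E3) :
    partialDeriv i complexCoord x = ![1, Complex.I, 0] i := by
  have h := partialDeriv_add i (differentiableAt_of_contDiff (contDiff_coord 0) x)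
    (differentiableAt_of_contDiff (contDiff_const (c := Complex.I) |>.mul (contDiff_coord 1)) x)
  refine h.trans ?_
  rw [partialDeriv_const_mul i _ (differentiableAt_of_contDiff (contDiff_coord 1) x),
    partialDeriv_coord, partialDeriv_coord]
  fin_cases i <;> simp

theorem partialDeriv_complexCoord_pow (i : Fin 3) (q : ℕ) (x : E3) :
    partialDeriv i (fun y => complexCoord y ^ q) x =
      q * complexCoord x ^ (q - 1) * ![1, Complex.I, 0] i := by
  rw [partialDeriv,
    fderiv_fun_pow q (differentiableAt_of_contDiff contDiff_complexCoord x)]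
  simp only [smul_apply]
  rw [← partialDeriv_complexCoord i x]
  simp [partialDeriv, mul_assoc]

theorem norm_sq_eq_coords (x : E3) : ‖x‖ ^ 2 = x 0 ^ 2 + x 1 ^ 2 + x 2 ^ 2 := by
  rw [EuclideanSpace.norm_sq_eq, Fin.sum_univ_three]
  simp

theorem inner_basisVec (x : E3) (i : Fin 3) : inner ℝ x (basisVec i) = x i := by
  simp [basisVec, EuclideanSpace.inner_single_right]

theorem hasFDerivAt_norm {x : E3} (hx : x ≠ 0) :
    HasFDerivAt (fun y : E3 => ‖y‖) (‖x‖⁻¹ • innerSL ℝ x) x := by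
  have h := (hasStrictFDerivAt_norm_sq x).hasFDerivAt.sqrt (by simpa using hx)
  simp only [Real.sqrt_sq (norm_nonneg _)] at h
  refine h.congr_fderiv ?_
  ext y
  have : ‖x‖ ≠ 0 := norm_ne_zero_iff.mpr hx
  simp
  field_simp

/-! ### Solid harmonics -/

open Polynomial in
/-- The homogeneous polynomial `|x| ^ (n - q) P_n^{(q)}(x₃ / |x|)`. -/
noncomputable def solidLegendre (n q : ℕ) (x : E3) : ℝ :=
  ∑ k ∈ Finset.range (n + 1),
    (derivative^[q] (legendreP n)).coeff k * x 2 ^ k * (‖x‖ ^ 2) ^ ((n - q - k) / 2)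

theorem contDiff_solidLegendre (n q : ℕ) : ContDiff ℝ ∞ (solidLegendre n q) := by
  refine ContDiff.sum fun k _ => ?_
  have h1 : ContDiff ℝ ∞ fun y : E3 => y 2 := (coordCLM 2).contDiff
  have h2 : ContDiff ℝ ∞ fun y : E3 => ‖y‖ ^ 2 := contDiff_norm_sq ℝ
  exact (contDiff_const.mul (h1.pow k)).mul (h2.pow _)

/-- `P_n^{(q)}(z)`. -/
noncomputable def legendreDeriv (n q : ℕ) (z : ℝ) : ℝ :=
  (Polynomial.derivative^[q] (legendreP n)).eval z

/-- Wherever the coefficient is nonzero, the truncated difference and the integer division in the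
exponent of |x|² are exact. -/
theorem solidLegendre_eq (n q : ℕ) {x : E3} (hx : x ≠ 0) :
    solidLegendre n q x = ‖x‖ ^ ((n : ℤ) - q) * legendreDeriv n q (x 2 / ‖x‖) := by
  have hr : ‖x‖ ≠ 0 := norm_ne_zero_iff.mpr hx
  have hdeg : (Polynomial.derivative^[q] (legendreP n)).natDegree < n + 1 := by
    by_contra! h
    have h0 : Polynomial.derivative^[q] (legendreP n) ≠ 0 := fun h0 => by simp [h0] at h
    have := legendreP_coeff_ne_zero (n := n) (q := q)
      (k := (Polynomial.derivative^[q] (legendreP n)).natDegree)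
      (by rwa [Polynomial.coeff_natDegree, ne_eq, Polynomial.leadingCoeff_eq_zero])
    obtain ⟨e, he⟩ := this
    omega
  rw [legendreDeriv, Polynomial.eval_eq_sum_range' hdeg, solidLegendre, Finset.mul_sum]
  refine Finset.sum_congr rfl fun k _ => ?_
  by_cases hk : (Polynomial.derivative^[q] (legendreP n)).coeff k = 0
  · simp [hk]
  · obtain ⟨e, he⟩ := legendreP_coeff_ne_zero hk
    rw [show (n - q - k) / 2 = e by omega, show (n : ℤ) - q = ((k + 2 * e : ℕ) : ℤ) by omega,
      zpow_natCast, pow_add, pow_mul, div_pow]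
    field_simp

theorem hasDerivAt_legendreDeriv (n q : ℕ) (z : ℝ) :
    HasDerivAt (legendreDeriv n q) (legendreDeriv n (q + 1) z) z := by
  have := (Polynomial.derivative^[q] (legendreP n)).hasDerivAt z
  rwa [← Function.iterate_succ_apply' (Polynomial.derivative)] at this

/-- Differentiation of the quotient form, valid off the origin; the origin is a null set and never
matters. -/
theorem partialDeriv_solidLegendre (n q : ℕ) (i : Fin 3) {x : E3} (hx : x ≠ 0) :
    partialDeriv i (fun y => (solidLegendre n q y : ℂ)) x =
      ((‖x‖ ^ ((n : ℤ) - q - 2) * ((n - q) * x i * legendreDeriv n q (x 2 / ‖x‖) +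
        legendreDeriv n (q + 1) (x 2 / ‖x‖) *
          ((if (2 : Fin 3) = i then ‖x‖ else 0) - x 2 / ‖x‖ * x i)) : ℝ) : ℂ) := by
  have hr : ‖x‖ ≠ 0 := norm_ne_zero_iff.mpr hx
  have hn := hasFDerivAt_norm hx
  have hz : HasFDerivAt (fun y : E3 => y 2 / ‖y‖)
      (‖x‖⁻¹ • coordCLM 2 - (x 2 / ‖x‖ ^ 3) • innerSL ℝ x) x := by
    have h1 := (coordCLM 2).hasFDerivAt (x := x) |>.mul
      ((hasDerivAt_inv hr).comp_hasFDerivAt x hn)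
    refine h1.congr_fderiv ?_
    ext y
    simp [coordCLM]
    field_simp
    ring
  have hp := (hasDerivAt_zpow ((n : ℤ) - q) ‖x‖ (.inl hr)).comp_hasFDerivAt x hn
  have hl := (hasDerivAt_legendreDeriv n q (x 2 / ‖x‖)).comp_hasFDerivAt x hz
  have h := hp.mul hl
  have h' := h.congr_of_eventuallyEq (f₁ := solidLegendre n q) (by
    filter_upwards [isOpen_ne.mem_nhds hx] with y hy using solidLegendre_eq n q hy)
  rw [partialDeriv_ofReal i h']
  congr 1
  have hb : coordCLM 2 (basisVec i) = if (2 : Fin 3) = i then 1 else 0 := by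
    simp [coordCLM, basisVec]
  simp only [Function.comp, add_apply, smul_apply,
    sub_apply, innerSL_apply_apply, inner_basisVec, hb, smul_eq_mul]
  have e1 : ‖x‖ ^ ((n : ℤ) - q - 1) = ‖x‖ ^ ((n : ℤ) - q - 2) * ‖x‖ := by
    rw [← zpow_add_one₀ hr]; congr 1; ring
  have e2 : ‖x‖ ^ ((n : ℤ) - q) = ‖x‖ ^ ((n : ℤ) - q - 2) * ‖x‖ * ‖x‖ := by
    rw [← e1, ← zpow_add_one₀ hr]; congr 1; ring
  rw [e1, e2]
  push_cast
  split_ifs <;> field_simp <;> ring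

/-! ### Monogenic spinors -/

/-- A smooth two-spinor field which is homogeneous of degree `d` and annihilated by `σ · ∇`. -/
structure IsMonogenic (d : ℕ) (P : E3 → Fin 2 → ℂ) : Prop where
  smooth : ∀ a, ContDiff ℝ ∞ fun x => P x a
  dirac_upper : ∀ x, x ≠ 0 → partialDeriv 2 (fun y => P y 0) x +
    (partialDeriv 0 (fun y => P y 1) x - Complex.I * partialDeriv 1 (fun y => P y 1) x) = 0
  dirac_lower : ∀ x, x ≠ 0 → partialDeriv 0 (fun y => P y 0) x +
    Complex.I * partialDeriv 1 (fun y => P y 0) x - partialDeriv 2 (fun y => P y 1) x = 0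
  euler : ∀ x a, x ≠ 0 → ∑ i, (x i : ℂ) * partialDeriv i (fun y => P y a) x = d * P x a

theorem IsMonogenic.const_mul {d : ℕ} {P : E3 → Fin 2 → ℂ} (hP : IsMonogenic d P) (c : ℂ) :
    IsMonogenic d fun x a => c * P x a := by
  have hd := fun a x => differentiableAt_of_contDiff (hP.smooth a) x
  refine ⟨fun a => contDiff_const.mul (hP.smooth a), fun x hx => ?_, fun x hx => ?_,
    fun x a hx => ?_⟩
  · simp only [partialDeriv_const_mul _ c (hd _ x)]
    linear_combination c * hP.dirac_upper x hx
  · simp only [partialDeriv_const_mul _ c (hd _ x)]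
    linear_combination c * hP.dirac_lower x hx
  · have h := hP.euler x a hx
    simp only [partialDeriv_const_mul _ c (hd _ x), Fin.sum_univ_three] at h ⊢
    linear_combination c * h

/-- Time reversal of two-spinors. -/
noncomputable def timeReversal (v : Fin 2 → ℂ) : Fin 2 → ℂ :=
  ![-(starRingEnd ℂ) (v 1), (starRingEnd ℂ) (v 0)]

/-- Time reversal is antilinear and anticommutes with every Pauli matrix, hence maps the kernel of σ
· ∇ to itself. It supplies the negative values of μ. -/
theorem IsMonogenic.timeReversal {d : ℕ} {P : E3 → Fin 2 → ℂ} (hP : IsMonogenic d P) :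
    IsMonogenic d fun x => timeReversal (P x) := by
  have hd := fun a x => differentiableAt_of_contDiff (hP.smooth a) x
  have hs : ∀ a, ContDiff ℝ ∞ fun x => (starRingEnd ℂ) (P x a) := fun a =>
    (Complex.conjCLE : ℂ ≃L[ℝ] ℂ).contDiff.comp (hP.smooth a)
  have h0 : ∀ i x, partialDeriv i (fun y => DiracBall.timeReversal (P y) 0) x =
      -(starRingEnd ℂ) (partialDeriv i (fun y => P y 1) x) := fun i x => by
    have := partialDeriv_const_mul i (-1) (differentiableAt_of_contDiff (hs 1) x)
    rw [partialDeriv_conj i (hd 1 x)] at this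
    simpa [DiracBall.timeReversal] using this
  have h1 : ∀ i x, partialDeriv i (fun y => DiracBall.timeReversal (P y) 1) x =
      (starRingEnd ℂ) (partialDeriv i (fun y => P y 0) x) := fun i x => by
    rw [← partialDeriv_conj i (hd 0 x)]
    rfl
  refine ⟨fun a => ?_, fun x hx => ?_, fun x hx => ?_, fun x a hx => ?_⟩
  · fin_cases a
    · exact (hs 1).neg
    · exact hs 0
  · have h := congrArg (starRingEnd ℂ) (hP.dirac_lower x hx)
    simp only [map_add, map_sub, map_mul, Complex.conj_I, map_zero] at h
    rw [h0, h1, h1]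
    linear_combination h
  · have h := congrArg (starRingEnd ℂ) (hP.dirac_upper x hx)
    simp only [map_add, map_sub, map_mul, Complex.conj_I, map_zero] at h
    rw [h0, h0, h1]
    linear_combination -h
  · fin_cases a
    · have h := congrArg (starRingEnd ℂ) (hP.euler x 1 hx)
      simp only [Fin.sum_univ_three, map_add, map_mul, Complex.conj_ofReal, map_natCast] at h
      simp only [Fin.zero_eta, Fin.sum_univ_three, h0]
      simp only [DiracBall.timeReversal, Matrix.cons_val_zero]
      linear_combination -h
    · have h := congrArg (starRingEnd ℂ) (hP.euler x 0 hx)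
      simp only [Fin.sum_univ_three, map_add, map_mul, Complex.conj_ofReal, map_natCast] at h
      simp only [Fin.mk_one, Fin.sum_univ_three, h1]
      simp only [DiracBall.timeReversal, Matrix.cons_val_one, Matrix.cons_val_fin_one]
      exact h

/-- The unnormalized solid harmonic spinor of degree `n` and magnetic number `q + 1 / 2`. -/
noncomputable def solidSpinor (n q : ℕ) (x : E3) : Fin 2 → ℂ :=
  ![(n + q + 1) * ((solidLegendre n q x : ℂ) * complexCoord x ^ q),
    -1 * ((solidLegendre n (q + 1) x : ℂ) * complexCoord x ^ (q + 1))]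

theorem contDiff_solidLegendre_mul_pow (n q p : ℕ) :
    ContDiff ℝ ∞ fun x => (solidLegendre n q x : ℂ) * complexCoord x ^ p :=
  (Complex.ofRealCLM.contDiff.comp (contDiff_solidLegendre n q)).mul (contDiff_complexCoord.pow p)

theorem partialDeriv_solidLegendre_mul_pow (n q p : ℕ) (i : Fin 3) (x : E3) :
    partialDeriv i (fun y => (solidLegendre n q y : ℂ) * complexCoord y ^ p) x =
      partialDeriv i (fun y => (solidLegendre n q y : ℂ)) x * complexCoord x ^ p
        + solidLegendre n q x * (p * complexCoord x ^ (p - 1) * ![1, Complex.I, 0] i) := by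
  rw [partialDeriv_mul (f := fun y => (solidLegendre n q y : ℂ)) i (differentiableAt_of_contDiff
    (Complex.ofRealCLM.contDiff.comp (contDiff_solidLegendre n q)) x)
    (differentiableAt_of_contDiff (contDiff_complexCoord.pow p) x), partialDeriv_complexCoord_pow]

theorem legendreDeriv_ode (n q : ℕ) (z : ℝ) :
    (1 - z ^ 2) * legendreDeriv n (q + 2) z - 2 * (q + 1) * z * legendreDeriv n (q + 1) z
      + (n - q) * (n + q + 1) * legendreDeriv n q z = 0 :=
  legendreP_ode n q z

theorem isMonogenic_solidSpinor (n q : ℕ) : IsMonogenic n (solidSpinor n q) := by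
  have hS := contDiff_solidLegendre_mul_pow n
  have h0 : ∀ i x, partialDeriv i (fun y => solidSpinor n q y 0) x = (n + q + 1) *
      (partialDeriv i (fun y => (solidLegendre n q y : ℂ)) x * complexCoord x ^ q
        + solidLegendre n q x * (q * complexCoord x ^ (q - 1) * ![1, Complex.I, 0] i)) :=
    fun i x => by
      rw [← partialDeriv_solidLegendre_mul_pow, ← partialDeriv_const_mul i _
        (differentiableAt_of_contDiff (hS q q) x)]
      rfl
  have h1 : ∀ i x, partialDeriv i (fun y => solidSpinor n q y 1) x = -1 *
      (partialDeriv i (fun y => (solidLegendre n (q + 1) y : ℂ)) x * complexCoord x ^ (q + 1)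
        + solidLegendre n (q + 1) x *
          (((q + 1 : ℕ) : ℂ) * complexCoord x ^ q * ![1, Complex.I, 0] i)) :=
    fun i x => by
      have := partialDeriv_solidLegendre_mul_pow n (q + 1) (q + 1) i x
      rw [Nat.add_sub_cancel] at this
      rw [← this, ← partialDeriv_const_mul i _ (differentiableAt_of_contDiff (hS _ _) x)]
      rfl
  have hI := Complex.I_mul_I
  -- Here r = |x|, ξ = x₃/r, p_i = P_n^{(q+i)}(ξ) and E = r^(n-q-3), an exponent low enough that
  -- only nonnegative further powers of r occur. The equations for σ · ∇ then reduce to the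
  -- differentiated Legendre equation, x₁² + x₂² = r²(1 - ξ²) and i² = -1.
  have setup : ∀ x : E3, x ≠ 0 → ∃ r E ξ p0 p1 p2 : ℂ, (x 2 : ℂ) = ξ * r ∧
      (x 0 : ℂ) ^ 2 + (x 1 : ℂ) ^ 2 = r ^ 2 * (1 - ξ ^ 2) ∧
      (1 - ξ ^ 2) * p2 - 2 * (q + 1) * ξ * p1 + (n - q) * (n + q + 1) * p0 = 0 ∧
      (solidLegendre n q x : ℂ) = E * r * r ^ 2 * p0 ∧
      (solidLegendre n (q + 1) x : ℂ) = E * r ^ 2 * p1 ∧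
      (∀ i, partialDeriv i (fun y => (solidLegendre n q y : ℂ)) x =
        E * r * ((n - q) * (x i) * p0 + p1 * ((if (2 : Fin 3) = i then r else 0) - ξ * x i))) ∧
      (∀ i, partialDeriv i (fun y => (solidLegendre n (q + 1) y : ℂ)) x =
        E * ((n - q - 1) * (x i) * p1 + p2 * ((if (2 : Fin 3) = i then r else 0) - ξ * x i))) := by
    intro x hx
    have hr : ‖x‖ ≠ 0 := norm_ne_zero_iff.mpr hx
    refine ⟨‖x‖, (‖x‖ ^ ((n : ℤ) - q - 3) : ℝ), (x 2 / ‖x‖ : ℝ), legendreDeriv n q (x 2 / ‖x‖),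
      legendreDeriv n (q + 1) (x 2 / ‖x‖), legendreDeriv n (q + 2) (x 2 / ‖x‖),
      ?_, ?_, by exact_mod_cast legendreDeriv_ode n q (x 2 / ‖x‖), ?_, ?_, fun i => ?_, fun i => ?_⟩
    · norm_cast; field_simp
    · norm_cast
      have := norm_sq_eq_coords x
      field_simp
      linarith
    · rw [solidLegendre_eq n q hx]
      norm_cast
      rw [← zpow_add_one₀ hr, ← zpow_natCast ‖x‖ 2, ← zpow_add₀ hr]
      congr 2
      push_cast; ring
    · have h2 : ‖x‖ ^ ((n : ℤ) - (q + 1 : ℕ)) = ‖x‖ ^ ((n : ℤ) - q - 3) * ‖x‖ ^ 2 := by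
        rw [← zpow_natCast ‖x‖ 2, ← zpow_add₀ hr]
        congr 1
        push_cast; ring
      rw [solidLegendre_eq n (q + 1) hx, h2]
      push_cast
      rfl
    · rw [partialDeriv_solidLegendre n q i hx, show (n : ℤ) - q - 2 = n - q - 3 + 1 by ring,
        zpow_add_one₀ hr]
      push_cast [apply_ite]
      rfl
    · rw [partialDeriv_solidLegendre n (q + 1) i hx,
        show (n : ℤ) - (q + 1 : ℕ) - 2 = n - q - 3 by push_cast; ring]
      push_cast [apply_ite]
      ring
  -- The factor q makes the truncated exponent q - 1 harmless when q = 0.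
  have hpow : ∀ x : E3, (q : ℂ) * complexCoord x ^ (q - 1) * complexCoord x =
      q * complexCoord x ^ q := fun x => by
    rcases q with _ | q
    · simp
    · rw [Nat.add_sub_cancel, mul_assoc, ← pow_succ]
  have h20 : (2 : Fin 3) = 0 ↔ False := by decide
  have h21 : (2 : Fin 3) = 1 ↔ False := by decide
  have hw : ∀ x, complexCoord x = x 0 + Complex.I * x 1 := fun _ => rfl
  refine ⟨fun a => ?_, fun x hx => ?_, fun x hx => ?_, fun x a hx => ?_⟩
  · fin_cases a
    · exact contDiff_const.mul (hS q q)
    · exact contDiff_const.mul (hS (q + 1) (q + 1))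
  · obtain ⟨r, E, ξ, p0, p1, p2, hx2, hx01, hode, hs0, hs1, hd0, hd1⟩ := setup x hx
    rw [h0, h1, h1, hs0, hs1, hd0, hd1, hd1, hx2, pow_succ (complexCoord x) q]
    simp only [Fin.isValue, if_true, h20, h21, if_false, Matrix.cons_val]
    push_cast
    generalize complexCoord x ^ q = W
    rw [hw]
    linear_combination (E * r ^ 2 * W * ξ) * hode
      - W * (E * ((n - q - 1) * p1 - ξ * p2)) * hx01
      + (E * ((n - q - 1) * p1 - ξ * p2) * x 1 ^ 2 * W + E * r ^ 2 * p1 * (q + 1) * W) * hI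
  · obtain ⟨r, E, ξ, p0, p1, p2, hx2, hx01, hode, hs0, hs1, hd0, hd1⟩ := setup x hx
    rw [h0, h0, h1, hs0, hs1, hd0, hd0, hd1, hx2, pow_succ (complexCoord x) q]
    simp only [Fin.isValue, if_true, h20, h21, if_false, Matrix.cons_val]
    push_cast
    generalize complexCoord x ^ (q - 1) = W'
    generalize complexCoord x ^ q = W
    rw [hw]
    linear_combination (E * r * W * (x 0 + Complex.I * x 1)) * hode
      + (n + q + 1) * (E * r * r ^ 2 * p0) * q * W' * hI
  · obtain ⟨r, E, ξ, p0, p1, p2, hx2, hx01, hode, hs0, hs1, hd0, hd1⟩ := setup x hx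
    have hp := hpow x
    fin_cases a
    · simp only [Fin.zero_eta, Fin.sum_univ_three, h0]
      simp only [hs0, hd0, hx2, h20, h21, if_true, if_false,
        Matrix.cons_val, solidSpinor]
      rw [hw] at hp ⊢
      linear_combination (n + q + 1) * E * r * ((n - q) * p0 - ξ * p1) *
        (x 0 + Complex.I * x 1) ^ q * hx01 + (n + q + 1) * (E * r * r ^ 2 * p0) * hp
    · simp only [Fin.mk_one, Fin.sum_univ_three, h1]
      simp only [hs1, hd1, hx2, h20, h21, if_true, if_false,
        Matrix.cons_val, solidSpinor, pow_succ (complexCoord x) q]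
      push_cast
      generalize complexCoord x ^ q = W
      rw [hw]
      linear_combination -E * ((n - q - 1) * p1 - ξ * p2) * W * (x 0 + Complex.I * x 1) * hx01

/-! ### Spherical harmonic spinors as restrictions of monogenic spinors -/

/-- `σ · x` acting on two-spinors. -/
noncomputable def sigmaMul (x : E3) (v : Fin 2 → ℂ) : Fin 2 → ℂ :=
  ![(x 2 : ℂ) * v 0 + ((x 0 : ℂ) - Complex.I * (x 1 : ℂ)) * v 1,
    complexCoord x * v 0 - (x 2 : ℂ) * v 1]

theorem sphHarm_natCast (n q : ℕ) (θ : E3) : sphHarm n q θ = sphHarmNonneg n q θ := by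
  simp [sphHarm]

theorem sphHarm_neg_natCast (n q : ℕ) (θ : E3) :
    sphHarm n (-(q : ℤ)) θ = (-1) ^ q * (starRingEnd ℂ) (sphHarmNonneg n q θ) := by
  -- For q = 0 the nonnegative branch of `sphHarm` applies, and the formula holds because Y_n^0 is
  -- real.
  rcases q with _ | q
  · simp [sphHarm, sphHarmNonneg]
  · have h : ¬ (0 : ℤ) ≤ -((q + 1 : ℕ) : ℤ) := by push_cast; omega
    rw [sphHarm, if_neg h, Int.natAbs_neg, Int.natAbs_natCast]

theorem sphHarmNonneg_eq (n q : ℕ) (θ : E3) : sphHarmNonneg n q θ = (-1) ^ q *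
    ((Real.sqrt ((2 * n + 1) / (4 * Real.pi) *
        (((n - q).factorial : ℝ) / ((n + q).factorial : ℝ))) : ℝ) : ℂ) *
    (legendreDeriv n q (θ 2) : ℂ) * complexCoord θ ^ q := rfl

/-- The normalization constant common to the components of a spherical harmonic spinor. -/
noncomputable def spinorNorm (n q : ℕ) : ℝ :=
  Real.sqrt ((n - q).factorial / (4 * Real.pi * (n + q + 1).factorial))

theorem spinorNorm_pos (n q : ℕ) : 0 < spinorNorm n q := by
  rw [spinorNorm]; positivity

/-- Each component of a spherical harmonic spinor carries a product of three square roots; it always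
simplifies to a rational factor k times the constant √l common to all components. -/
theorem one_div_sqrt_mul_sqrt {a b c k l : ℝ} (ha : 0 < a) (hb : 0 ≤ b) (hk : 0 ≤ k)
    (h : b * c = a * (k ^ 2 * l)) :
    1 / Real.sqrt a * Real.sqrt b * Real.sqrt c = k * Real.sqrt l := by
  rw [mul_assoc, ← Real.sqrt_mul hb, h, Real.sqrt_mul ha.le, Real.sqrt_mul (by positivity),
    Real.sqrt_sq hk]
  have : Real.sqrt a ≠ 0 := (Real.sqrt_pos.mpr ha).ne'
  field_simp

theorem spinorNorm_minus_upper (n q : ℕ) :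
    1 / Real.sqrt (2 * n + 1) * Real.sqrt (n + q + 1) * Real.sqrt ((2 * n + 1) / (4 * Real.pi) *
      ((n - q).factorial / (n + q).factorial)) = (n + q + 1) * spinorNorm n q := by
  refine one_div_sqrt_mul_sqrt (by positivity) (by positivity) (by positivity) ?_
  rw [Nat.factorial_succ]
  have : ((n + q).factorial : ℝ) ≠ 0 := by positivity
  have : (n : ℝ) + q + 1 ≠ 0 := by positivity
  push_cast
  field_simp

theorem spinorNorm_minus_lower {n q : ℕ} (hq : q < n) :
    1 / Real.sqrt (2 * n + 1) * Real.sqrt (n - q) * Real.sqrt ((2 * n + 1) / (4 * Real.pi) *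
      ((n - (q + 1)).factorial / (n + (q + 1)).factorial)) = 1 * spinorNorm n q := by
  have hq' : (q : ℝ) < n := by exact_mod_cast hq
  refine one_div_sqrt_mul_sqrt (by positivity) (by linarith) (by positivity) ?_
  obtain ⟨d, rfl⟩ := Nat.exists_eq_add_of_lt hq
  rw [show q + d + 1 - q = d + 1 by omega, show q + d + 1 - (q + 1) = d by omega,
    Nat.factorial_succ d, add_assoc _ q 1]
  have : ((q + d + 1 + (q + 1)).factorial : ℝ) ≠ 0 := by positivity
  push_cast
  field_simp
  ring

theorem spinorNorm_plus_upper {n q : ℕ} (hq : q ≤ n) :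
    1 / Real.sqrt (2 * n + 3) * Real.sqrt (n + 1 - q) * Real.sqrt ((2 * n + 3) / (4 * Real.pi) *
      ((n + 1 - q).factorial / (n + 1 + q).factorial)) = (n + 1 - q) * spinorNorm n q := by
  have hq' : (q : ℝ) ≤ n := by exact_mod_cast hq
  refine one_div_sqrt_mul_sqrt (by positivity) (by linarith) (by linarith) ?_
  obtain ⟨d, rfl⟩ := Nat.exists_eq_add_of_le hq
  rw [show q + d + 1 - q = d + 1 by omega, show q + d - q = d by omega,
    Nat.factorial_succ d, show q + d + 1 + q = q + d + q + 1 by ring]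
  have : ((q + d + q + 1).factorial : ℝ) ≠ 0 := by positivity
  push_cast
  field_simp
  ring

theorem spinorNorm_plus_lower {n q : ℕ} (hq : q ≤ n) :
    1 / Real.sqrt (2 * n + 3) * Real.sqrt (n + q + 2) * Real.sqrt ((2 * n + 3) / (4 * Real.pi) *
      ((n + 1 - (q + 1)).factorial / (n + 1 + (q + 1)).factorial)) = 1 * spinorNorm n q := by
  refine one_div_sqrt_mul_sqrt (by positivity) (by positivity) (by positivity) ?_
  rw [show n + 1 - (q + 1) = n - q by omega, show n + 1 + (q + 1) = n + q + 1 + 1 by ring,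
    Nat.factorial_succ (n + q + 1)]
  have : ((n + q + 1).factorial : ℝ) ≠ 0 := by positivity
  push_cast
  field_simp
  ring

theorem sphSpinor_minus_natCast {n q : ℕ} (hq : q ≤ n) (θ : E3) :
    sphSpinor .minus n q θ = fun a => (-1) ^ q * (spinorNorm n q : ℂ) *
      ![(n + q + 1) * (legendreDeriv n q (θ 2) * complexCoord θ ^ q),
        -1 * (legendreDeriv n (q + 1) (θ 2) * complexCoord θ ^ (q + 1))] a := by
  have e1 : 2 * jOf n = 2 * n + 1 := by rw [jOf]; ring
  have e2 : jOf n + muOf q = n + q + 1 := by rw [jOf, muOf]; push_cast; ring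
  have e3 : jOf n - muOf q = n - q := by rw [jOf, muOf]; push_cast; ring
  have hu := congrArg ((↑) : ℝ → ℂ) (spinorNorm_minus_upper n q)
  rw [sphSpinor, e1, e2, e3, sphHarm_natCast, sphHarmNonneg_eq,
    show ((q : ℤ) + 1) = ((q + 1 : ℕ) : ℤ) by push_cast; rfl, sphHarm_natCast, sphHarmNonneg_eq]
  ext a
  fin_cases a
  · simp only [Fin.zero_eta, Pi.smul_apply, Matrix.cons_val_zero, smul_eq_mul]
    push_cast at hu ⊢
    linear_combination ((-1) ^ q * (legendreDeriv n q (θ 2) : ℂ) * complexCoord θ ^ q) * hu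
  · simp only [Fin.mk_one, Pi.smul_apply, Matrix.cons_val_one, Matrix.cons_val_fin_one, smul_eq_mul]
    rcases hq.lt_or_eq with hq | rfl
    · have hl := congrArg ((↑) : ℝ → ℂ) (spinorNorm_minus_lower hq)
      push_cast at hl ⊢
      rw [pow_succ (-1 : ℂ)]
      linear_combination (-(-1) ^ q * (legendreDeriv n (q + 1) (θ 2) : ℂ) *
        complexCoord θ ^ (q + 1)) * hl
    -- At q = n the factorials no longer match, but the derivative P_n^{(n+1)} vanishes.
    · have h0 : legendreDeriv q (q + 1) (θ 2) = 0 := by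
        rw [legendreDeriv, legendreP_derivative_eq_zero (Nat.lt_succ_self q), Polynomial.eval_zero]
      simp [h0]

theorem sphSpinor_plus_natCast {n q : ℕ} (hq : q ≤ n) (θ : E3) :
    sphSpinor .plus n q θ = fun a => (-1) ^ q * (spinorNorm n q : ℂ) *
      ![(n + 1 - q) * (legendreDeriv (n + 1) q (θ 2) * complexCoord θ ^ q),
        legendreDeriv (n + 1) (q + 1) (θ 2) * complexCoord θ ^ (q + 1)] a := by
  have e1 : 2 * jOf n + 2 = 2 * n + 3 := by rw [jOf]; ring
  have e2 : jOf n + 1 - muOf q = n + 1 - q := by rw [jOf, muOf]; push_cast; ring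
  have e3 : jOf n + 1 + muOf q = n + q + 2 := by rw [jOf, muOf]; push_cast; ring
  have e4 : (2 * ((n + 1 : ℕ) : ℝ) + 1) = 2 * n + 3 := by push_cast; ring
  have hu := congrArg ((↑) : ℝ → ℂ) (spinorNorm_plus_upper hq)
  have hl := congrArg ((↑) : ℝ → ℂ) (spinorNorm_plus_lower hq)
  rw [sphSpinor, e1, e2, e3, sphHarm_natCast, sphHarmNonneg_eq, e4,
    show ((q : ℤ) + 1) = ((q + 1 : ℕ) : ℤ) by push_cast; rfl, sphHarm_natCast, sphHarmNonneg_eq, e4]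
  ext a
  fin_cases a
  · simp only [Fin.zero_eta, Pi.smul_apply, Matrix.cons_val_zero, smul_eq_mul]
    push_cast at hu ⊢
    linear_combination ((-1) ^ q * (legendreDeriv (n + 1) q (θ 2) : ℂ) * complexCoord θ ^ q) * hu
  · simp only [Fin.mk_one, Pi.smul_apply, Matrix.cons_val_one, Matrix.cons_val_fin_one, smul_eq_mul]
    push_cast at hl ⊢
    rw [pow_succ (-1 : ℂ)]
    linear_combination ((-1) ^ q * (legendreDeriv (n + 1) (q + 1) (θ 2) : ℂ) *
        complexCoord θ ^ (q + 1)) * hl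

/-- The index -q - 1 stands for -μ when q stands for μ, and the relation comes from Y_n^{-q} =
(-1)^q conj Y_n^q. -/
theorem sphSpinor_minus_neg (n q : ℕ) (θ : E3) : sphSpinor .minus n (-(q : ℤ) - 1) θ =
    fun a => (-1) ^ q * timeReversal (sphSpinor .minus n q θ) a := by
  have e2 : jOf n + muOf (-(q : ℤ) - 1) = jOf n - muOf q := by simp only [muOf]; push_cast; ring
  have e3 : jOf n - muOf (-(q : ℤ) - 1) = jOf n + muOf q := by simp only [muOf]; push_cast; ring
  simp only [sphSpinor]
  rw [e2, e3, show -(q : ℤ) - 1 = -((q + 1 : ℕ) : ℤ) by push_cast; ring, sphHarm_neg_natCast,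
    show -((q + 1 : ℕ) : ℤ) + 1 = -(q : ℤ) by push_cast; ring, sphHarm_neg_natCast,
    sphHarm_natCast, show ((q : ℤ) + 1) = ((q + 1 : ℕ) : ℤ) by push_cast; rfl, sphHarm_natCast]
  ext a
  fin_cases a
  · simp [timeReversal, pow_succ]; ring
  · simp [timeReversal]; ring

theorem sphSpinor_plus_neg (n q : ℕ) (θ : E3) : sphSpinor .plus n (-(q : ℤ) - 1) θ =
    fun a => -((-1) ^ q * timeReversal (sphSpinor .plus n q θ) a) := by
  have e2 : jOf n + 1 - muOf (-(q : ℤ) - 1) = jOf n + 1 + muOf q := by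
    simp only [muOf]; push_cast; ring
  have e3 : jOf n + 1 + muOf (-(q : ℤ) - 1) = jOf n + 1 - muOf q := by
    simp only [muOf]; push_cast; ring
  simp only [sphSpinor]
  rw [e2, e3, show -(q : ℤ) - 1 = -((q + 1 : ℕ) : ℤ) by push_cast; ring, sphHarm_neg_natCast,
    show -((q + 1 : ℕ) : ℤ) + 1 = -(q : ℤ) by push_cast; ring, sphHarm_neg_natCast,
    sphHarm_natCast, show ((q : ℤ) + 1) = ((q + 1 : ℕ) : ℤ) by push_cast; rfl, sphHarm_natCast]
  ext a
  fin_cases a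
  · simp [timeReversal, pow_succ]; ring
  · simp [timeReversal]; ring

theorem complexCoord_smul (c : ℝ) (x : E3) : complexCoord (c • x) = c * complexCoord x := by
  simp [complexCoord]; ring

theorem norm_pow_smul_legendre (n q : ℕ) {x : E3} (hx : x ≠ 0) :
    (‖x‖ : ℂ) ^ n * ((legendreDeriv n q (dir x 2) : ℂ) * complexCoord (dir x) ^ q) =
      solidLegendre n q x * complexCoord x ^ q := by
  have hr : (‖x‖ : ℂ) ≠ 0 := by exact_mod_cast norm_ne_zero_iff.mpr hx
  have h2 : dir x 2 = x 2 / ‖x‖ := by simp [dir]; ring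
  rw [solidLegendre_eq n q hx, h2, dir, complexCoord_smul, mul_pow]
  push_cast
  rw [zpow_sub₀ hr, zpow_natCast, zpow_natCast, inv_pow]
  field_simp

theorem norm_pow_smul_sphSpinor_minus {n q : ℕ} (hq : q ≤ n) {x : E3} (hx : x ≠ 0) (a : Fin 2) :
    (‖x‖ : ℂ) ^ n * sphSpinor .minus n q (dir x) a =
      (-1) ^ q * (spinorNorm n q : ℂ) * solidSpinor n q x a := by
  have h0 := norm_pow_smul_legendre n q hx
  have h1 := norm_pow_smul_legendre n (q + 1) hx
  rw [sphSpinor_minus_natCast hq]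
  fin_cases a
  · simp only [solidSpinor, Fin.zero_eta, Matrix.cons_val_zero]
    linear_combination ((-1) ^ q * (spinorNorm n q : ℂ) * (n + q + 1)) * h0
  · simp only [solidSpinor, Fin.mk_one, Matrix.cons_val_one, Matrix.cons_val_fin_one]
    linear_combination ((-1) ^ q * (spinorNorm n q : ℂ) * (-1)) * h1

theorem norm_dir {x : E3} (hx : x ≠ 0) : ‖dir x‖ = 1 := by
  rw [dir, norm_smul, norm_inv, norm_norm, inv_mul_cancel₀ (norm_ne_zero_iff.mpr hx)]

/-- The upper component is the recurrence `legendreP_succ_eval` with |θ₁ + iθ₂|² = 1 - θ₃², the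
lower one is `legendreP_succ_derivative`. -/
theorem sphSpinor_plus_eq_sigmaMul {n q : ℕ} (hq : q ≤ n) {θ : E3} (hθ : ‖θ‖ = 1) :
    sphSpinor .plus n q θ = sigmaMul θ (sphSpinor .minus n q θ) := by
  have h1 := congrArg ((↑) : ℝ → ℂ) (legendreP_succ_eval n q (θ 2))
  have h2 := congrArg ((↑) : ℝ → ℂ) (legendreP_succ_derivative n q (θ 2))
  have h3 : (θ 0 : ℂ) ^ 2 + (θ 1 : ℂ) ^ 2 = 1 - (θ 2 : ℂ) ^ 2 := by
    have := norm_sq_eq_coords θ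
    rw [hθ] at this
    norm_cast
    linarith
  have hI := Complex.I_mul_I
  rw [sphSpinor_plus_natCast hq, sphSpinor_minus_natCast hq]
  simp only [← legendreDeriv.eq_1] at h1 h2
  push_cast at h1 h2
  have hw : complexCoord θ = θ 0 + Complex.I * θ 1 := rfl
  ext a
  fin_cases a
  · simp only [sigmaMul, Fin.zero_eta, Matrix.cons_val_zero, Matrix.cons_val_one,
      Matrix.cons_val_fin_one, pow_succ (complexCoord θ) q]
    generalize complexCoord θ ^ q = W
    rw [hw]
    linear_combination ((-1) ^ q * (spinorNorm n q : ℂ) * W) * h1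
      - ((-1) ^ q * (spinorNorm n q : ℂ) * W * legendreDeriv n (q + 1) (θ 2)) *
        (θ 1 ^ 2 * hI - h3)
  · simp only [sigmaMul, Fin.mk_one, Matrix.cons_val_zero, Matrix.cons_val_one,
      Matrix.cons_val_fin_one, pow_succ (complexCoord θ) q]
    linear_combination ((-1) ^ q * (spinorNorm n q : ℂ) * complexCoord θ ^ q * complexCoord θ) * h2

theorem sigmaMul_timeReversal (x : E3) (v : Fin 2 → ℂ) (a : Fin 2) :
    sigmaMul x (timeReversal v) a = -timeReversal (sigmaMul x v) a := by
  fin_cases a <;> simp [sigmaMul, timeReversal, complexCoord] <;> ring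

theorem sigmaMul_const_mul (x : E3) (c : ℂ) (v : Fin 2 → ℂ) (a : Fin 2) :
    sigmaMul x (fun b => c * v b) a = c * sigmaMul x v a := by
  fin_cases a <;> simp [sigmaMul] <;> ring

theorem sigmaMul_smul (x : E3) (c : ℝ) (v : Fin 2 → ℂ) (a : Fin 2) :
    sigmaMul (c • x) v a = c * sigmaMul x v a := by
  fin_cases a <;> simp [sigmaMul, complexCoord] <;> ring

/-- A height z in (-1, 1) off the finitely many roots of P_n^{(q)} gives a unit vector at which
neither factor of the upper component vanishes. -/
theorem exists_solidSpinor_ne_zero {n q : ℕ} (hq : q ≤ n) : ∃ x, x ≠ 0 ∧ solidSpinor n q x 0 ≠ 0 := by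
  have hfin := Polynomial.finite_setOfPred_isRoot (iterate_derivative_legendreP_ne_zero hq)
  obtain ⟨z, hz, hz'⟩ := (Set.Ioo_infinite (show (-1 : ℝ) < 1 by norm_num)).exists_notMem_finite hfin
  have h1 : 0 < 1 - z ^ 2 := by nlinarith [hz.1, hz.2]
  set x : E3 := !₂[Real.sqrt (1 - z ^ 2), 0, z] with hxdef
  have hnorm : ‖x‖ = 1 := by
    have := norm_sq_eq_coords x
    simp [hxdef, Real.sq_sqrt h1.le] at this
    rcases this with h | h
    · exact h
    · linarith [norm_nonneg x]
  have hx : x ≠ 0 := fun h => by simp [h] at hnorm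
  refine ⟨x, hx, ?_⟩
  have hw : complexCoord x ≠ 0 := by
    have : Real.sqrt (1 - z ^ 2) ≠ 0 := (Real.sqrt_pos.mpr h1).ne'
    simpa [complexCoord, hxdef] using this
  have hL : legendreDeriv n q z ≠ 0 := hz'
  simp only [solidSpinor, Matrix.cons_val_zero]
  rw [solidLegendre_eq n q hx, hnorm]
  have : (n : ℂ) + q + 1 ≠ 0 := by norm_cast
  simp only [one_zpow, one_mul, div_one]
  refine mul_ne_zero this (mul_ne_zero ?_ (pow_ne_zero _ hw))
  exact_mod_cast hL

/-- The spherical harmonic spinors of total angular momentum `n + 1 / 2` are the restrictions to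
the sphere of `P` and `(σ · x) P` for a homogeneous monogenic spinor `P` of degree `n`. -/
theorem exists_monogenic (n : ℕ) (M : ℤ) (h1 : -((n : ℤ) + 1) ≤ M) (h2 : M ≤ n) :
    ∃ P : E3 → Fin 2 → ℂ, IsMonogenic n P ∧ (∃ x, x ≠ 0 ∧ P x ≠ 0) ∧
      (∀ x, x ≠ 0 → ∀ a, (‖x‖ : ℂ) ^ n * sphSpinor .minus n M (dir x) a = P x a) ∧
      ∀ x, x ≠ 0 → ∀ a, (‖x‖ : ℂ) ^ (n + 1) * sphSpinor .plus n M (dir x) a =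
        sigmaMul x (P x) a := by
  have hplus : (∀ θ, ‖θ‖ = 1 → sphSpinor .plus n M θ = sigmaMul θ (sphSpinor .minus n M θ)) →
      ∀ P : E3 → Fin 2 → ℂ,
      (∀ x, x ≠ 0 → ∀ a, (‖x‖ : ℂ) ^ n * sphSpinor .minus n M (dir x) a = P x a) →
      ∀ x, x ≠ 0 → ∀ a, (‖x‖ : ℂ) ^ (n + 1) * sphSpinor .plus n M (dir x) a =
        sigmaMul x (P x) a := by
    intro h P hP x hx a
    have hr : (‖x‖ : ℂ) ≠ 0 := by exact_mod_cast norm_ne_zero_iff.mpr hx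
    rw [h _ (norm_dir hx), ← show (fun a => (‖x‖ : ℂ) ^ n * sphSpinor .minus n M (dir x) a) = P x
      from funext (hP x hx), sigmaMul_const_mul]
    conv_lhs => rw [dir, sigmaMul_smul]
    rw [← dir]
    push_cast
    rw [pow_succ]
    field_simp
  rcases le_or_gt 0 M with hM | hM
  · lift M to ℕ using hM
    have hq : M ≤ n := by exact_mod_cast h2
    have hm : ∀ x, x ≠ 0 → ∀ a, (‖x‖ : ℂ) ^ n * sphSpinor .minus n M (dir x) a =
      (-1) ^ M * (spinorNorm n M : ℂ) * solidSpinor n M x a :=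
      fun x hx a => norm_pow_smul_sphSpinor_minus hq hx a
    refine ⟨_, (isMonogenic_solidSpinor n M).const_mul ((-1) ^ M * (spinorNorm n M : ℂ)), ?_, hm,
      hplus (fun θ hθ => sphSpinor_plus_eq_sigmaMul hq hθ) _ hm⟩
    obtain ⟨x, hx, hx0⟩ := exists_solidSpinor_ne_zero hq
    refine ⟨x, hx, fun h => ?_⟩
    have := congrFun h 0
    simp [hx0, (spinorNorm_pos n M).ne'] at this
  -- Negative μ: time reversal of the spinor for -μ. The sign from its anticommutation with σ · θ is
  -- cancelled by the one in `sphSpinor_plus_neg`.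
  · obtain ⟨q, rfl⟩ : ∃ q : ℕ, M = -(q : ℤ) - 1 := ⟨(-M - 1).toNat, by omega⟩
    have hq : q ≤ n := by omega
    have hm : ∀ x, x ≠ 0 → ∀ a, (‖x‖ : ℂ) ^ n * sphSpinor .minus n (-(q : ℤ) - 1) (dir x) a =
        (-1) ^ q * timeReversal (fun b => (-1) ^ q * (spinorNorm n q : ℂ) * solidSpinor n q x b) a := by
      intro x hx a
      rw [sphSpinor_minus_neg, ← show (fun b => (‖x‖ : ℂ) ^ n * sphSpinor .minus n q (dir x) b) =
        fun b => (-1) ^ q * (spinorNorm n q : ℂ) * solidSpinor n q x b from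
          funext (norm_pow_smul_sphSpinor_minus hq hx)]
      fin_cases a <;> simp [timeReversal] <;> ring
    refine ⟨_, (((isMonogenic_solidSpinor n q).const_mul
      ((-1) ^ q * (spinorNorm n q : ℂ))).timeReversal).const_mul ((-1) ^ q), ?_, hm,
      hplus (fun θ hθ => ?_) _ hm⟩
    · obtain ⟨x, hx, hx0⟩ := exists_solidSpinor_ne_zero hq
      refine ⟨x, hx, fun h => ?_⟩
      have := congrFun h 1
      simp [timeReversal, hx0, (spinorNorm_pos n q).ne'] at this
    · rw [sphSpinor_plus_neg, sphSpinor_minus_neg, sphSpinor_plus_eq_sigmaMul hq hθ]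
      ext a
      rw [sigmaMul_const_mul, sigmaMul_timeReversal]
      ring

/-! ### The operator `σ · ∇` -/

/-- `σ · ∇` acting on two-spinor fields. -/
noncomputable def sigmaGrad (X : E3 → Fin 2 → ℂ) (x : E3) : Fin 2 → ℂ :=
  ![partialDeriv 2 (fun y => X y 0) x +
      (partialDeriv 0 (fun y => X y 1) x - Complex.I * partialDeriv 1 (fun y => X y 1) x),
    partialDeriv 0 (fun y => X y 0) x + Complex.I * partialDeriv 1 (fun y => X y 0) x
      - partialDeriv 2 (fun y => X y 1) x]

theorem sigmaGrad_const_mul {X : E3 → Fin 2 → ℂ} {x : E3} (c : ℂ)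
    (hX : ∀ a, ContDiff ℝ ∞ fun y => X y a) (a : Fin 2) :
    sigmaGrad (fun y b => c * X y b) x a = c * sigmaGrad X x a := by
  have hd := fun a => differentiableAt_of_contDiff (hX a) x
  fin_cases a <;> simp [sigmaGrad, partialDeriv_const_mul _ c (hd _)] <;> ring

/-- The Leibniz rule for a factor with gradient g x, as radial functions have. -/
theorem sigmaGrad_radial_mul {X : E3 → Fin 2 → ℂ} {F : E3 → ℂ} {x : E3} {g : ℂ}
    (hX : ∀ a, ContDiff ℝ ∞ fun y => X y a) (hF : ContDiff ℝ ∞ F)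
    (hg : ∀ i, partialDeriv i F x = g * x i) (a : Fin 2) :
    sigmaGrad (fun y b => F y * X y b) x a =
      F x * sigmaGrad X x a + g * sigmaMul x (X x) a := by
  have hd := fun a => differentiableAt_of_contDiff (hX a) x
  have hFd := differentiableAt_of_contDiff hF x
  fin_cases a <;> simp [sigmaGrad, sigmaMul, complexCoord, partialDeriv_mul _ hFd (hd _), hg] <;>
    ring

theorem sigmaMul_sigmaMul (x : E3) (v : Fin 2 → ℂ) (a : Fin 2) :
    sigmaMul x (sigmaMul x v) a = (‖x‖ : ℂ) ^ 2 * v a := by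
  have h : (‖x‖ : ℂ) ^ 2 = (x 0 : ℂ) ^ 2 + (x 1 : ℂ) ^ 2 + (x 2 : ℂ) ^ 2 := by
    exact_mod_cast norm_sq_eq_coords x
  have hI := Complex.I_mul_I
  rw [h]
  fin_cases a
  · simp [sigmaMul, complexCoord]
    linear_combination -(x 1 ^ 2 * v 0) * hI
  · simp [sigmaMul, complexCoord]
    linear_combination -(x 1 ^ 2 * v 1) * hI

theorem contDiff_sigmaMul {P : E3 → Fin 2 → ℂ} (hP : ∀ a, ContDiff ℝ ∞ fun y => P y a)
    (a : Fin 2) : ContDiff ℝ ∞ fun y => sigmaMul y (P y) a := by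
  have h0 := contDiff_coord 0
  have h1 := contDiff_coord 1
  have h2 := contDiff_coord 2
  fin_cases a
  · exact (h2.mul (hP 0)).add ((h0.sub (contDiff_const.mul h1)).mul (hP 1))
  · exact (contDiff_complexCoord.mul (hP 0)).sub (h2.mul (hP 1))

theorem IsMonogenic.sigmaGrad_eq_zero {n : ℕ} {P : E3 → Fin 2 → ℂ} (hP : IsMonogenic n P) {x : E3}
    (hx : x ≠ 0) (a : Fin 2) : sigmaGrad P x a = 0 := by
  fin_cases a
  · exact hP.dirac_upper x hx
  · exact hP.dirac_lower x hx

/-- The anticommutator of σ · ∇ and σ · x is 2 x · ∇ + 3. On P the term (σ · x)(σ · ∇)P vanishes and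
Euler's identity gives x · ∇ P = nP. -/
theorem IsMonogenic.sigmaGrad_sigmaMul {n : ℕ} {P : E3 → Fin 2 → ℂ} (hP : IsMonogenic n P)
    {x : E3} (hx : x ≠ 0) (a : Fin 2) :
    sigmaGrad (fun y => sigmaMul y (P y)) x a = (2 * n + 3) * P x a := by
  have hd := fun a => differentiableAt_of_contDiff (hP.smooth a) x
  have hc := fun j => differentiableAt_of_contDiff (contDiff_coord j) x
  have hw := differentiableAt_of_contDiff contDiff_complexCoord x
  have hI1 : DifferentiableAt ℝ (fun y : E3 => Complex.I * (y 1 : ℂ)) x := (hc 1).const_mul _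
  have q0 : ∀ i, partialDeriv i (fun y => sigmaMul y (P y) 0) x =
      ((if 2 = i then 1 else 0) * P x 0 + x 2 * partialDeriv i (fun y => P y 0) x) +
      (((if 0 = i then 1 else 0) - Complex.I * (if 1 = i then 1 else 0)) * P x 1 +
        (x 0 - Complex.I * x 1) * partialDeriv i (fun y => P y 1) x) := fun i => by
    have h := partialDeriv_add i ((hc 2).mul (hd 0)) (((hc 0).sub hI1).mul (hd 1))
    refine Eq.trans h ?_
    have h1 := partialDeriv_mul i (hc 2) (hd 0)
    have h2 := partialDeriv_mul i ((hc 0).sub hI1) (hd 1)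
    refine (congrArg₂ (· + ·) h1 h2).trans ?_
    have h3 : partialDeriv i ((fun y : E3 => (y 0 : ℂ)) - fun y => Complex.I * (y 1 : ℂ)) x =
        (if 0 = i then 1 else 0) - Complex.I * (if 1 = i then 1 else 0) := by
      refine (partialDeriv_sub i (hc 0) hI1).trans ?_
      rw [partialDeriv_const_mul i _ (hc 1), partialDeriv_coord, partialDeriv_coord]
    simp only [h3, partialDeriv_coord, Pi.sub_apply]
  have q1 : ∀ i, partialDeriv i (fun y => sigmaMul y (P y) 1) x =
      (![1, Complex.I, 0] i * P x 0 + complexCoord x * partialDeriv i (fun y => P y 0) x) -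
      ((if 2 = i then 1 else 0) * P x 1 + x 2 * partialDeriv i (fun y => P y 1) x) := fun i => by
    have h := partialDeriv_sub i (hw.mul (hd 0)) ((hc 2).mul (hd 1))
    refine Eq.trans h ?_
    have h1 := partialDeriv_mul i hw (hd 0)
    have h2 := partialDeriv_mul i (hc 2) (hd 1)
    refine (congrArg₂ (· - ·) h1 h2).trans ?_
    simp only [partialDeriv_coord, partialDeriv_complexCoord]
  have hu := hP.dirac_upper x hx
  have hl := hP.dirac_lower x hx
  have e0 := hP.euler x 0 hx
  have e1 := hP.euler x 1 hx
  have hI := Complex.I_mul_I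
  rw [Fin.sum_univ_three] at e0 e1
  have h20 : (2 : Fin 3) = 0 ↔ False := by decide
  have h21 : (2 : Fin 3) = 1 ↔ False := by decide
  have h10 : (1 : Fin 3) = 0 ↔ False := by decide
  have h01 : (0 : Fin 3) = 1 ↔ False := by decide
  have h02 : (0 : Fin 3) = 2 ↔ False := by decide
  have h12 : (1 : Fin 3) = 2 ↔ False := by decide
  fin_cases a
  · simp only [sigmaGrad, Fin.zero_eta, Matrix.cons_val_zero, q0, q1, h20, h21, h10, h01, h02, h12,
      if_true, if_false, Matrix.cons_val]
    simp only [complexCoord]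
    generalize partialDeriv 0 (fun y => P y 0) x = a0 at *
    generalize partialDeriv 1 (fun y => P y 0) x = a1 at *
    generalize partialDeriv 2 (fun y => P y 0) x = a2 at *
    generalize partialDeriv 0 (fun y => P y 1) x = b0 at *
    generalize partialDeriv 1 (fun y => P y 1) x = b1 at *
    generalize partialDeriv 2 (fun y => P y 1) x = b2 at *
    linear_combination 2 * e0 - (x 0 - Complex.I * x 1) * hl - x 2 * hu
      + (-P x 0 - 2 * x 1 * a1) * hI
  · simp only [sigmaGrad, Fin.mk_one, Matrix.cons_val_one, Matrix.cons_val_fin_one, q0, q1, h20,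
      h21, h10, h01, h02, h12, if_true, if_false, Matrix.cons_val]
    simp only [complexCoord]
    generalize partialDeriv 0 (fun y => P y 0) x = a0 at *
    generalize partialDeriv 1 (fun y => P y 0) x = a1 at *
    generalize partialDeriv 2 (fun y => P y 0) x = a2 at *
    generalize partialDeriv 0 (fun y => P y 1) x = b0 at *
    generalize partialDeriv 1 (fun y => P y 1) x = b1 at *
    generalize partialDeriv 2 (fun y => P y 1) x = b2 at *
    linear_combination 2 * e1 + x 2 * hl - (x 0 + Complex.I * x 1) * hu
      + (-P x 1 - 2 * x 1 * b1) * hI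

/-! ### Radial factors -/

/-- `Φ_p(κ |x|²)`. -/
noncomputable def radialPhi (p κ : ℝ) (x : E3) : ℂ := (besselPhi p (κ * ‖x‖ ^ 2) : ℝ)

theorem contDiff_radialPhi {p : ℝ} (hp : 0 ≤ p) (κ : ℝ) : ContDiff ℝ ∞ (radialPhi p κ) :=
  Complex.ofRealCLM.contDiff.comp
    ((contDiff_besselPhi hp).comp (contDiff_const.mul (contDiff_norm_sq ℝ)))

theorem partialDeriv_radialPhi {p : ℝ} (hp : 0 ≤ p) (κ : ℝ) (i : Fin 3) (x : E3) :
    partialDeriv i (radialPhi p κ) x = -2 * κ * radialPhi (p + 1) κ x * x i := by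
  have h := (hasDerivAt_besselPhi hp (κ * ‖x‖ ^ 2)).comp_hasFDerivAt x
    ((hasStrictFDerivAt_norm_sq x).hasFDerivAt.const_mul κ)
  refine (partialDeriv_ofReal i h).trans ?_
  simp [inner_basisVec, radialPhi]
  ring

/-- The spinor field with the lower orbital angular momentum. -/
noncomputable def lowerWave (n : ℕ) (P : E3 → Fin 2 → ℂ) (κ : ℝ) (x : E3) (a : Fin 2) : ℂ :=
  radialPhi (n + 1 / 2) κ x * P x a

/-- The spinor field with the higher orbital angular momentum. -/
noncomputable def upperWave (n : ℕ) (P : E3 → Fin 2 → ℂ) (κ : ℝ) (x : E3) (a : Fin 2) : ℂ :=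
  radialPhi (n + 3 / 2) κ x * sigmaMul x (P x) a

theorem IsMonogenic.contDiff_lowerWave {n : ℕ} {P : E3 → Fin 2 → ℂ} (hP : IsMonogenic n P) (κ : ℝ)
    (a : Fin 2) : ContDiff ℝ ∞ fun x => lowerWave n P κ x a :=
  (contDiff_radialPhi (by positivity) κ).mul (hP.smooth a)

theorem IsMonogenic.contDiff_upperWave {n : ℕ} {P : E3 → Fin 2 → ℂ} (hP : IsMonogenic n P) (κ : ℝ)
    (a : Fin 2) : ContDiff ℝ ∞ fun x => upperWave n P κ x a :=
  (contDiff_radialPhi (by positivity) κ).mul (contDiff_sigmaMul hP.smooth a)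

/-- Only the radial factor is differentiated, and Φ_p' = -Φ_{p+1}. -/
theorem IsMonogenic.sigmaGrad_lowerWave {n : ℕ} {P : E3 → Fin 2 → ℂ} (hP : IsMonogenic n P) (κ : ℝ)
    {x : E3} (hx : x ≠ 0) (a : Fin 2) :
    sigmaGrad (lowerWave n P κ) x a = -2 * κ * upperWave n P κ x a := by
  have h := sigmaGrad_radial_mul (x := x) hP.smooth
    (contDiff_radialPhi (p := (n : ℝ) + 1 / 2) (by positivity) κ)
    (fun i => partialDeriv_radialPhi (by positivity) κ i x) a
  refine h.trans ?_
  rw [hP.sigmaGrad_eq_zero hx, upperWave, show (n : ℝ) + 1 / 2 + 1 = n + 3 / 2 by ring]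
  ring

/-- The result (2n + 3)Φ_{n+3/2} - 2κ|x|² Φ_{n+5/2} equals 2Φ_{n+1/2} by the Bessel recurrence. -/
theorem IsMonogenic.sigmaGrad_upperWave {n : ℕ} {P : E3 → Fin 2 → ℂ} (hP : IsMonogenic n P) (κ : ℝ)
    {x : E3} (hx : x ≠ 0) (a : Fin 2) :
    sigmaGrad (upperWave n P κ) x a = 2 * lowerWave n P κ x a := by
  have h := sigmaGrad_radial_mul (x := x) (contDiff_sigmaMul hP.smooth)
    (contDiff_radialPhi (p := (n : ℝ) + 3 / 2) (by positivity) κ)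
    (fun i => partialDeriv_radialPhi (by positivity) κ i x) a
  refine h.trans ?_
  have hrec := congrArg ((↑) : ℝ → ℂ)
    (besselPhi_recurrence (p := (n : ℝ) + 1 / 2) (by positivity) (κ * ‖x‖ ^ 2))
  rw [show (n : ℝ) + 1 / 2 + 1 = n + 3 / 2 by ring,
    show (n : ℝ) + 1 / 2 + 2 = n + 3 / 2 + 1 by ring] at hrec
  rw [hP.sigmaGrad_sigmaMul hx, sigmaMul_sigmaMul, lowerWave]
  simp only [radialPhi]
  push_cast at hrec ⊢
  linear_combination -2 * P x a * hrec

/-! ### Smooth spinor fields on the ball -/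

theorem sum_alphaMat_mulVec (G : Fin 3 → Spinor) (a : Fin 2) :
    (∑ k, (alphaMat k).mulVec (G k)) (.inl a) =
        ![G 2 (.inr 0) + (G 0 (.inr 1) - Complex.I * G 1 (.inr 1)),
          G 0 (.inr 0) + Complex.I * G 1 (.inr 0) - G 2 (.inr 1)] a ∧
      (∑ k, (alphaMat k).mulVec (G k)) (.inr a) =
        ![G 2 (.inl 0) + (G 0 (.inl 1) - Complex.I * G 1 (.inl 1)),
          G 0 (.inl 0) + Complex.I * G 1 (.inl 0) - G 2 (.inl 1)] a := by
  constructor <;> fin_cases a <;>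
    simp [Fin.sum_univ_three, alphaMat, pauli, Matrix.mulVec, dotProduct] <;> ring

theorem betaMat_mulVec (v : Spinor) (a : Fin 2) :
    betaMat.mulVec v (.inl a) = v (.inl a) ∧ betaMat.mulVec v (.inr a) = -v (.inr a) := by
  constructor <;> fin_cases a <;>
    simp [betaMat, Matrix.mulVec, dotProduct, Matrix.one_apply]

theorem alphaDot_mulVec (X : E3) (v : Spinor) (a : Fin 2) :
    (alphaDot X).mulVec v (.inl a) = sigmaMul X (fun b => v (.inr b)) a ∧
      (alphaDot X).mulVec v (.inr a) = sigmaMul X (fun b => v (.inl b)) a := by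
  have h : (alphaDot X).mulVec v = ∑ k, (alphaMat k).mulVec ((X k : ℂ) • v) := by
    simp [alphaDot, Matrix.sum_mulVec, Matrix.smul_mulVec, Matrix.mulVec_smul]
  rw [h, (sum_alphaMat_mulVec _ a).1, (sum_alphaMat_mulVec _ a).2]
  constructor <;> fin_cases a <;> simp [sigmaMul, complexCoord] <;> ring

theorem ae_norm_eq_surfaceMeasure {R : ℝ} (hR : 0 < R) : ∀ᵐ x ∂(surfaceMeasure R), ‖x‖ = R := by
  refine Measure.ae_smul_measure ?_ _
  rw [ae_map_iff (by fun_prop) (measurableSet_eq_fun (by fun_prop) (by fun_prop))]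
  refine Eventually.of_forall fun θ => ?_
  rw [norm_smul, norm_eq_of_mem_sphere θ, mul_one, Real.norm_of_nonneg hR.le]

instance isFiniteMeasure_surfaceMeasure (R : ℝ) : IsFiniteMeasure (surfaceMeasure R) :=
  Measure.smul_finite _ ENNReal.ofReal_ne_top

instance isFiniteMeasure_restrict_ballR (R : ℝ) : IsFiniteMeasure (volume.restrict (ballR R)) :=
  ⟨by rw [Measure.restrict_apply_univ]; exact measure_ball_lt_top⟩

theorem memLp_of_continuous {f : E3 → ℂ} (hf : Continuous f) {μ : Measure E3} [IsFiniteMeasure μ]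
    {R : ℝ} (hμ : ∀ᵐ x ∂μ, ‖x‖ ≤ R) : MemLp f 2 μ := by
  obtain ⟨C, hC⟩ := (isCompact_closedBall (0 : E3) R).exists_bound_of_continuousOn hf.continuousOn
  refine MemLp.of_bound hf.aestronglyMeasurable C ?_
  filter_upwards [hμ] with x hx using hC x (mem_closedBall_zero_iff.mpr hx)

theorem ae_norm_le_ballR (R : ℝ) : ∀ᵐ x ∂(volume.restrict (ballR R)), ‖x‖ ≤ R := by
  filter_upwards [ae_restrict_mem Metric.isOpen_ball.measurableSet] with x hx
  exact (mem_ball_zero_iff.mp hx).le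

theorem ae_ne_zero_ballR (R : ℝ) : ∀ᵐ x ∂(volume.restrict (ballR R)), x ≠ (0 : E3) :=
  ae_restrict_of_ae (by simp [ae_iff])

/-- The test function is supported inside the ball, so both integrals extend to ℝ³, where
integration by parts has no boundary term. -/
theorem hasWeakPartial_of_contDiff {R : ℝ} {f u : E3 → ℂ} (hf : ContDiff ℝ ∞ f)
    (hu : u =ᵐ[volume.restrict (ballR R)] f) (i : Fin 3) :
    HasWeakPartial (ballR R) i u (partialDeriv i f) := by
  intro η hη hc hsupp
  have hηc : ContDiff ℝ ∞ fun x => (η x : ℂ) := Complex.ofRealCLM.contDiff.comp hη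
  have hcc : HasCompactSupport fun x => (η x : ℂ) := hc.comp_left (g := fun t : ℝ => (t : ℂ)) (by simp)
  have hder : ∀ x, fderiv ℝ (fun x => (η x : ℂ)) x (basisVec i) =
      ((fderiv ℝ η x (basisVec i) : ℝ) : ℂ) := fun x =>
    partialDeriv_ofReal i (hη.differentiable (by simp) x).hasFDerivAt
  have hcont' : ∀ g : E3 → ℂ, ContDiff ℝ ∞ g → Continuous fun x => fderiv ℝ g x (basisVec i) :=
    fun g hg => (hg.continuous_fderiv (by simp)).clm_apply continuous_const
  have hc' : HasCompactSupport fun x => fderiv ℝ (fun x => (η x : ℂ)) x (basisVec i) :=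
    hcc.fderiv_apply ℝ (basisVec i)
  have key := integral_mul_fderiv_eq_neg_fderiv_mul_of_integrable (μ := (volume : Measure E3))
    (f := f) (g := fun x => (η x : ℂ)) (v := basisVec i)
    (((hcont' f hf).mul hηc.continuous).integrable_of_hasCompactSupport hcc.mul_left)
    ((hf.continuous.mul (hcont' _ hηc)).integrable_of_hasCompactSupport hc'.mul_left)
    ((hf.continuous.mul hηc.continuous).integrable_of_hasCompactSupport hcc.mul_left)
    (fun x _ => hf.differentiable (by simp) x) (fun x _ => hηc.differentiable (by simp) x)
  have hz : ∀ x, x ∉ ballR R → η x = 0 := fun x hx => by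
    by_contra h
    exact hx (hsupp (subset_tsupport _ h))
  have hz' : ∀ x, x ∉ ballR R → fderiv ℝ η x = 0 := fun x hx => by
    by_contra h
    exact hx (hsupp (support_fderiv_subset ℝ (f := η) h))
  have e1 : ∫ x in ballR R, u x * ((fderiv ℝ η x (basisVec i) : ℝ) : ℂ) =
      ∫ x, f x * fderiv ℝ (fun x => (η x : ℂ)) x (basisVec i) := by
    refine Eq.trans (integral_congr_ae ?_)
      (setIntegral_eq_integral_of_forall_compl_eq_zero (s := ballR R) fun x hx => ?_)
    · filter_upwards [hu] with x hx
      rw [hx, hder]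
    · rw [hder, hz' x hx]
      simp
  have e2 : ∫ x in ballR R, partialDeriv i f x * ((η x : ℝ) : ℂ) =
      ∫ x, fderiv ℝ f x (basisVec i) * (η x : ℂ) :=
    setIntegral_eq_integral_of_forall_compl_eq_zero fun x hx => by rw [hz x hx]; simp
  rw [e1, e2, key]

theorem isH1With_of_contDiff {R : ℝ} {f u : E3 → ℂ} (hf : ContDiff ℝ ∞ f)
    (hu : u =ᵐ[volume.restrict (ballR R)] f) :
    IsH1With (ballR R) u fun i => partialDeriv i f where
  memLp := (memLp_congr_ae hu).mpr (memLp_of_continuous hf.continuous (ae_norm_le_ballR R))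
  memLp_grad i := memLp_of_continuous
    ((hf.continuous_fderiv (by simp)).clm_apply continuous_const) (ae_norm_le_ballR R)
  weak i := hasWeakPartial_of_contDiff hf hu i

theorem hasTrace_of_contDiff {R : ℝ} (hR : 0 < R) {f u : E3 → ℂ} (hf : ContDiff ℝ ∞ f)
    (hu : u =ᵐ[volume.restrict (ballR R)] f) : HasTrace R u f := by
  refine ⟨memLp_of_continuous hf.continuous ((ae_norm_eq_surfaceMeasure hR).mono fun x hx => hx.le),
    -- The constant sequence f serves as the smooth approximation.
    _, isH1With_of_contDiff hf hu, fun _ => f, fun _ => hf, ?_, fun i => ?_, ?_⟩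
  · have h : eLpNorm (f - u) 2 (volume.restrict (ballR R)) = 0 := by
      rw [eLpNorm_congr_ae (g := 0) (by filter_upwards [hu] with x hx; simp [hx]), eLpNorm_zero]
    simp only [h, tendsto_const_nhds]
  · simp [partialDeriv]
  · simp

/-- A spinor field which is smooth up to a null set, satisfies the boundary condition
`v = i e^τ (σ · ν) u` and the Dirac equation pointwise is an eigenfunction. -/
theorem isEigenfunction_of_smooth {R m τ lam : ℝ} (hR : 0 < R) {φ : E3 → Spinor}
    {u v : E3 → Fin 2 → ℂ} (hu : ∀ a, ContDiff ℝ ∞ fun x => u x a)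
    (hv : ∀ a, ContDiff ℝ ∞ fun x => v x a)
    (hφ : ∀ x, x ≠ 0 → φ x = Sum.elim (u x) (v x))
    (hbdry : ∀ x a, ‖x‖ = R → v x a =
      Complex.I * Real.exp τ * sigmaMul (outwardNormal R x) (u x) a)
    (hlower : ∀ x a, x ≠ 0 → -Complex.I * sigmaGrad u x a = (lam + m) * v x a)
    (hupper : ∀ x a, x ≠ 0 → -Complex.I * sigmaGrad v x a = (lam - m) * u x a)
    (hne : ∃ x, ‖x‖ < R ∧ u x ≠ 0) : IsEigenfunction R m τ (lam : ℂ) φ := by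
  set W : E3 → Spinor := fun x => Sum.elim (u x) (v x) with hW
  have hWs : ∀ a, ContDiff ℝ ∞ fun x => W x a := by
    rintro (a | a)
    · exact hu a
    · exact hv a
  have hae : ∀ᵐ x ∂(volume.restrict (ballR R)), φ x = W x := by
    filter_upwards [ae_ne_zero_ballR R] with x hx using hφ x hx
  have hae' : ∀ a, (fun x => φ x a) =ᵐ[volume.restrict (ballR R)] fun x => W x a := fun a => by
    filter_upwards [hae] with x hx
    rw [hx]
  refine ⟨⟨fun a => ⟨_, isH1With_of_contDiff (hWs a) (hae' a)⟩, W,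
    fun a => hasTrace_of_contDiff hR (hWs a) (hae' a), ?_⟩, fun h0 => ?_, ?_⟩
  -- The two halves of the condition read u = -i e^(-τ) (σ · ν) v and v = i e^τ (σ · ν) u; they are
  -- equivalent because (σ · ν)² = 1.
  · filter_upwards [ae_norm_eq_surfaceMeasure hR] with x hx
    have hnorm : ‖outwardNormal R x‖ = 1 := by
      rw [outwardNormal, norm_smul, hx, norm_inv, Real.norm_of_nonneg hR.le, inv_mul_cancel₀ hR.ne']
    have hexp : (Real.sinh τ : ℂ) + Real.cosh τ = Real.exp τ := by
      norm_cast; rw [Real.sinh_add_cosh]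
    have hexp' : (Real.sinh τ : ℂ) - Real.cosh τ = -Real.exp (-τ) := by
      rw [← Real.cosh_sub_sinh]; push_cast; ring
    have hmul : (Real.exp (-τ) : ℂ) * Real.exp τ = 1 := by
      norm_cast; rw [← Real.exp_add]; simp
    rw [← Matrix.mulVec_mulVec]
    set S : Spinor := (alphaDot (outwardNormal R x)).mulVec (W x) with hS
    have hmv : ∀ b, (((Real.sinh τ : ℝ) : ℂ) • (1 : Matrix SpinorIdx SpinorIdx ℂ)
        - ((Real.cosh τ : ℝ) : ℂ) • betaMat).mulVec S b =
        Real.sinh τ * S b - Real.cosh τ * betaMat.mulVec S b := fun b => by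
      rw [Matrix.sub_mulVec, Matrix.smul_mulVec, Matrix.smul_mulVec, Matrix.one_mulVec]
      rfl
    have hv' : v x = fun a => Complex.I * Real.exp τ * sigmaMul (outwardNormal R x) (u x) a :=
      funext fun a => hbdry x a hx
    ext (a | a)
    · rw [Pi.smul_apply, hmv, (betaMat_mulVec S a).1, hS, (alphaDot_mulVec _ _ a).1]
      simp only [hW, Sum.elim_inl, Sum.elim_inr, smul_eq_mul]
      have : sigmaMul (outwardNormal R x) (v x) a = Complex.I * Real.exp τ * u x a := by
        rw [hv', sigmaMul_const_mul, sigmaMul_sigmaMul, hnorm]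
        simp
      rw [this, ← sub_mul, hexp']
      linear_combination (-u x a) * hmul + u x a * (Real.exp (-τ) * Real.exp τ : ℂ) *
        Complex.I_mul_I
    · rw [Pi.smul_apply, hmv, (betaMat_mulVec S a).2, hS, (alphaDot_mulVec _ _ a).2]
      simp only [hW, Sum.elim_inl, Sum.elim_inr, smul_eq_mul]
      rw [hbdry x a hx, ← hexp]
      ring
  -- A continuous component that is nonzero at one point of the ball is nonzero on an open set,
  -- which has positive measure.
  · obtain ⟨x, hxR, hx⟩ := hne
    obtain ⟨a, ha⟩ := Function.ne_iff.mp hx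
    have hopen : IsOpen (ballR R ∩ {y | u y a ≠ 0}) :=
      Metric.isOpen_ball.inter (isOpen_ne.preimage (hu a).continuous)
    have hpos := hopen.measure_pos volume ⟨x, mem_ball_zero_iff.mpr hxR, ha⟩
    refine hpos.ne' (measure_mono_null ?_
      ((ae_restrict_iff' Metric.isOpen_ball.measurableSet).mp (hae.and h0)))
    rintro y ⟨hy1, hy2⟩ h
    obtain ⟨h1, h2⟩ := h hy1
    exact hy2 (by simpa [hW, h2] using (congrFun h1 (.inl a)).symm)
  · refine ⟨fun i x a => partialDeriv i (fun y => W y a) x,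
      fun a => isH1With_of_contDiff (hWs a) (hae' a), ?_⟩
    filter_upwards [hae, ae_ne_zero_ballR R] with x hx hx0
    rw [hx]
    ext (a | a)
    · simp only [Pi.smul_apply, Pi.add_apply, smul_eq_mul, (betaMat_mulVec _ a).1,
        (sum_alphaMat_mulVec _ a).1]
      have h := hupper x a hx0
      simp only [hW, Sum.elim_inl, Sum.elim_inr]
      simp only [sigmaGrad] at h
      linear_combination -h
    · simp only [Pi.smul_apply, Pi.add_apply, smul_eq_mul, (betaMat_mulVec _ a).2,
        (sum_alphaMat_mulVec _ a).2]
      have h := hlower x a hx0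
      simp only [hW, Sum.elim_inl, Sum.elim_inr]
      simp only [sigmaGrad] at h
      linear_combination -h

/-! ### The explicit eigenfunctions -/

theorem mul_rpow_half {w r : ℝ} (hw : 0 < w) (hr : 0 < r) (n : ℕ) :
    (w * r / 2) ^ ((n : ℝ) + 1 / 2) = (w / 2) ^ ((n : ℝ) + 1 / 2) * (r ^ n * Real.sqrt r) := by
  rw [mul_div_right_comm, Real.mul_rpow (by positivity) hr.le, Real.rpow_add hr,
    Real.rpow_natCast, Real.sqrt_eq_rpow]

theorem inv_sqrt_mul_besselJ_half {w r : ℝ} (hw : 0 < w) (hr : 0 < r) (n : ℕ) :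
    1 / Real.sqrt r * besselJ (n + 1 / 2) (w * r) =
      (w / 2) ^ ((n : ℝ) + 1 / 2) * (r ^ n * besselPhi (n + 1 / 2) (w ^ 2 / 4 * r ^ 2)) := by
  have hs : Real.sqrt r ≠ 0 := (Real.sqrt_pos.mpr hr).ne'
  rw [besselJ_half_eq, mul_rpow_half hw hr, besselEven,
    show (w * r / 2) ^ 2 = w ^ 2 / 4 * r ^ 2 by ring]
  field_simp

theorem inv_sqrt_mul_besselJ_three_half {w r : ℝ} (hw : 0 < w) (hr : 0 < r) (n : ℕ) :
    1 / Real.sqrt r * besselJ (n + 3 / 2) (w * r) =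
      (w / 2) ^ ((n : ℝ) + 1 / 2) * (w / 2) *
        (r ^ (n + 1) * besselPhi (n + 3 / 2) (w ^ 2 / 4 * r ^ 2)) := by
  have hs : Real.sqrt r ≠ 0 := (Real.sqrt_pos.mpr hr).ne'
  rw [besselJ_three_half_eq n (by positivity), mul_rpow_half hw hr, besselOdd,
    show (w * r / 2) ^ 2 = w ^ 2 / 4 * r ^ 2 by ring]
  field_simp
  ring

theorem ellOf_minus_add_half (n : ℕ) : ellOf .minus n + 1 / 2 = n + 1 / 2 := by
  simp [ellOf, jOf, Branch.sgn]; ring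

theorem ellOf_plus_add_half (n : ℕ) : ellOf .plus n + 1 / 2 = n + 3 / 2 := by
  simp [ellOf, jOf, Branch.sgn]; ring

section Radial
variable {n : ℕ} {M : ℤ} {P : E3 → Fin 2 → ℂ}

theorem lowerWave_eq
    (hPm : ∀ x, x ≠ 0 → ∀ a, (‖x‖ : ℂ) ^ n * sphSpinor .minus n M (dir x) a = P x a)
    {w : ℝ} (hw : 0 < w) {x : E3} (hx : x ≠ 0) (a : Fin 2) :
    ((1 / Real.sqrt ‖x‖ * besselJ (n + 1 / 2) (w * ‖x‖) : ℝ) : ℂ) * sphSpinor .minus n M (dir x) a =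
      ((w / 2) ^ ((n : ℝ) + 1 / 2) : ℝ) * lowerWave n P (w ^ 2 / 4) x a := by
  rw [inv_sqrt_mul_besselJ_half hw (norm_pos_iff.mpr hx), lowerWave, radialPhi, ← hPm x hx a]
  push_cast
  ring

theorem upperWave_eq
    (hPp : ∀ x, x ≠ 0 → ∀ a, (‖x‖ : ℂ) ^ (n + 1) * sphSpinor .plus n M (dir x) a =
      sigmaMul x (P x) a)
    {w : ℝ} (hw : 0 < w) {x : E3} (hx : x ≠ 0) (a : Fin 2) :
    ((1 / Real.sqrt ‖x‖ * besselJ (n + 3 / 2) (w * ‖x‖) : ℝ) : ℂ) * sphSpinor .plus n M (dir x) a =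
      ((w / 2) ^ ((n : ℝ) + 1 / 2) * (w / 2) : ℝ) * upperWave n P (w ^ 2 / 4) x a := by
  rw [inv_sqrt_mul_besselJ_three_half hw (norm_pos_iff.mpr hx), upperWave, radialPhi, ← hPp x hx a]
  push_cast
  ring

/-- Along a ray on which P does not vanish the radial factors tend to Φ_p(0) > 0 at the origin, so
points close to it work. The higher wave is nonzero because (σ · x)² = |x|². -/
theorem exists_waves_ne_zero (hP0 : ∃ x, x ≠ 0 ∧ P x ≠ 0)
    (hPm : ∀ x, x ≠ 0 → ∀ a, (‖x‖ : ℂ) ^ n * sphSpinor .minus n M (dir x) a = P x a)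
    {R : ℝ} (hR : 0 < R) (κ : ℝ) :
    ∃ x, ‖x‖ < R ∧ lowerWave n P κ x ≠ 0 ∧ upperWave n P κ x ≠ 0 := by
  obtain ⟨y, hy, hPy⟩ := hP0
  have hcont : Continuous fun t : ℝ => t • y := by fun_prop
  have h0 : ∀ p : ℝ, 0 ≤ p → ∀ᶠ t in 𝓝[>] (0 : ℝ), radialPhi p κ (t • y) ≠ 0 := fun p hp => by
    refine nhdsWithin_le_nhds (((contDiff_radialPhi hp κ).continuous.comp
      hcont).continuousAt.eventually_ne ?_)
    simpa [radialPhi] using (besselPhi_zero_pos hp).ne'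
  have h1 : ∀ᶠ t in 𝓝[>] (0 : ℝ), ‖t • y‖ < R :=
    nhdsWithin_le_nhds ((continuous_norm.comp hcont).continuousAt.eventually
      (gt_mem_nhds (by simpa using hR)))
  obtain ⟨t, ⟨⟨hlow, hup⟩, hR'⟩, ht⟩ := (((h0 (n + 1 / 2) (by positivity)).and
    (h0 (n + 3 / 2) (by positivity))).and h1 |>.and self_mem_nhdsWithin).exists
  have ht : 0 < t := ht
  have hx : t • y ≠ 0 := smul_ne_zero ht.ne' hy
  have hdir : dir (t • y) = dir y := by
    rw [dir, dir, norm_smul, Real.norm_of_nonneg ht.le, smul_smul]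
    congr 1
    field_simp
  obtain ⟨a, ha⟩ := Function.ne_iff.mp hPy
  have hPx : P (t • y) a ≠ 0 := by
    rw [← hPm _ hx, hdir]
    rw [← hPm y hy] at ha
    exact mul_ne_zero (pow_ne_zero _ (by exact_mod_cast norm_ne_zero_iff.mpr hx))
      (right_ne_zero_of_mul ha)
  refine ⟨t • y, hR', fun h => ?_, fun h => ?_⟩
  · exact mul_ne_zero hlow hPx (congrFun h a)
  · have hs : sigmaMul (t • y) (P (t • y)) = 0 := funext fun b =>
      (mul_eq_zero.mp (congrFun h b)).resolve_left hup
    have h2 := sigmaMul_sigmaMul (t • y) (P (t • y)) a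
    rw [hs] at h2
    have h3 : sigmaMul (t • y) 0 a = 0 := by fin_cases a <;> simp [sigmaMul]
    rw [h3] at h2
    exact mul_ne_zero (pow_ne_zero 2 (by exact_mod_cast norm_ne_zero_iff.mpr hx)) hPx h2.symm

end Radial

instance isFiniteMeasure_radialMeasure (R : ℝ) : IsFiniteMeasure (radialMeasure R) := by
  refine isFiniteMeasure_withDensity_ofReal ?_
  have : IntegrableOn (fun r : ℝ => r ^ 2) (Set.Icc 0 R) :=
    (continuous_pow 2).continuousOn.integrableOn_Icc
  exact (this.mono_set Set.Ioo_subset_Icc_self).hasFiniteIntegral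

/-- The profiles are singular only in form: for r > 0 they agree with functions continuous on [0,
R]. -/
theorem memLp_radialMeasure {R : ℝ} {f g : ℝ → ℝ} (hg : Continuous g) (h : ∀ r, 0 < r → f r = g r) :
    MemLp (fun r => (f r : ℂ)) 2 (radialMeasure R) := by
  have hmem : ∀ᵐ r ∂(radialMeasure R), r ∈ Set.Ioo 0 R :=
    (withDensity_absolutelyContinuous _ _).ae_le (ae_restrict_mem measurableSet_Ioo)
  have hg' : Continuous fun r => (g r : ℂ) := Complex.continuous_ofReal.comp hg
  obtain ⟨C, hC⟩ := isCompact_Icc.exists_bound_of_continuousOn (s := Set.Icc 0 R) hg'.continuousOn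
  have hae : (fun r => (f r : ℂ)) =ᵐ[radialMeasure R] fun r => (g r : ℂ) := by
    filter_upwards [hmem] with r hr
    rw [h r hr.1]
  refine (memLp_congr_ae hae).mpr (MemLp.of_bound hg'.aestronglyMeasurable C ?_)
  filter_upwards [hmem] with r hr using hC r (Set.Ioo_subset_Icc_self hr)

theorem explicitSpinor_properties {R m τ lam : ℝ} (hR : 0 < R) {n : ℕ} {s : Branch}
    (hlam : m ^ 2 < lam ^ 2) (hrel : BoundaryRelation R m τ n s lam) {M : ℤ}
    (h1 : -((n : ℤ) + 1) ≤ M) (h2 : M ≤ n) :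
    explicitSpinor m s n M lam ∈ partialWaveSpace R s n M ∧
      IsEigenfunction R m τ (lam : ℂ) (explicitSpinor m s n M lam) := by
  obtain ⟨P, hP, hP0, hPm, hPp⟩ := exists_monogenic n M h1 h2
  set w : ℝ := Real.sqrt (lam ^ 2 - m ^ 2) with hwdef
  have hw : 0 < w := Real.sqrt_pos.mpr (sub_pos.mpr hlam)
  have hw2 : (w : ℂ) ^ 2 = (lam : ℂ) ^ 2 - (m : ℂ) ^ 2 := by
    have := Real.sq_sqrt (sub_pos.mpr hlam).le
    rw [hwdef]
    exact_mod_cast this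
  have hadd : lam + m ≠ 0 := fun h => by
    have : lam = -m := by linarith
    simp [this] at hlam
  have haddc : (lam : ℂ) + m ≠ 0 := by exact_mod_cast hadd
  have hRc : (R : ℂ) ≠ 0 := by exact_mod_cast hR.ne'
  -- Chosen so that κr² = (wr/2)², the argument of Φ_p in J_p(wr).
  set κ : ℝ := w ^ 2 / 4
  have hκ : (κ : ℂ) = (w : ℂ) ^ 2 / 4 := by simp [κ]
  set C : ℝ := (w / 2) ^ ((n : ℝ) + 1 / 2) with hC
  have hCpos : 0 < C := Real.rpow_pos_of_pos (by positivity) _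
  obtain ⟨x₀, hx₀, hlow0, hup0⟩ := exists_waves_ne_zero hP0 hPm hR κ
  have hI := Complex.I_mul_I
  have hrad : ∀ x : E3, ‖x‖ = R → (radialPhi (n + 1 / 2) κ x = besselEven n (R * w)) ∧
      R * w / 2 * radialPhi (n + 3 / 2) κ x = besselOdd n (R * w) := fun x hx => by
    rw [radialPhi, radialPhi, hx, besselEven, besselOdd,
      show κ * R ^ 2 = (R * w / 2) ^ 2 by simp only [κ]; ring]
    refine ⟨rfl, by push_cast; ring⟩
  have hnu : ∀ x v a, sigmaMul (outwardNormal R x) v a = (R : ℂ)⁻¹ * sigmaMul x v a :=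
    fun x v a => by rw [outwardNormal, sigmaMul_smul]; push_cast; rfl
  have hfL : MemLp (fun r => ((1 / Real.sqrt r * besselJ (n + 1 / 2) (w * r) : ℝ) : ℂ)) 2
      (radialMeasure R) := memLp_radialMeasure
    (by have := (contDiff_besselPhi (p := (n : ℝ) + 1 / 2) (by positivity)).continuous; fun_prop)
    fun r hr => inv_sqrt_mul_besselJ_half hw hr n
  have hgL : MemLp (fun r => ((1 / Real.sqrt r * besselJ (n + 3 / 2) (w * r) : ℝ) : ℂ)) 2
      (radialMeasure R) := memLp_radialMeasure
    (by have := (contDiff_besselPhi (p := (n : ℝ) + 3 / 2) (by positivity)).continuous; fun_prop)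
    fun r hr => inv_sqrt_mul_besselJ_three_half hw hr n
  suffices hmain : ∃ u v : E3 → Fin 2 → ℂ, (∀ a, ContDiff ℝ ∞ fun x => u x a) ∧
      (∀ a, ContDiff ℝ ∞ fun x => v x a) ∧
      (∀ x, x ≠ 0 → explicitSpinor m s n M lam x = Sum.elim (u x) (v x)) ∧
      (∀ x a, ‖x‖ = R → v x a =
        Complex.I * Real.exp τ * sigmaMul (outwardNormal R x) (u x) a) ∧
      (∀ x a, x ≠ 0 → -Complex.I * sigmaGrad u x a = (lam + m) * v x a) ∧
      (∀ x a, x ≠ 0 → -Complex.I * sigmaGrad v x a = (lam - m) * u x a) ∧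
      (∃ x, ‖x‖ < R ∧ u x ≠ 0) by
    obtain ⟨u, v, hu, hv, heq, hb, hl, hup, hne⟩ := hmain
    have heig := isEigenfunction_of_smooth hR hu hv heq hb hl hup hne
    refine ⟨⟨fun a => (heig.mem_domain.1 a).choose_spec.memLp, _, _, ?_, ?_,
      Eventually.of_forall fun x => rfl⟩, heig⟩
    · match s with
      | .minus => rw [ellOf_minus_add_half]; exact hfL
      | .plus => rw [ellOf_plus_add_half]; exact hgL
    · match s with
      | .minus =>
        simp only [Branch.opp, ellOf_plus_add_half]
        refine (hgL.const_mul ((Branch.sgn .minus * (w / (lam + m)) : ℝ) : ℂ)).ae_eq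
          (Eventually.of_forall fun r => ?_)
        simp only
        push_cast
        ring
      | .plus =>
        simp only [Branch.opp, ellOf_minus_add_half]
        refine (hfL.const_mul ((Branch.sgn .plus * (w / (lam + m)) : ℝ) : ℂ)).ae_eq
          (Eventually.of_forall fun r => ?_)
        simp only
        push_cast
        ring
  have hsl : ∀ x a, sigmaMul x (lowerWave n P κ x) a =
      radialPhi (n + 1 / 2) κ x * sigmaMul x (P x) a := fun x a => sigmaMul_const_mul x _ (P x) a
  have hsu : ∀ x a, sigmaMul x (upperWave n P κ x) a =
      radialPhi (n + 3 / 2) κ x * ((‖x‖ : ℂ) ^ 2 * P x a) := fun x a => by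
    rw [← sigmaMul_sigmaMul]
    exact sigmaMul_const_mul x _ (sigmaMul x (P x)) a
  have hls := hP.contDiff_lowerWave κ
  have hus := hP.contDiff_upperWave κ
  match s, hrel with
  | .minus, hrel =>
    simp only [BoundaryRelation, ← hwdef] at hrel
    have hrelc := congrArg ((↑) : ℝ → ℂ) hrel
    push_cast at hrelc
    -- The lower coefficient of the explicit spinor, with sign -1 for this branch, times the
    -- constant C w/2 of `upperWave_eq`.
    set d : ℂ := -(w / (lam + m)) * (C * (w / 2)) with hd
    refine ⟨fun x a => Complex.I * C * lowerWave n P κ x a, fun x a => d * upperWave n P κ x a,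
      fun a => contDiff_const.mul (hls a), fun a => contDiff_const.mul (hus a), fun x hx => ?_,
      fun x a hx => ?_, fun x a hx => ?_, fun x a hx => ?_, x₀, hx₀, fun h => ?_⟩
    · ext (a | a)
      · have e := lowerWave_eq hPm hw hx a
        simp only [explicitSpinor, separatedSpinor, Sum.elim_inl, Pi.smul_apply, smul_eq_mul,
          ellOf_minus_add_half, ← hwdef]
        linear_combination Complex.I * e
      · have e := upperWave_eq hPp hw hx a
        simp only [explicitSpinor, separatedSpinor, Sum.elim_inr, Pi.smul_apply, smul_eq_mul,
          Branch.opp, ellOf_plus_add_half, ← hwdef, hd, Branch.sgn]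
        push_cast at e ⊢
        linear_combination -(w / (lam + m)) * e
    · obtain ⟨e1, e2⟩ := hrad x hx
      rw [hnu, sigmaMul_const_mul]
      simp only [upperWave]
      rw [hsl, e1, hd]
      rw [← e2] at hrelc
      generalize radialPhi (n + 3 / 2) κ x = F at hrelc ⊢
      rw [Complex.ofReal_exp]
      field_simp
      linear_combination -2 * C * sigmaMul x (P x) a * hrelc
        - 2 * (lam + m) * C * sigmaMul x (P x) a * Complex.exp τ * besselEven n (R * w) * hI
    · rw [sigmaGrad_const_mul _ hls, hP.sigmaGrad_lowerWave κ hx, hκ, hd]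
      field_simp
      linear_combination (C * upperWave n P κ x a * w ^ 2 * 4) * hI
    · rw [sigmaGrad_const_mul _ hus, hP.sigmaGrad_upperWave κ hx, hd]
      field_simp
      linear_combination (C * lowerWave n P κ x a) * hw2
    · refine hlow0 (funext fun a => ?_)
      have := congrFun h a
      simpa [hCpos.ne'] using this
  | .plus, hrel =>
    simp only [BoundaryRelation, ← hwdef] at hrel
    have hrelc := congrArg ((↑) : ℝ → ℂ) hrel
    push_cast at hrelc
    -- Now the lower two-spinor carries the lower wave, so its constant is the C of `lowerWave_eq`,
    -- with sign +1.
    set d : ℂ := w / (lam + m) * C with hd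
    refine ⟨fun x a => Complex.I * (C * (w / 2)) * upperWave n P κ x a,
      fun x a => d * lowerWave n P κ x a,
      fun a => contDiff_const.mul (hus a), fun a => contDiff_const.mul (hls a), fun x hx => ?_,
      fun x a hx => ?_, fun x a hx => ?_, fun x a hx => ?_, x₀, hx₀, fun h => ?_⟩
    · ext (a | a)
      · have e := upperWave_eq hPp hw hx a
        simp only [explicitSpinor, separatedSpinor, Sum.elim_inl, Pi.smul_apply, smul_eq_mul,
          ellOf_plus_add_half, ← hwdef]
        push_cast at e ⊢
        linear_combination Complex.I * e
      · have e := lowerWave_eq hPm hw hx a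
        simp only [explicitSpinor, separatedSpinor, Sum.elim_inr, Pi.smul_apply, smul_eq_mul,
          Branch.opp, ellOf_minus_add_half, ← hwdef, hd, Branch.sgn]
        push_cast at e ⊢
        linear_combination (w / (lam + m)) * e
    · obtain ⟨e1, e2⟩ := hrad x hx
      rw [hnu, sigmaMul_const_mul]
      simp only [lowerWave]
      rw [hsu, e1, hd, hx]
      rw [← e2] at hrelc
      generalize radialPhi (n + 3 / 2) κ x = F at hrelc ⊢
      rw [Complex.ofReal_exp]
      field_simp
      linear_combination 2 * C * P x a * hrelc
        - w * (lam + m) * C * P x a * Complex.exp τ * R * F * hI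
    · rw [sigmaGrad_const_mul _ hus, hP.sigmaGrad_upperWave κ hx, hd]
      field_simp
      linear_combination -(C * w * lowerWave n P κ x a) * hI
    · rw [sigmaGrad_const_mul _ hls, hP.sigmaGrad_lowerWave κ hx, hκ, hd]
      field_simp
      linear_combination (4 * w * C * upperWave n P κ x a) * hw2
    · refine hup0 (funext fun a => ?_)
      have := congrFun h a
      simpa [hCpos.ne', hw.ne'] using this

end DiracBall

/-! ### The curves together with their eigenfunctions -/

open DiracBall
theorem propositionB2 (R m : ℝ) (hR : 0 < R) (hm : 0 ≤ m) (n : ℕ) :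
    ∃ lam : Branch → ℤ → ℝ → ℝ,
      (∀ s : Branch, Function.Injective (lam s)) ∧
      (∀ (s : Branch) (k : ℤ),
        ContDiff ℝ ∞ (lam s k) ∧
        StrictMono (lam s k) ∧
        Set.range (lam s k) = curveInterval R m s n k ∧
        ∀ τ : ℝ, IsEigenvalue R m τ ((lam s k τ : ℝ) : ℂ)) ∧
      ∀ (s : Branch) (k : ℤ) (τ : ℝ) (M : ℤ), -((n : ℤ) + 1) ≤ M → M ≤ (n : ℤ) →
        explicitSpinor m s n M (lam s k τ) ∈ partialWaveSpace R s n M ∧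
        IsEigenfunction R m τ ((lam s k τ : ℝ) : ℂ) (explicitSpinor m s n M (lam s k τ)) := by
  obtain ⟨lam, hinj, h⟩ := exists_curves hR hm n
  have hprop : ∀ (s : Branch) (k : ℤ) (τ : ℝ) (M : ℤ), -((n : ℤ) + 1) ≤ M → M ≤ (n : ℤ) →
        explicitSpinor m s n M (lam s k τ) ∈ partialWaveSpace R s n M ∧
        IsEigenfunction R m τ ((lam s k τ : ℝ) : ℂ) (explicitSpinor m s n M (lam s k τ)) :=
    fun s k τ M h1 h2 => explicitSpinor_properties hR ((h s k).2.2.2 τ).1 ((h s k).2.2.2 τ).2 h1 h2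
  -- The value M = 0, that is μ = 1/2, is admissible for every j and provides an eigenfunction.
  refine ⟨lam, hinj, fun s k => ⟨(h s k).1, (h s k).2.1, (h s k).2.2.1, fun τ =>
    ⟨_, (hprop s k τ 0 (by omega) (by omega)).2⟩⟩, hprop⟩
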